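/- Let $X$ be a quasi-compact, quasi-separated scheme and let $\mathrm{Qcoh}(X)$ be the abelian category of quasi-coherent sheaves of $\mathcal O_X$-modules. *Definitions.* A localizing subcategory of an abelian category $\mathcal C$ is a full subcategory $\mathcal S$ closed under subobjects, quotient objects, extensions and direct limits. The quotient category $\mathcal C/\mathcal S$ is obtained by inverting the morphisms whose kernel and cokernel lie in $\mathcal S$. An object $Z$ is $\mathcal S$-closed if $\mathrm{Hom}(B,Z)\to\mathrm{Hom}(A,Z)$ is bijective for each such morphism $A\to B$. The subcategory $\mathcal S$ is of finite type if the inclusion into $\mathcal C$ of the full subcategory of $\mathcal S$-closed objects (which is equivalent to $\mathcal C/\mathcal S$) preserves directed sums, that is, colimits of directed systems of monomorphisms. A localizing subcategory $\mathcal S$ of $\mathrm{Qcoh}(X)$ is tensor if $\mathcal F\otimes_{\mathcal O_X}\mathcal G\in\mathcal S$ for all $\mathcal F\in\mathcal S$ and $\mathcal G\in\mathrm{Qcoh}(X)$. Let $L$ be the collection of tensor localizing subcategories of finite type of $\mathrm{Qcoh}(X)$, ordered by inclusion and with intersection as multiplication. Its largest element is $\mathrm{Qcoh}(X)$. An element $\mathcal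 P\neq\mathrm{Qcoh}(X)$ of $L$ is prime if, for all $\mathcal A,\mathcal B\in L$, $\mathcal A\cap\mathcal B\subseteq\mathcal P$ implies $\mathcal A\subseteq\mathcal P$ or $\mathcal B\subseteq\mathcal P$. Let $\mathrm{Spec}\,L$ be the set of prime elements with the topology generated by the sets $D(\mathcal A)=\{\mathcal P : \mathcal A\not\subseteq\mathcal P\}$, $\mathcal A\in L$, and let $\mathrm{Spec}(\mathrm{Qcoh}\,X)$ be the same set with the Hochster dual topology, in which the open sets are the unions of complements of quasi-compact open subsets of $\mathrm{Spec}\,L$. For $\mathcal F\in\mathrm{Qcoh}(X)$ put $\mathrm{supp}(\mathcal F)=\{\mathcal P : \mathcal F\notin\mathcal P\}$, and for an open $U\subseteq\mathrm{Spec}(\mathrm{Qcoh}\,X)$ put $\mathcal S_U=\{\mathcal F : \mathrm{supp}(\mathcal F)\cap U=\emptyset\}$. Let $\mathcal O_{\mathrm{Qcoh}\,X}$ be the sheaf of rings associated with the presheaf $U\mapsto\mathrm{End}_{\mathrm{Qcoh}(X)/\mathcal S_U}(\mathcal O_X)$, whose restriction maps are induced by the quotient functors $\mathrm{Qcoh}(X)/\mathcal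 S_U\to\mathrm{Qcoh}(X)/\mathcal S_V$ for $V\subseteq U$. *Theorem.* The open subsets of $\mathrm{Spec}\,L$ are exactly the sets $D(\mathcal A)$, $\mathcal A\in L$ (equivalently, the closed subsets are exactly the sets $V(\mathcal A)=\{\mathcal P:\mathcal A\subseteq\mathcal P\}$). The map $$f\colon X\to\mathrm{Spec}(\mathrm{Qcoh}\,X),\qquad P\mapsto\mathcal S_P=\{\mathcal F\in\mathrm{Qcoh}(X) : \mathcal F_P=0\},$$ is well defined and underlies an isomorphism of ringed spaces $(X,\mathcal O_X)\cong(\mathrm{Spec}(\mathrm{Qcoh}\,X),\mathcal O_{\mathrm{Qcoh}\,X})$. That is, $f$ is a homeomorphism and there are ring isomorphisms $f^\sharp_U\colon\mathcal O_{\mathrm{Qcoh}\,X}(U)\to\mathcal O_X(f^{-1}(U))$, for $U$ open in $\mathrm{Spec}(\mathrm{Qcoh}\,X)$, compatible with restriction. Moreover $f^\sharp$ is induced by the restriction $\mathcal F\mapsto\mathcal F|_{f^{-1}(U)}$: if $\varphi\in\mathrm{End}_{\mathrm{Qcoh}(X)/\mathcal S_U}(\mathcal O_X)$ and if $s,a\colon\mathcal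 O_X\to\mathcal F$ are morphisms in $\mathrm{Qcoh}(X)$ such that the kernel and cokernel of $s$ lie in $\mathcal S_U$ and $s\circ\varphi=a$ in $\mathrm{Qcoh}(X)/\mathcal S_U$, then $s(f^\sharp_U(\varphi))=a(1)$ in $\mathcal F(f^{-1}(U))$. -/

import Mathlib

open CategoryTheory Limits AlgebraicGeometry TopologicalSpace Opposite

universe u

namespace Reconstruction

noncomputable section

open scoped ZeroObject

/-! ### The abelian category of quasi-coherent sheaves -/

/-- The property of a sheaf of modules of being quasi-coherent. -/
def isQcoh (X : Scheme.{u}) : ObjectProperty X.Modules := fun M => M.IsQuasicoherent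

lemma isQcoh_iso {X : Scheme.{u}} {M N : X.Modules} (e : M ≅ N) (h : isQcoh X M) : isQcoh X N := by
  exact (SheafOfModules.isQuasicoherent.{u} X.ringCatSheaf).prop_of_iso
    (X := M) (Y := N) e h

lemma isQcoh_spec_iff {R : CommRingCat.{u}} (M : (Spec R).Modules) :
    isQcoh _ M ↔ ∃ A : ModuleCat R, Nonempty (tilde A ≅ M) :=
  (iff_of_eq (congrFun (essImage_tilde (R := R)) M)).symm

lemma presentation_of_iso {X : Scheme.{u}} {M N : X.Modules} (e : M ≅ N)
    (P : SheafOfModules.Presentation M) : Nonempty (SheafOfModules.Presentation N) := by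
  have h : ∀ {M N : SheafOfModules.{u} X.ringCatSheaf} (_ : M ≅ N) (_ : M.Presentation),
      Nonempty N.Presentation :=
    fun e P => ⟨SheafOfModules.Presentation.ofIsIso.{u, u, u} e.hom P⟩
  exact h (M := M) (N := N) ⟨e.hom, e.inv, e.hom_inv_id, e.inv_hom_id⟩ P

lemma nonempty_presentation {R : CommRingCat.{u}} (M : (Spec R).Modules) (h : isQcoh _ M) :
    Nonempty (SheafOfModules.Presentation M) := by
  obtain ⟨A, ⟨e⟩⟩ := (isQcoh_spec_iff M).1 h
  exact presentation_of_iso e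
    (presentationTilde.{u} _ .univ (by simp) _ (Submodule.span_eq _))

/-- Quasi-coherence may be checked on the affine open subsets. -/
lemma isQcoh_of_restrict {X : Scheme.{u}} (M : X.Modules)
    (h : ∀ (U : X.Opens) (hU : IsAffineOpen U), isQcoh _ (M.restrict hU.fromSpec)) :
    isQcoh X M := by
  have key : ∀ U : X.affineOpens, Nonempty
      ((SheafOfModules.over (R := X.ringCatSheaf) M U.1).Presentation) := by
    intro U
    have hU : IsAffineOpen U.1 := U.2
    generalize U.1 = U at hU ⊢
    obtain ⟨P⟩ := nonempty_presentation _ (h U hU)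
    let e₁ : (M.restrict hU.fromSpec).restrict hU.isoSpec.hom ≅ M.restrict U.ι :=
      (Scheme.Modules.restrictFunctorComp hU.isoSpec.hom hU.fromSpec).symm.app M ≪≫
        (Scheme.Modules.restrictFunctorCongr (by simp)).app M
    let e₂ : (Scheme.Modules.overEquiv U).functor.obj
        ((SheafOfModules.overFunctor X.ringCatSheaf U).obj M) ≅ M.restrict U.ι :=
      (Scheme.Modules.overFunctorEquiv U).app M
    obtain ⟨P₁⟩ := presentation_of_iso (e₁ ≪≫ e₂.symm)
        (Scheme.Modules.presentationRestrict hU.isoSpec.hom P)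
    let η : (Scheme.Modules.overEquiv U).functor.obj
        (SheafOfModules.unit (X.ringCatSheaf.over U)) ≅
        SheafOfModules.unit U.toScheme.ringCatSheaf :=
      (Scheme.Modules.overFunctorEquiv U).app (SheafOfModules.unit X.ringCatSheaf) ≪≫
        Scheme.Modules.restrictUnitIso U.ι
    let η' : SheafOfModules.unit (X.ringCatSheaf.over U) ≅
        (Scheme.Modules.overEquiv U).inverse.obj (SheafOfModules.unit U.toScheme.ringCatSheaf) :=
      (Scheme.Modules.overEquiv U).unitIso.app _ ≪≫ (Scheme.Modules.overEquiv U).inverse.mapIso η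
    have h₁ : PreservesColimitsOfSize.{u, u} (Scheme.Modules.overEquiv U).inverse := inferInstance
    let G : SheafOfModules.{u} U.toScheme.ringCatSheaf ⥤ SheafOfModules.{u} (X.ringCatSheaf.over U) :=
      (Scheme.Modules.overEquiv U).inverse
    have h₂ : PreservesColimitsOfSize.{u, u} G := h₁
    let e₃ : G.obj ((Scheme.Modules.overEquiv U).functor.obj
        ((SheafOfModules.overFunctor X.ringCatSheaf U).obj M)) ≅ SheafOfModules.over M U :=
      ((Scheme.Modules.overEquiv U).unitIso.app _).symm
    exact ⟨SheafOfModules.Presentation.ofIsIso.{u, u, u} e₃.hom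
      (SheafOfModules.Presentation.map P₁ G η')⟩
  refine SheafOfModules.QuasicoherentData.isQuasicoherent.{u, u, u, u} (M := M)
    { I := X.affineOpens, X := fun U => U.1, coversTop := ?_, presentation := fun U => (key U).some }
  rw [Opens.coversTop_iff]
  exact iSup_affineOpens_eq_top X

lemma isQcoh_restrict {X Y : Scheme.{u}} (f : X ⟶ Y) [IsOpenImmersion f] (M : Y.Modules)
    (h : isQcoh Y M) : isQcoh X (M.restrict f) := by
  have : M.IsQuasicoherent := h
  exact Scheme.Modules.isQuasicoherent_restrictFunctor f M

lemma isQcoh_unit (X : Scheme.{u}) : isQcoh X (SheafOfModules.unit X.ringCatSheaf) := by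
  refine isQcoh_of_restrict _ fun U hU => ?_
  refine isQcoh_iso (Scheme.Modules.restrictUnitIso hU.fromSpec).symm ?_
  exact (isQcoh_spec_iff _).2 ⟨_, ⟨tildeSelf⟩⟩

lemma isQcoh_cokernel_spec {R : CommRingCat.{u}} {M N : (Spec R).Modules} (f : M ⟶ N)
    (hM : isQcoh _ M) (hN : isQcoh _ N) : isQcoh _ (cokernel f) := by
  obtain ⟨A, ⟨e₁⟩⟩ := (isQcoh_spec_iff M).1 hM
  obtain ⟨B, ⟨e₂⟩⟩ := (isQcoh_spec_iff N).1 hN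
  obtain ⟨g, hg⟩ := (tilde.functor R).map_surjective (X := A) (Y := B) (e₁.hom ≫ f ≫ e₂.inv)
  refine (isQcoh_spec_iff _).2 ⟨cokernel g, ⟨PreservesCokernel.iso (tilde.functor R) g ≪≫
    cokernel.mapIso _ _ e₁ e₂ ?_⟩⟩
  have h : (e₁.hom ≫ f ≫ e₂.inv) ≫ e₂.hom = e₁.hom ≫ f := by simp
  exact (congrArg (· ≫ e₂.hom) hg).trans h

lemma isQcoh_coprod_spec {R : CommRingCat.{u}} {M N : (Spec R).Modules}
    (hM : isQcoh _ M) (hN : isQcoh _ N) : isQcoh _ (M ⨿ N) := by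
  obtain ⟨A, ⟨e₁⟩⟩ := (isQcoh_spec_iff M).1 hM
  obtain ⟨B, ⟨e₂⟩⟩ := (isQcoh_spec_iff N).1 hN
  exact (isQcoh_spec_iff _).2 ⟨A ⨿ B,
    ⟨(PreservesColimitPair.iso (tilde.functor R) _ _).symm ≪≫ coprod.mapIso e₁ e₂⟩⟩

lemma isQcoh_cokernel {X : Scheme.{u}} {M N : X.Modules} (f : M ⟶ N)
    (hM : isQcoh _ M) (hN : isQcoh _ N) : isQcoh _ (cokernel f) := by
  refine isQcoh_of_restrict _ fun U hU => ?_
  exact isQcoh_iso (PreservesCokernel.iso (Scheme.Modules.restrictFunctor hU.fromSpec) f).symm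
    (isQcoh_cokernel_spec _ (isQcoh_restrict _ _ hM) (isQcoh_restrict _ _ hN))

lemma isQcoh_coprod {X : Scheme.{u}} {M N : X.Modules}
    (hM : isQcoh _ M) (hN : isQcoh _ N) : isQcoh _ (M ⨿ N) := by
  refine isQcoh_of_restrict _ fun U hU => ?_
  exact isQcoh_iso (PreservesColimitPair.iso (Scheme.Modules.restrictFunctor hU.fromSpec) _ _)
    (isQcoh_coprod_spec (isQcoh_restrict _ _ hM) (isQcoh_restrict _ _ hN))


lemma app_smul_spec {R : CommRingCat.{u}} {M N : (Spec R).Modules} (g : M ⟶ N)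
    (V : (Spec R).Opens) (r : R) (x : Γ(M, V)) : g.app V (r • x) = r • g.app V x := by
  rw [Scheme.Modules.smul_Spec_def, Scheme.Modules.smul_Spec_def, Scheme.Modules.Hom.app_smul]

lemma app_res {X : Scheme.{u}} {M N : X.Modules} (g : M ⟶ N) {U V : X.Opens} (h : U ≤ V)
    (x : Γ(M, V)) :
    g.app U (M.presheaf.map (homOfLE h).op x) = N.presheaf.map (homOfLE h).op (g.app V x) :=
  congr($(g.mapPresheaf.naturality (homOfLE h).op) x)

/-- The basic open subset of an affine scheme. -/
def specBasicOpen {R : CommRingCat.{u}} (f : R) : (Spec R).Opens := PrimeSpectrum.basicOpen f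

lemma isLocalizing_iff_spec {R : CommRingCat.{u}} (M : (Spec R).Modules) :
    isQcoh _ M ↔ ∀ f : R,
      (∀ x : Γ(M, specBasicOpen f), ∃ (n : ℕ) (y : Γ(M, ⊤)),
        M.presheaf.map (homOfLE le_top).op y = f ^ n • x) ∧
      (∀ y : Γ(M, ⊤), M.presheaf.map (homOfLE (le_top : specBasicOpen f ≤ ⊤)).op y = 0 →
        ∃ n : ℕ, f ^ n • y = 0) := by
  refine ((isQuasicoherent_iff_isIso_fromTildeΓ M).trans
    (isIso_fromTildeΓ_iff_isLocalizing M)).trans (forall_congr' fun f => ⟨fun h => ?_, fun h => ?_⟩)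
  · refine ⟨fun x => ?_, fun y hy => ?_⟩
    · have h' : IsLocalizedModule.Away f
        ((modulesSpecToSheaf.obj M).obj.map (PrimeSpectrum.basicOpen f).leTop.op).hom := h
      obtain ⟨n, y, hy⟩ := h'.surj _ _ x
      exact ⟨n, y, hy.symm⟩
    · obtain ⟨⟨_, n, rfl⟩, hn⟩ := (IsLocalizedModule.eq_zero_iff (.powers f)
        ((modulesSpecToSheaf.obj M).obj.map (PrimeSpectrum.basicOpen f).leTop.op).hom).mp hy
      exact ⟨n, hn⟩
  · refine IsLocalizedModule.Away.mk_of_addCommGroup ?_ ?_ ?_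
    · exact Scheme.Modules.isUnit_algebraMap_end_of_le_basicOpen f le_rfl
    · intro x
      obtain ⟨n, y, hy⟩ := h.1 x
      exact ⟨n, y, hy.symm⟩
    · intro y hy
      exact h.2 y hy

lemma isQcoh_of_exact_spec {R : CommRingCat.{u}} {K M N : (Spec R).Modules} (i : K ⟶ M) (g : M ⟶ N)
    (hM : isQcoh _ M) (hN : isQcoh _ N)
    (hi : ∀ V, Function.Injective (i.app V)) (hig : ∀ V x, g.app V x = 0 ↔ ∃ y, i.app V y = x) :
    isQcoh _ K := by
  rw [isLocalizing_iff_spec] at hM hN ⊢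
  refine fun f => ⟨fun x => ?_, fun y hy => ?_⟩
  · obtain ⟨n, y, hy⟩ := (hM f).1 (i.app _ x)
    have h₀ : N.presheaf.map (homOfLE (le_top : specBasicOpen f ≤ ⊤)).op
        (g.app ⊤ y) = 0 := by
      rw [← app_res, hy, app_smul_spec, (hig _ _).2 ⟨x, rfl⟩, smul_zero]
    obtain ⟨m, hm⟩ := (hN f).2 _ h₀
    rw [← app_smul_spec] at hm
    obtain ⟨z, hz⟩ := (hig _ _).1 hm
    refine ⟨m + n, z, hi _ ?_⟩
    rw [app_res, hz, app_smul_spec, pow_add, mul_smul, ← hy]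
    exact Scheme.Modules.map_smul_Spec _ _ _
  · have h₀ : M.presheaf.map (homOfLE (le_top : specBasicOpen f ≤ ⊤)).op
        (i.app ⊤ y) = 0 := by
      rw [← app_res, hy, map_zero]
    obtain ⟨n, hn⟩ := (hM f).2 _ h₀
    refine ⟨n, hi _ ?_⟩
    rw [app_smul_spec, hn, map_zero]

lemma kernel_app {X : Scheme.{u}} {M N : X.Modules} (g : M ⟶ N) (V : X.Opens) :
    Function.Injective ((kernel.ι g).app V) ∧
      ∀ x, g.app V x = 0 ↔ ∃ y, (kernel.ι g).app V y = x := by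
  let E : TopCat.Presheaf Ab X ⥤ Ab := (evaluation X.Opensᵒᵖ Ab).obj (op V)
  let F : X.Modules ⥤ Ab := Scheme.Modules.toPresheaf X ⋙ E
  have hF : (F.map (kernel.ι g)) = (kernel.ι g).app V := rfl
  have : PreservesLimits (Scheme.Modules.toPresheaf X) := inferInstance
  have : PreservesLimitsOfSize.{0, 0} (Scheme.Modules.toPresheaf X) :=
    preservesLimitsOfSize_shrink _
  have : PreservesLimitsOfShape WalkingParallelPair E :=
    inferInstanceAs (PreservesLimitsOfShape WalkingParallelPair
      ((evaluation X.Opensᵒᵖ Ab.{u}).obj (op V)))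
  have : PreservesLimitsOfShape WalkingParallelPair F :=
    comp_preservesLimitsOfShape _ _
  have : F.PreservesZeroMorphisms := ⟨fun _ _ => rfl⟩
  have hl := KernelFork.mapIsLimit _ (kernelIsKernel g) F
  let S : ShortComplex Ab := ShortComplex.mk (F.map (kernel.ι g)) (F.map g)
    (by rw [← F.map_comp, kernel.condition]; rfl)
  have hS : S.Exact := S.exact_of_f_is_kernel hl
  have hm : Mono S.f := mono_of_isLimit_fork hl
  refine ⟨(AddCommGrpCat.mono_iff_injective S.f).1 hm, fun x => ⟨fun h => ?_, ?_⟩⟩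
  · exact (ShortComplex.ab_exact_iff S).1 hS x h
  · rintro ⟨y, rfl⟩
    exact S.ab_zero_apply y

lemma isQcoh_kernel {X : Scheme.{u}} {M N : X.Modules} (f : M ⟶ N)
    (hM : isQcoh _ M) (hN : isQcoh _ N) : isQcoh _ (kernel f) := by
  refine isQcoh_of_restrict _ fun U hU => ?_
  exact isQcoh_of_exact_spec
    ((Scheme.Modules.restrictFunctor hU.fromSpec).map (kernel.ι f))
    ((Scheme.Modules.restrictFunctor hU.fromSpec).map f)
    (isQcoh_restrict _ _ hM) (isQcoh_restrict _ _ hN)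
    (fun V => (kernel_app f (hU.fromSpec ''ᵁ V)).1) (fun V => (kernel_app f (hU.fromSpec ''ᵁ V)).2)

instance (X : Scheme.{u}) : (isQcoh X).IsClosedUnderIsomorphisms :=
  ⟨fun e h => isQcoh_iso e h⟩

instance (X : Scheme.{u}) : (isQcoh X).IsClosedUnderKernels where
  kernels_le := by
    rintro _ ⟨f, k, hk, hf⟩
    exact isQcoh_iso ((kernelIsKernel f).conePointUniqueUpToIso hk) (isQcoh_kernel f hf.1 hf.2)

instance (X : Scheme.{u}) : (isQcoh X).IsClosedUnderCokernels where
  cokernels_le := by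
    rintro _ ⟨f, k, hk, hf⟩
    exact isQcoh_iso ((cokernelIsCokernel f).coconePointUniqueUpToIso hk)
      (isQcoh_cokernel f hf.1 hf.2)

instance (X : Scheme.{u}) : (isQcoh X).ContainsZero where
  exists_zero := ⟨_, isZero_cokernel_of_epi (𝟙 (SheafOfModules.unit X.ringCatSheaf : X.Modules)),
    isQcoh_cokernel _ (isQcoh_unit X) (isQcoh_unit X)⟩

instance (X : Scheme.{u}) : (isQcoh X).IsClosedUnderBinaryProducts where
  limitsOfShape_le := by
    rintro M ⟨p⟩
    let e : M ≅ p.diag.obj ⟨.left⟩ ⨯ p.diag.obj ⟨.right⟩ :=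
      p.isLimit.conePointUniqueUpToIso
        ((IsLimit.postcomposeHomEquiv (diagramIsoPair p.diag).symm _).symm (prodIsProd _ _))
    refine isQcoh_iso (e ≪≫ (biprod.isoProd _ _).symm ≪≫ biprod.isoCoprod _ _).symm
      (isQcoh_coprod (p.prop_diag_obj _) (p.prop_diag_obj _))

instance (X : Scheme.{u}) : (isQcoh X).IsClosedUnderFiniteProducts := .mk'

/-- The category of quasi-coherent sheaves on `X`. -/
abbrev Qcoh (X : Scheme.{u}) := (isQcoh X).FullSubcategory

/-- The structure sheaf, as an object of `Qcoh X`. -/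
def structureModule (X : Scheme.{u}) : Qcoh X := ⟨SheafOfModules.unit X.ringCatSheaf, isQcoh_unit X⟩

/-! ### Localizing subcategories and quotient categories -/

section Localizing

universe v w
variable {C : Type w} [Category.{v} C] [Abelian C]

/-- A localizing subcategory: a Serre subcategory closed under direct limits. -/
class IsLocalizingSubcategory (S : ObjectProperty C) : Prop extends S.IsSerreClass where
  closedUnderFilteredColimits (J : Type v) [SmallCategory J] [IsFiltered J] :
    S.IsClosedUnderColimitsOfShape J

/-- The `S`-closed objects: those `Z` such that `Hom(B, Z) → Hom(A, Z)` is bijective for every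
`A ⟶ B` whose kernel and cokernel are in `S`; equivalently, `Hom(A, Z) = 0` and `Ext¹(A, Z) = 0` for
every `A` in `S`. -/
def closedObjects (S : ObjectProperty C) [S.IsSerreClass] : ObjectProperty C :=
  S.isoModSerre.isLocal

/-- `S` is of finite type if the inclusion of the full subcategory of `S`-closed objects (which is
the inclusion `C/S ⥤ C`) preserves directed sums, that is the colimits of directed systems of
monomorphisms. -/
def IsOfFiniteType (S : ObjectProperty C) [S.IsSerreClass] : Prop :=
  ∀ (J : Type v) [PartialOrder J] [IsDirectedOrder J] [Nonempty J]
    (F : J ⥤ (closedObjects S).FullSubcategory),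
    (∀ {i j : J} (f : i ⟶ j), Mono (F.map f)) → PreservesColimit F (closedObjects S).ι

/-- The quotient category `C/S`: the category obtained from `C` by inverting the morphisms whose
kernel and cokernel are in `S`. -/
abbrev QuotientCategory (S : ObjectProperty C) [S.IsSerreClass] := S.isoModSerre.Localization

/-- The quotient functor `C ⥤ C/S`. -/
abbrev toQuotient (S : ObjectProperty C) [S.IsSerreClass] : C ⥤ QuotientCategory S :=
  S.isoModSerre.Q

variable {S T R : ObjectProperty C} [S.IsSerreClass] [T.IsSerreClass] [R.IsSerreClass]

lemma isInvertedBy_toQuotient (h : S ≤ T) : S.isoModSerre.IsInvertedBy (toQuotient T) :=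
  fun _ _ f hf => T.isoModSerre.Q_inverts f ⟨h _ hf.1, h _ hf.2⟩

/-- The functor `C/S ⥤ C/T` induced by the quotient functors when `S ⊆ T`. -/
def quotientFunctor (h : S ≤ T) : QuotientCategory S ⥤ QuotientCategory T :=
  Localization.Construction.lift (toQuotient T) (isInvertedBy_toQuotient h)

lemma toQuotient_comp (h : S ≤ T) : toQuotient S ⋙ quotientFunctor h = toQuotient T :=
  Localization.Construction.fac _ _

instance (h : S ≤ T) : (quotientFunctor h).Additive := by
  rw [Localization.functor_additive_iff (toQuotient S) S.isoModSerre, toQuotient_comp]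
  infer_instance

/-- The ring `End_{C/S}(A)` of endomorphisms of the image of `A` in the quotient category. -/
def quotientEnd (S : ObjectProperty C) [S.IsSerreClass] (A : C) : RingCat.{max v w} :=
  RingCat.of (End ((toQuotient S).obj A))

/-- The ring homomorphism `End_{C/S}(A) → End_{C/T}(A)` induced by the functor `C/S ⥤ C/T` when
`S ⊆ T`. -/
def quotientEndMap (A : C) (h : S ≤ T) : quotientEnd S A ⟶ quotientEnd T A :=
  RingCat.ofHom
    { toFun := fun φ => (quotientFunctor h).map φ
      map_one' := (quotientFunctor h).map_id _
      map_mul' := fun φ ψ => (quotientFunctor h).map_comp ψ φ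
      map_zero' := (quotientFunctor h).map_zero _ _
      map_add' := fun _ _ => (quotientFunctor h).map_add }

lemma quotientEndMap_refl (A : C) : quotientEndMap A (le_refl S) = 𝟙 (quotientEnd S A) := by
  have h : quotientFunctor (le_refl S) = 𝟭 _ :=
    Localization.Construction.uniq _ _ (toQuotient_comp _)
  ext φ
  exact (Functor.congr_hom h (X := (toQuotient S).obj A) (Y := (toQuotient S).obj A) φ).trans
    ((Category.id_comp _).trans (Category.comp_id _))

lemma quotientEndMap_trans (A : C) (h : S ≤ T) (h' : T ≤ R) :
    quotientEndMap A (h.trans h') = quotientEndMap A h ≫ quotientEndMap A h' := by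
  have e : quotientFunctor (h.trans h') = quotientFunctor h ⋙ quotientFunctor h' := by
    refine Localization.Construction.uniq _ _ ?_
    rw [← Functor.assoc, toQuotient_comp h]
    exact (toQuotient_comp _).trans (toQuotient_comp _).symm
  ext φ
  exact (Functor.congr_hom e (X := (toQuotient S).obj A) (Y := (toQuotient S).obj A) φ).trans
    ((Category.id_comp _).trans (Category.comp_id _))

end Localizing

/-! ### Tensor localizing subcategories of finite type -/

/-- The tensor product of sheaves of modules over the structure sheaf: the sheaf associated with
`U ↦ M(U) ⊗ N(U)`, the tensor product being over the ring of sections over `U`. -/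
def tensor {X : Scheme.{u}} (M N : X.Modules) : X.Modules :=
  (PresheafOfModules.sheafification (𝟙 X.ringCatSheaf.obj)).obj
    (PresheafOfModules.Monoidal.tensorObj (R := X.presheaf) M.val N.val)

/-- A tensor localizing subcategory of finite type of `Qcoh X`: a localizing subcategory of finite
type that contains `F ⊗ G` whenever it contains `F`, for every quasi-coherent `G`. These are the
elements of the lattice; the order is inclusion and the product of two elements is their
intersection. (The tensor product of quasi-coherent sheaves is quasi-coherent, so `h` always
exists; it is only there to make `F ⊗ G` an object of `Qcoh X`.) -/
structure TensorLocalizing (X : Scheme.{u}) where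
  /-- the underlying class of objects -/
  carrier : ObjectProperty (Qcoh X)
  [isLocalizing : IsLocalizingSubcategory carrier]
  isOfFiniteType : IsOfFiniteType carrier
  isTensor (F G : Qcoh X) : carrier F →
    ∃ h : isQcoh X (tensor F.obj G.obj), carrier ⟨tensor F.obj G.obj, h⟩

attribute [instance] TensorLocalizing.isLocalizing

/-- The prime elements of the lattice of tensor localizing subcategories of finite type: an element
`p` other than the largest element (all of `Qcoh X`) is prime if `A ∩ B ≤ p` implies `A ≤ p` or
`B ≤ p`. -/
structure LatticeSpec (X : Scheme.{u}) where
  /-- the underlying element of the lattice -/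
  toTensorLocalizing : TensorLocalizing X
  ne_top : toTensorLocalizing.carrier ≠ ⊤
  prime (A B : TensorLocalizing X) : A.carrier ⊓ B.carrier ≤ toTensorLocalizing.carrier →
    A.carrier ≤ toTensorLocalizing.carrier ∨ B.carrier ≤ toTensorLocalizing.carrier

/-- The prime element `p` as a class of objects of `Qcoh X`. -/
def LatticeSpec.subcategory {X : Scheme.{u}} (p : LatticeSpec X) : ObjectProperty (Qcoh X) :=
  p.toTensorLocalizing.carrier

instance {X : Scheme.{u}} (p : LatticeSpec X) : p.subcategory.IsSerreClass :=
  inferInstanceAs p.toTensorLocalizing.carrier.IsSerreClass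

/-- The set `D(A)` of the primes `p` with `A ≰ p`, the complement of `V(A) = {p | A ≤ p}`. -/
def LatticeSpec.basicOpen {X : Scheme.{u}} (A : TensorLocalizing X) : Set (LatticeSpec X) :=
  {p | ¬ A.carrier ≤ p.subcategory}

/-- The Zariski topology on the prime spectrum of the lattice, generated by the sets `D(A)`. -/
instance (X : Scheme.{u}) : TopologicalSpace (LatticeSpec X) :=
  .generateFrom (Set.range LatticeSpec.basicOpen)

/-- The Hochster dual of a topology: the open subsets are the unions of complements of quasi-compact
open subsets. -/
@[reducible] def hochsterDual (α : Type*) [TopologicalSpace α] : TopologicalSpace α where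
  IsOpen U := ∃ 𝒦 : Set (Set α), (∀ K ∈ 𝒦, IsOpen K ∧ IsCompact K) ∧ U = ⋃ K ∈ 𝒦, Kᶜ
  isOpen_univ := ⟨{∅}, by simp, by simp⟩
  isOpen_inter := by
    rintro _ _ ⟨𝒦, h𝒦, rfl⟩ ⟨ℒ, hℒ, rfl⟩
    refine ⟨Set.image2 (· ∪ ·) 𝒦 ℒ, ?_, ?_⟩
    · rintro _ ⟨K, hK, L, hL, rfl⟩
      exact ⟨(h𝒦 K hK).1.union (hℒ L hL).1, (h𝒦 K hK).2.union (hℒ L hL).2⟩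
    · ext x
      simp only [Set.mem_inter_iff, Set.mem_iUnion, Set.mem_compl_iff, Set.mem_image2,
        exists_prop]
      constructor
      · rintro ⟨⟨K, hK, hx⟩, L, hL, hx'⟩
        exact ⟨K ∪ L, ⟨K, hK, L, hL, rfl⟩, by simp [hx, hx']⟩
      · rintro ⟨_, ⟨K, hK, L, hL, rfl⟩, hx⟩
        simp only [Set.mem_union, not_or] at hx
        exact ⟨⟨K, hK, hx.1⟩, L, hL, hx.2⟩
  isOpen_sUnion := by
    intro 𝒰 h𝒰
    choose! κ hκ hκ' using h𝒰
    refine ⟨⋃ U ∈ 𝒰, κ U, ?_, ?_⟩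
    · simp only [Set.mem_iUnion, exists_prop]
      rintro K ⟨U, hU, hK⟩
      exact hκ U hU K hK
    · ext x
      simp only [Set.mem_sUnion, Set.mem_iUnion, Set.mem_compl_iff, exists_prop]
      constructor
      · rintro ⟨U, hU, hx⟩
        rw [hκ' U hU] at hx
        simp only [Set.mem_iUnion, Set.mem_compl_iff, exists_prop] at hx
        obtain ⟨K, hK, hx⟩ := hx
        exact ⟨K, ⟨U, hU, hK⟩, hx⟩
      · rintro ⟨K, ⟨U, hU, hK⟩, hx⟩
        refine ⟨U, hU, ?_⟩
        rw [hκ' U hU]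
        simp only [Set.mem_iUnion, Set.mem_compl_iff, exists_prop]
        exact ⟨K, hK, hx⟩

/-- The space `Spec(Qcoh X)`: the prime spectrum of the lattice of tensor localizing subcategories
of finite type of `Qcoh X`, with the Hochster dual of the Zariski topology. -/
def SpecQcoh (X : Scheme.{u}) : TopCat.{u + 1} :=
  @TopCat.of (LatticeSpec X) (hochsterDual (LatticeSpec X))

/-- The support `supp F` of a quasi-coherent sheaf `F`: the set of points `p` of `SpecQcoh X` such
that `F` is not in `p`. -/
def SpecQcoh.support {X : Scheme.{u}} (F : Qcoh X) : Set (SpecQcoh X) :=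
  {p : LatticeSpec X | ¬ p.subcategory F}

/-- The subcategory `S_U` of the sheaves `F` with `supp F ∩ U = ∅`. -/
def supportedAway {X : Scheme.{u}} (U : Opens (SpecQcoh X)) : ObjectProperty (Qcoh X) :=
  fun F => SpecQcoh.support F ∩ U = ∅

lemma supportedAway_iff {X : Scheme.{u}} (U : Opens (SpecQcoh X)) (F : Qcoh X) :
    supportedAway U F ↔ ∀ p : LatticeSpec X, p ∈ (U : Set (SpecQcoh X)) → p.subcategory F := by
  rw [supportedAway, Set.eq_empty_iff_forall_notMem]
  exact forall_congr' fun p => ⟨fun h hp => by_contra fun hF => h ⟨hF, hp⟩,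
    fun h hp => hp.1 (h hp.2)⟩

lemma supportedAway_anti {X : Scheme.{u}} {U V : Opens (SpecQcoh X)} (h : V ≤ U) :
    supportedAway U ≤ supportedAway V := by
  intro F hF
  rw [supportedAway_iff] at hF ⊢
  exact fun p hp => hF p (h hp)

instance {X : Scheme.{u}} (U : Opens (SpecQcoh X)) : (supportedAway U).IsSerreClass where
  exists_zero := ⟨0, isZero_zero _, (supportedAway_iff _ _).2 fun p _ => p.subcategory.prop_zero⟩
  prop_of_mono f _ h := (supportedAway_iff _ _).2 fun p hp =>
    p.subcategory.prop_of_mono f ((supportedAway_iff _ _).1 h p hp)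
  prop_of_epi f _ h := (supportedAway_iff _ _).2 fun p hp =>
    p.subcategory.prop_of_epi f ((supportedAway_iff _ _).1 h p hp)
  prop_X₂_of_shortExact hS h₁ h₃ := (supportedAway_iff _ _).2 fun p hp =>
    p.subcategory.prop_X₂_of_shortExact hS ((supportedAway_iff _ _).1 h₁ p hp)
      ((supportedAway_iff _ _).1 h₃ p hp)

/-- The presheaf of rings `U ↦ End_{Qcoh(X)/S_U}(O_X)`; the restriction maps are induced by the
quotient functors `Qcoh(X)/S_U ⥤ Qcoh(X)/S_V` for `V ⊆ U`. -/
def endPresheaf (X : Scheme.{u}) : TopCat.Presheaf RingCat.{u + 1} (SpecQcoh X) where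
  obj U := quotientEnd (supportedAway U.unop) (structureModule X)
  map i := quotientEndMap _ (supportedAway_anti i.unop.le)
  map_id _ := quotientEndMap_refl _
  map_comp _ _ := quotientEndMap_trans _ _ _

/-- The structure sheaf of `Spec(Qcoh X)`: the sheaf of rings associated with `endPresheaf X`. -/
def specQcohSheaf (X : Scheme.{u}) : TopCat.Sheaf RingCat.{u + 1} (SpecQcoh X) :=
  (presheafToSheaf (Opens.grothendieckTopology (SpecQcoh X)) RingCat.{u + 1}).obj (endPresheaf X)

/-- The map from the sections over `U` of the presheaf `U ↦ End_{Qcoh(X)/S_U}(O_X)` to those of the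
associated sheaf. -/
def toSpecQcohSheaf (X : Scheme.{u}) (U : Opens (SpecQcoh X)) :
    End ((toQuotient (supportedAway U)).obj (structureModule X)) →
      (specQcohSheaf X).obj.obj (op U) :=
  fun φ => (CategoryTheory.toSheafify (Opens.grothendieckTopology (SpecQcoh X)) (endPresheaf X)).app
    (op U) φ

/-- The subcategory `S_P` of the sheaves `F` with zero stalk at `P`. -/
def vanishingAt {X : Scheme.{u}} (P : X) : ObjectProperty (Qcoh X) :=
  fun F => IsZero (TopCat.Presheaf.stalk F.obj.presheaf P)

/-- The map that a morphism `O_X ⟶ F` induces on sections over an open set `V`. -/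
def onSections {X : Scheme.{u}} {F : Qcoh X} (a : structureModule X ⟶ F) (V : X.Opens) :
    Γ(X, V) → Γ(F.obj, V) :=
  fun r => a.hom.app V r

end
end Reconstruction

open Reconstruction

/-! The elements of the lattice correspond to the Thomason subsets of `X`: a subcategory `A` goes to
the union `supportOf A` of the supports of its objects, and `V` goes to the sheaves `supportedOn V`.

A subcategory is recovered from its support (`carrier_eq_supportedOn`). Closure under tensor
products gives closure under direct images of restrictions to affine open subsets
(`prop_extend_sec`), so membership can be tested on a finite affine cover (`prop_of_sections`),
where it becomes membership in a hereditary torsion class of modules. Finite type implies that every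
ideal with torsion quotient contains a finitely generated one with torsion quotient
(`exists_fg_torsionClass`). By Zorn's lemma each ideal with non-torsion quotient then lies in a
prime with non-torsion quotient, so the support decides membership. The same finiteness makes the
support Thomason.

Conversely, let `V` be Thomason. An object is closed for `supportedOn V` exactly when its sections
over an affine `W` agree with those over `W ⊓ U`, for all quasi-compact open `U` containing the
complement of `V` (`closedObjects_iff`). Only sections over quasi-compact open subsets occur, and
these commute with directed unions; hence `supportedOn V` is of finite type.

By compactness of the constructible topology, the prime Thomason subsets are the sets of points not
specializing to a given point (`IsThomason.exists_eq_nonGeneralizations`). The open subsets of the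
lattice spectrum are therefore the Thomason subsets, the quasi-compact ones are the complements of
quasi-compact open subsets of `X`, and the Hochster dual gives back the topology of `X`.

For the structure sheaf: a morphism with kernel and cokernel in `S_U` is bijective on sections over
`U`, so the endomorphisms in the quotient category act on `Γ(X, U)`. Evaluation at 1 is an injective
ring homomorphism to `Γ(X, U)`, surjective for quasi-compact `U`. The resulting map of presheaves is
locally bijective and its target is a sheaf, so it identifies the associated sheaf with the
structure sheaf of `X`. -/

namespace Reconstruction

open scoped Topology

/-! ### Thomason subsets -/

section Topology

variable {X : Type*} [TopologicalSpace X]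

/-- A Thomason subset: a union of closed subsets with quasi-compact complements. -/
def IsThomason (V : Set X) : Prop :=
  ∀ x ∈ V, ∃ U : Set X, IsOpen U ∧ IsCompact U ∧ x ∉ U ∧ Uᶜ ⊆ V

lemma IsThomason.of_compl {U : Set X} (hU : IsOpen U) (hU' : IsCompact U) : IsThomason Uᶜ :=
  fun _ hx => ⟨U, hU, hU', hx, subset_rfl⟩

lemma IsThomason.univ : IsThomason (Set.univ : Set X) :=
  fun _ _ => ⟨∅, isOpen_empty, isCompact_empty, by simp, by simp⟩

lemma IsThomason.inter {V W : Set X} (hV : IsThomason V) (hW : IsThomason W) :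
    IsThomason (V ∩ W) := by
  rintro x ⟨hx, hx'⟩
  obtain ⟨U, h₁, h₂, h₃, h₄⟩ := hV x hx
  obtain ⟨U', h₁', h₂', h₃', h₄'⟩ := hW x hx'
  refine ⟨U ∪ U', h₁.union h₁', h₂.union h₂', by simp [h₃, h₃'], ?_⟩
  rw [Set.compl_union]
  exact Set.inter_subset_inter h₄ h₄'

lemma IsThomason.sUnion {𝒱 : Set (Set X)} (h : ∀ V ∈ 𝒱, IsThomason V) :
    IsThomason (⋃₀ 𝒱) := by
  rintro x ⟨V, hV, hx⟩
  obtain ⟨U, h₁, h₂, h₃, h₄⟩ := h V hV x hx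
  exact ⟨U, h₁, h₂, h₃, h₄.trans (Set.subset_sUnion_of_mem hV)⟩

lemma IsThomason.stableUnderSpecialization {V : Set X} (hV : IsThomason V) {x y : X}
    (h : x ⤳ y) (hx : x ∈ V) : y ∈ V := by
  obtain ⟨U, h₁, -, h₃, h₄⟩ := hV x hx
  exact h₄ fun hy => h₃ (h.mem_open h₁ hy)

/-- The set of the points which do not specialize to `x`. -/
def nonGeneralizations (x : X) : Set X := {y | ¬ y ⤳ x}

lemma exists_isCompact_of_not_specializes [PrespectralSpace X] {x y : X} (h : ¬ y ⤳ x) :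
    ∃ U : Set X, IsOpen U ∧ IsCompact U ∧ x ∈ U ∧ y ∉ U := by
  rw [specializes_iff_forall_open] at h
  push Not at h
  obtain ⟨s, hs, hx, hy⟩ := h
  obtain ⟨U, ⟨h₁, h₂⟩, hxU, hUs⟩ :=
    (PrespectralSpace.isTopologicalBasis (X := X)).exists_subset_of_mem_open hx hs
  exact ⟨U, h₁, h₂, hxU, fun hyU => hy (hUs hyU)⟩

lemma isThomason_nonGeneralizations [PrespectralSpace X] (x : X) :
    IsThomason (nonGeneralizations x) := by
  intro y hy
  obtain ⟨U, h₁, h₂, hx, hyU⟩ := exists_isCompact_of_not_specializes hy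
  exact ⟨U, h₁, h₂, hyU, fun z hz hzx => hz (hzx.mem_open h₁ hx)⟩

lemma isClosed_constructible_compl {U : Set X} (h : IsOpen U) (h' : IsCompact U) :
    IsClosed[constructibleTopology X] Uᶜ := by
  rw [← @isOpen_compl_iff _ _ (constructibleTopology X), compl_compl]
  exact IsCompact.isOpen_constructibleTopology_of_isOpen h' h

lemma isOpen_constructible_of_isOpen [PrespectralSpace X] {U : Set X} (hU : IsOpen U) :
    IsOpen[constructibleTopology X] U := by
  refine (@isOpen_iff_forall_mem_open X (constructibleTopology X) U).2 fun x hx => ?_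
  obtain ⟨V, ⟨h₁, h₂⟩, hxV, hVU⟩ :=
    (PrespectralSpace.isTopologicalBasis (X := X)).exists_subset_of_mem_open hx hU
  exact ⟨V, hVU, IsCompact.isOpen_constructibleTopology_of_isOpen h₂ h₁, hxV⟩

/-- Complements of quasi-compact open subsets are open in the constructible topology; its
compactness thus applies to covers by Thomason subsets. -/
lemma IsThomason.isOpen_constructible {V : Set X} (hV : IsThomason V) :
    IsOpen[constructibleTopology X] V := by
  refine (@isOpen_iff_forall_mem_open X (constructibleTopology X) V).2 fun x hx => ?_
  obtain ⟨U, h₁, h₂, h₃, h₄⟩ := hV x hx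
  exact ⟨Uᶜ, h₄, IsCompact.isOpen_constructibleTopology_of_isClosed (by simpa using h₂)
    (by simpa using h₁), h₃⟩

/-- A Thomason subset that is compact for the topology of Thomason subsets is closed, and its
complement is quasi-compact. -/
lemma IsThomason.isCompact_compl [CompactSpace X] [QuasiSeparatedSpace X] {V : Set X}
    (hV : IsThomason V)
    (h : ∀ 𝒵 : Set (Set X), (∀ Z ∈ 𝒵, IsThomason Z) → V ⊆ ⋃₀ 𝒵 →
      ∃ t ⊆ 𝒵, t.Finite ∧ V ⊆ ⋃₀ t) : IsClosed V ∧ IsCompact Vᶜ := by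
  -- Cover `V` by its closed pieces with quasi-compact complement. Finitely many suffice, so `Vᶜ` is
  -- a finite intersection of quasi-compact open subsets, quasi-compact by quasi-separatedness.
  let 𝒵 : Set (Set X) := {Z | ∃ U, IsOpen U ∧ IsCompact U ∧ Z = Uᶜ ∧ Z ⊆ V}
  obtain ⟨t, ht, htf, hVt⟩ := h 𝒵
    (by rintro _ ⟨U, h₁, h₂, rfl, -⟩; exact .of_compl h₁ h₂) fun x hx => by
      obtain ⟨U, h₁, h₂, h₃, h₄⟩ := hV x hx
      exact ⟨Uᶜ, ⟨U, h₁, h₂, rfl, h₄⟩, h₃⟩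
  have hV' : Vᶜ = ⋂₀ (compl '' t) := by
    rw [← Set.compl_sUnion]
    exact congrArg _ (hVt.antisymm (Set.sUnion_subset fun Z hZ => (ht hZ).choose_spec.2.2.2))
  have hO : ∀ U ∈ compl '' t, IsOpen U ∧ IsCompact U := by
    rintro _ ⟨Z, hZ, rfl⟩
    obtain ⟨U, h₁, h₂, rfl, -⟩ := ht hZ
    simpa using ⟨h₁, h₂⟩
  rw [← isOpen_compl_iff, hV']
  exact ⟨(htf.image _).isOpen_sInter fun U hU => (hO U hU).1,
    QuasiSeparatedSpace.isCompact_sInter (htf.image _) (fun U hU => .inl (hO U hU).1)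
      fun U hU => (hO U hU).2⟩

variable [CompactSpace X] [QuasiSober X] [PrespectralSpace X] [QuasiSeparatedSpace X]

lemma compactSpace_constructibleTopology : @CompactSpace X (constructibleTopology X) :=
  @Function.Surjective.compactSpace _ _ _ (constructibleTopology X) _
    (WithTopology.continuous_ofTopology _) inferInstance (WithTopology.ofTopology_surjective _)

/-- The finite intersection property for closed subsets of the constructible topology. -/
lemma nonempty_sInter_of_constructible (𝒞 : Set (Set X))
    (hc : ∀ C ∈ 𝒞, IsClosed[constructibleTopology X] C)
    (h : ∀ t ⊆ 𝒞, t.Finite → (⋂₀ t).Nonempty) : (⋂₀ 𝒞).Nonempty := by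
  have h' := compactSpace_constructibleTopology (X := X)
  exact @CompactSpace.nonempty_sInter X (constructibleTopology X) h' 𝒞 hc h

/-- A closed subset contained in a set that is open in the constructible topology is separated from
its complement by a quasi-compact open subset. -/
lemma exists_isCompact_compl_subset {V Z : Set X} (hV : IsOpen[constructibleTopology X] V)
    (hZ : IsClosed Z) (h : Z ⊆ V) :
    ∃ U : Set X, IsOpen U ∧ IsCompact U ∧ Disjoint U Z ∧ Uᶜ ⊆ V := by
  by_contra! hn
  -- If no `U` works, `Vᶜ` and the complements of the members of `𝒰` have the finite intersection
  -- property, as `𝒰` is stable under finite unions. A common point is outside `Z`, yet has a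
  -- quasi-compact neighbourhood in `𝒰`.
  let 𝒰 : Set (Set X) := {U | IsOpen U ∧ IsCompact U ∧ Disjoint U Z}
  have key : (⋂₀ (insert Vᶜ (compl '' 𝒰))).Nonempty := by
    refine nonempty_sInter_of_constructible _ ?_ fun t ht htf => ?_
    · rintro C (rfl | ⟨U, hU, rfl⟩)
      · let := constructibleTopology X
        exact hV.isClosed_compl
      · exact isClosed_constructible_compl hU.1 hU.2.1
    · let s : Set (Set X) := compl '' t ∩ 𝒰
      have hs : s.Finite := (htf.image _).inter_of_left _
      have hU : ⋃₀ s ∈ 𝒰 := ⟨isOpen_sUnion fun U hU => hU.2.1,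
        hs.isCompact_sUnion fun U hU => hU.2.2.1,
        Set.disjoint_sUnion_left.2 fun U hU => hU.2.2.2⟩
      obtain ⟨x, hx, hxV⟩ := Set.not_subset.1 (hn _ hU.1 hU.2.1 hU.2.2)
      refine ⟨x, fun C hC => ?_⟩
      obtain (rfl | ⟨U, hU, rfl⟩) := ht hC
      · exact hxV
      · exact fun hxU => hx ⟨U, ⟨⟨Uᶜ, hC, compl_compl _⟩, hU⟩, hxU⟩
  obtain ⟨x, hx⟩ := key
  have hxZ : x ∉ Z := fun hxZ => hx Vᶜ (Set.mem_insert _ _) (h hxZ)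
  obtain ⟨U, ⟨h₁, h₂⟩, hxU, hUZ⟩ :=
    (PrespectralSpace.isTopologicalBasis (X := X)).exists_subset_of_mem_open
      (a := x) (u := Zᶜ) hxZ hZ.isOpen_compl
  exact hx Uᶜ (Set.mem_insert_of_mem _ ⟨U, ⟨h₁, h₂, Set.disjoint_left.2 fun y hy => hUZ hy⟩, rfl⟩)
    hxU

/-- The closure of a point of `V` stays in `V`, so `exists_isCompact_compl_subset` separates it from
the complement. -/
lemma isThomason_of_isOpen_constructible {V : Set X} (hV : IsOpen[constructibleTopology X] V)
    (h : ∀ x y, x ⤳ y → x ∈ V → y ∈ V) : IsThomason V := by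
  intro x hx
  obtain ⟨U, h₁, h₂, h₃, h₄⟩ := exists_isCompact_compl_subset hV (isClosed_closure (s := {x}))
    fun y hy => h x y (specializes_iff_mem_closure.2 hy) hx
  exact ⟨U, h₁, h₂, fun hxU => Set.disjoint_left.1 h₃ hxU (subset_closure rfl), h₄⟩

/-- A proper Thomason subset that is prime with respect to intersections consists of the points
which do not specialize to a fixed point. -/
lemma IsThomason.exists_eq_nonGeneralizations {V : Set X} (hV : IsThomason V) (hne : V ≠ Set.univ)
    (hp : ∀ A B : Set X, IsThomason A → IsThomason B → A ∩ B ⊆ V → A ⊆ V ∨ B ⊆ V) :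
    ∃ x, V = nonGeneralizations x := by
  -- Primality of `V` keeps `𝒵` stable under finite intersections. By compactness some `x` outside
  -- `V` lies in every member of `𝒵`; this is the point sought.
  let 𝒵 : Set (Set X) := {Z | IsThomason Z ∧ IsClosed Z ∧ IsCompact Zᶜ ∧ ¬ Z ⊆ V}
  have huniv : Set.univ ∈ 𝒵 :=
    ⟨.univ, isClosed_univ, by simp, fun h => hne (Set.univ_subset_iff.1 h)⟩
  have hfin : ∀ t : Set (Set X), t.Finite → t ⊆ 𝒵 → ⋂₀ t ∈ 𝒵 := by
    intro t ht
    induction t, ht using Set.Finite.induction_on with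
    | empty => intro _; simpa using huniv
    | @insert Z t _ _ ih =>
      intro h
      obtain ⟨h₁, h₂, h₃, h₄⟩ := h (Set.mem_insert _ _)
      obtain ⟨h₁', h₂', h₃', h₄'⟩ := ih ((Set.subset_insert _ _).trans h)
      rw [Set.sInter_insert]
      refine ⟨h₁.inter h₁', h₂.inter h₂', ?_, fun hs => ?_⟩
      · rw [Set.compl_inter]
        exact h₃.union h₃'
      · exact (hp _ _ h₁ h₁' hs).elim h₄ h₄'
  have key : (⋂₀ (insert Vᶜ 𝒵)).Nonempty := by
    refine nonempty_sInter_of_constructible _ ?_ fun t ht htf => ?_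
    · rintro C (rfl | ⟨-, hC, hC', -⟩)
      · have h := hV.isOpen_constructible
        let := constructibleTopology X
        exact h.isClosed_compl
      · rw [← compl_compl C]
        exact isClosed_constructible_compl hC.isOpen_compl hC'
    · obtain ⟨x, hx, hxV⟩ := Set.not_subset.1
        (hfin (t ∩ 𝒵) (htf.inter_of_left _) Set.inter_subset_right).2.2.2
      refine ⟨x, fun C hC => ?_⟩
      obtain (rfl | hC') := ht hC
      · exact hxV
      · exact hx C ⟨hC, hC'⟩
  obtain ⟨x, hx⟩ := key
  have hxV : x ∉ V := hx Vᶜ (Set.mem_insert _ _)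
  refine ⟨x, Set.Subset.antisymm (fun y hy hyx => hxV (hV.stableUnderSpecialization hyx hy))
    fun y hy => ?_⟩
  by_contra hyV
  obtain ⟨U, h₁, h₂, hxU, hyU⟩ := exists_isCompact_of_not_specializes hy
  exact hx Uᶜ (Set.mem_insert_of_mem _ ⟨.of_compl h₁ h₂, h₁.isClosed_compl, by simpa using h₂,
    fun h => hyV (h hyU)⟩) hxU

/-- The closed subsets with quasi-compact complement are compact for the topology of Thomason
subsets. -/
lemma exists_finite_subcover_of_isThomason {U : Set X} (hU : IsOpen U) (hU' : IsCompact U)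
    {ι : Type*} (V : ι → Set X) (hV : ∀ i, IsThomason (V i)) (h : Uᶜ ⊆ ⋃ i, V i) :
    ∃ t : Finset ι, Uᶜ ⊆ ⋃ i ∈ t, V i := by
  have h₁ := isClosed_constructible_compl hU hU'
  have h₂ := fun i => (hV i).isOpen_constructible
  have h₃ := compactSpace_constructibleTopology (X := X)
  let := constructibleTopology X
  exact h₁.isCompact.elim_finite_subcover V h₂ h

/-- A subset of a Thomason subset that is closed in the constructible topology is separated from its
complement by a quasi-compact open subset. -/
lemma IsThomason.exists_isCompact_disjoint {V C : Set X} (hV : IsThomason V)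
    (hC : IsClosed[constructibleTopology X] C) (h : C ⊆ V) :
    ∃ U : Set X, IsOpen U ∧ IsCompact U ∧ Disjoint U C ∧ Uᶜ ⊆ V := by
  let ι := {U : Set X // IsOpen U ∧ IsCompact U ∧ Uᶜ ⊆ V}
  have h₁ := compactSpace_constructibleTopology (X := X)
  have h₂ (i : ι) : IsOpen[constructibleTopology X] (i.1)ᶜ :=
    (IsThomason.of_compl i.2.1 i.2.2.1).isOpen_constructible
  obtain ⟨t, ht⟩ : ∃ t : Finset ι, C ⊆ ⋃ i ∈ t, (i.1)ᶜ := by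
    let := constructibleTopology X
    refine hC.isCompact.elim_finite_subcover _ h₂ fun x hx => ?_
    obtain ⟨U, h₁, h₂, h₃, h₄⟩ := hV x (h hx)
    exact Set.mem_iUnion.2 ⟨⟨U, h₁, h₂, h₄⟩, h₃⟩
  have hO : ∀ U ∈ Subtype.val '' (t : Set ι), IsOpen U ∧ IsCompact U ∧ Uᶜ ⊆ V := by
    rintro _ ⟨U, -, rfl⟩
    exact U.2
  have hf : (Subtype.val '' (t : Set ι)).Finite := t.finite_toSet.image _
  refine ⟨⋂₀ (Subtype.val '' (t : Set ι)), hf.isOpen_sInter fun U hU => (hO U hU).1,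
    QuasiSeparatedSpace.isCompact_sInter hf (fun U hU => .inl (hO U hU).1)
      fun U hU => (hO U hU).2.1, Set.disjoint_left.2 fun x hx hxC => ?_, fun x hx => ?_⟩
  · obtain ⟨U, hU, hxU⟩ := Set.mem_iUnion₂.1 (ht hxC)
    exact hxU (hx U ⟨U, hU, rfl⟩)
  · rw [Set.compl_sInter] at hx
    obtain ⟨_, ⟨U, hU, rfl⟩, hxU⟩ := hx
    exact (hO U hU).2.2 hxU

end Topology

end Reconstruction

namespace Reconstruction

noncomputable section

/-! ### Sections of sheaves of modules -/

section Sections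

variable {X : Scheme.{u}}

/-- The restriction of functions to a smaller open subset. -/
def resO {U V : X.Opens} (h : V ≤ U) : Γ(X, U) →+* Γ(X, V) := (X.presheaf.map (homOfLE h).op).hom

lemma resO_resO {U V W : X.Opens} (h : V ≤ U) (h' : W ≤ V) (r : Γ(X, U)) :
    resO h' (resO h r) = resO (h'.trans h) r := by
  simp only [resO, ← CommRingCat.comp_apply, ← Functor.map_comp, ← op_comp, homOfLE_comp]

@[simp] lemma resO_self {U : X.Opens} (h : U ≤ U) (r : Γ(X, U)) : resO h r = r :=
  congr($(X.presheaf.map_id (op U)) r)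

lemma basicOpen_resO {U V : X.Opens} (h : V ≤ U) (f : Γ(X, U)) :
    X.basicOpen (resO h f) = V ⊓ X.basicOpen f :=
  X.basicOpen_res _ _

variable (F : X.Modules)

/-- The restriction of sections to a smaller open subset. -/
def res {U V : X.Opens} (h : V ≤ U) : Γ(F, U) →+ Γ(F, V) := (F.presheaf.map (homOfLE h).op).hom

variable {F}

lemma res_res {U V W : X.Opens} (h : V ≤ U) (h' : W ≤ V) (x : Γ(F, U)) :
    res F h' (res F h x) = res F (h'.trans h) x := by
  simp only [res, ← AddCommGrpCat.comp_apply, ← Functor.map_comp, ← op_comp, homOfLE_comp]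

@[simp] lemma res_self {U : X.Opens} (h : U ≤ U) (x : Γ(F, U)) : res F h x = x :=
  congr($(F.presheaf.map_id (op U)) x)

lemma res_smul {U V : X.Opens} (h : V ≤ U) (r : Γ(X, U)) (x : Γ(F, U)) :
    res F h (r • x) = resO h r • res F h x :=
  F.map_smul (homOfLE h) r x

lemma app_res' {G : X.Modules} (g : F ⟶ G) {U V : X.Opens} (h : V ≤ U) (x : Γ(F, U)) :
    g.app V (res F h x) = res G h (g.app U x) :=
  app_res g h x

/-- Open subsets such as `U.ι ''ᵁ U.ι ⁻¹ᵁ W` and `W ⊓ U` are equal without being so by definition;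
their sections are compared by restriction in both directions. -/
lemma res_injective_of_eq {U V : X.Opens} (h : V ≤ U) (h' : U ≤ V) :
    Function.Injective (res F h) :=
  fun x y e => by simpa [res_res] using congrArg (res F h') e

lemma sections_ext {ι : Type*} {U : X.Opens} (V : ι → X.Opens) (hV : ∀ i, V i ≤ U)
    (hU : U ≤ ⨆ i, V i)
    {x y : Γ(F, U)} (h : ∀ i, res F (hV i) x = res F (hV i) y) : x = y :=
  TopCat.Sheaf.eq_of_locally_eq' ⟨_, F.isSheaf⟩ V U (fun i => homOfLE (hV i)) hU x y h

lemma sections_eq_zero {ι : Type*} {U : X.Opens} (V : ι → X.Opens) (hV : ∀ i, V i ≤ U)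
    (hU : U ≤ ⨆ i, V i) {x : Γ(F, U)} (h : ∀ i, res F (hV i) x = 0) : x = 0 :=
  sections_ext V hV hU fun i => by rw [h, map_zero]

lemma sections_glue {ι : Type*} {U : X.Opens} (V : ι → X.Opens) (hV : ∀ i, V i ≤ U)
    (hU : U ≤ ⨆ i, V i) (x : ∀ i, Γ(F, V i))
    (h : ∀ i j, res F (inf_le_left : V i ⊓ V j ≤ V i) (x i) = res F inf_le_right (x j)) :
    ∃ y : Γ(F, U), ∀ i, res F (hV i) y = x i := by
  obtain ⟨y, hy, -⟩ := TopCat.Sheaf.existsUnique_gluing' ⟨_, F.isSheaf⟩ V U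
    (fun i => homOfLE (hV i)) hU x h
  exact ⟨y, hy⟩

/-- The sections of `F` over the basic open subsets of `U` are the localizations of the sections
over `U`. -/
def IsLocalizingAt (F : X.Modules) (U : X.Opens) : Prop :=
  ∀ f : Γ(X, U),
    (∀ x : Γ(F, X.basicOpen f), ∃ (n : ℕ) (y : Γ(F, U)),
      res F (X.basicOpen_le f) y = resO (X.basicOpen_le f) (f ^ n) • x) ∧
    (∀ y : Γ(F, U), res F (X.basicOpen_le f) y = 0 → ∃ n : ℕ, f ^ n • y = 0)

/-- The scalars act through the identification of functions on `V` with functions on its image; the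
composite is plain restriction. -/
lemma smul_restrict_fromSpec {U : X.Opens} (hU : IsAffineOpen U) (V : (Spec Γ(X, U)).Opens)
    (h : hU.fromSpec ''ᵁ V ≤ U) (r : Γ(X, U)) (x : Γ(F.restrict hU.fromSpec, V)) :
    r • x = (resO h r • (show Γ(F, hU.fromSpec ''ᵁ V) from x) : Γ(F, hU.fromSpec ''ᵁ V)) := by
  have e : V ≤ hU.fromSpec ⁻¹ᵁ U := by
    rw [hU.fromSpec_preimage_self]
    exact le_top
  have key : (Scheme.ΓSpecIso Γ(X, U)).inv ≫ (Spec Γ(X, U)).presheaf.map V.leTop.op ≫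
      (hU.fromSpec.appIso V).inv = X.presheaf.map (homOfLE h).op := by
    rw [← Scheme.Hom.appLE_appIso_inv hU.fromSpec e, Scheme.Hom.appLE, hU.fromSpec_app_self]
    simp only [Category.assoc, ← Functor.map_comp_assoc]
    rfl
  rw [Scheme.Modules.smul_Spec_def]
  exact congr($key r • (show Γ(F, hU.fromSpec ''ᵁ V) from x))

/-- The localization condition is transported along equalities of open subsets, which are kept as
variables so that they can be substituted. -/
lemma localizing_iff_of_eq {U U' D D' : X.Opens} (e : U' = U) (e' : D' = D) (hU : U' ≤ U)
    (h : D' ≤ U') (hD : D ≤ U) (hD' : D' ≤ U) (f : Γ(X, U)) :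
    ((∀ x : Γ(F, D'), ∃ (n : ℕ) (y : Γ(F, U')), res F h y = resO hD' (f ^ n) • x) ∧
      (∀ y : Γ(F, U'), res F h y = 0 → ∃ n : ℕ, resO hU (f ^ n) • y = 0)) ↔
    ((∀ x : Γ(F, D), ∃ (n : ℕ) (y : Γ(F, U)), res F hD y = resO hD (f ^ n) • x) ∧
      (∀ y : Γ(F, U), res F hD y = 0 → ∃ n : ℕ, f ^ n • y = 0)) := by
  subst e e'
  simp

lemma isQcoh_restrict_iff {U : X.Opens} (hU : IsAffineOpen U) :
    isQcoh _ (F.restrict hU.fromSpec) ↔ IsLocalizingAt F U := by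
  have e : hU.fromSpec ''ᵁ ⊤ = U := by simp [hU.opensRange_fromSpec]
  rw [isLocalizing_iff_spec]
  refine forall_congr' fun f => ?_
  have e' : hU.fromSpec ''ᵁ specBasicOpen f = X.basicOpen f := hU.fromSpec_image_basicOpen f
  rw [← localizing_iff_of_eq e e' e.le (Scheme.Hom.image_mono _ le_top) (X.basicOpen_le f)
    (e'.trans_le (X.basicOpen_le f))]
  simp only [smul_restrict_fromSpec hU _ e.le,
    smul_restrict_fromSpec hU _ (e'.trans_le (X.basicOpen_le f))]
  rfl

/-- This reduces quasi-coherence to an elementary condition on sections, which is the form used from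
here on. -/
lemma isQcoh_iff_isLocalizingAt :
    isQcoh X F ↔ ∀ U, IsAffineOpen U → IsLocalizingAt F U :=
  ⟨fun h _ hU => (isQcoh_restrict_iff hU).1 (isQcoh_restrict _ _ h),
    fun h => isQcoh_of_restrict _ fun _ hU => (isQcoh_restrict_iff hU).2 (h _ hU)⟩

lemma exists_finite_affine_cover {U : X.Opens} (hU : IsCompact (U : Set X)) :
    ∃ (ι : Type u) (_ : Finite ι) (V : ι → X.Opens), (∀ i, IsAffineOpen (V i)) ∧ U = ⨆ i, V i := by
  obtain ⟨s, hs, h⟩ := isCompact_iff_finite_and_eq_biUnion_affineOpens.mp hU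
  exact ⟨s, hs, fun i => i.1, fun i => i.1.2,
    h.trans (iSup_subtype' (p := (· ∈ s)) (f := fun i _ => i.1))⟩

lemma pow_smul_eq_zero_of_le {A M : Type*} [CommRing A] [AddCommGroup M] [Module A M] {f : A}
    {y : M} {m n : ℕ} (h : m ≤ n) (hy : f ^ m • y = 0) : f ^ n • y = 0 := by
  rw [← Nat.sub_add_cancel h, pow_add, mul_smul, hy, smul_zero]

/-- A section over a quasi-compact open subset that vanishes where `f` is invertible is annihilated
by a power of `f`. -/
lemma exists_pow_smul_eq_zero (hF : isQcoh X F) {U : X.Opens} (hU : IsCompact (U : Set X))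
    (f : Γ(X, U)) (y : Γ(F, U)) (hy : res F (X.basicOpen_le f) y = 0) :
    ∃ n : ℕ, f ^ n • y = 0 := by
  rw [isQcoh_iff_isLocalizingAt] at hF
  obtain ⟨ι, _, V, hV, hUV⟩ := exists_finite_affine_cover hU
  have hle : ∀ i, V i ≤ U := fun i => hUV.symm ▸ le_iSup V i
  have key : ∀ i, ∃ n : ℕ, resO (hle i) f ^ n • res F (hle i) y = 0 := fun i => by
    refine ((hF _ (hV i)) (resO (hle i) f)).2 _ ?_
    have := congrArg (res F ((basicOpen_resO (hle i) f).trans_le inf_le_right)) hy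
    rw [res_res, map_zero] at this
    rwa [res_res]
  choose n hn using key
  obtain ⟨N, hN⟩ := Finite.exists_le n
  refine ⟨N, sections_eq_zero V hle hUV.le fun i => ?_⟩
  rw [res_smul, map_pow]
  exact pow_smul_eq_zero_of_le (hN i) (hn i)

/-- The sections of a quasi-coherent sheaf over the basic open subsets of a quasi-compact and
quasi-separated open subset `U` are the localizations of the sections over `U`. -/
lemma isLocalizingAt_of_isCompact (hF : isQcoh X F) {U : X.Opens} (hU : IsCompact (U : Set X))
    (hU' : IsQuasiSeparated (U : Set X)) : IsLocalizingAt F U := by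
  refine fun f => ⟨fun x => ?_, exists_pow_smul_eq_zero hF hU f⟩
  obtain ⟨ι, _, V, hV, hUV⟩ := exists_finite_affine_cover hU
  have hle : ∀ i, V i ≤ U := fun i => hUV.symm ▸ le_iSup V i
  have hD : ∀ i, X.basicOpen (resO (hle i) f) ≤ X.basicOpen f := fun i =>
    (basicOpen_resO (hle i) f).trans_le inf_le_right
  have key : ∀ i, ∃ (n : ℕ) (y : Γ(F, V i)), res F (X.basicOpen_le (resO (hle i) f)) y =
      resO (X.basicOpen_le _) (resO (hle i) f ^ n) • res F (hD i) x := fun i =>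
    (((isQcoh_iff_isLocalizingAt.1 hF) _ (hV i)) (resO (hle i) f)).1 _
  choose n y hy using key
  obtain ⟨N, hN⟩ := Finite.exists_le n
  -- The extra power gives all the local extensions the common exponent `N`.
  let z : ∀ i, Γ(F, V i) := fun i => resO (hle i) f ^ (N - n i) • y i
  have hz : ∀ i, res F (X.basicOpen_le (resO (hle i) f)) (z i) =
      resO (X.basicOpen_le _) (resO (hle i) f ^ N) • res F (hD i) x := fun i => by
    rw [res_smul, hy, ← mul_smul, ← map_mul, ← pow_add, Nat.sub_add_cancel (hN i)]
  -- The extensions agree on overlaps only up to a power of `f`. Overlaps are quasi-compact but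
  -- perhaps not affine, which is why the annihilation lemma is stated for quasi-compact open
  -- subsets.
  have hcomp : ∀ p : ι × ι, ∃ m : ℕ,
      resO (inf_le_left.trans (hle p.1) : V p.1 ⊓ V p.2 ≤ U) f ^ m •
      (res F (inf_le_left : V p.1 ⊓ V p.2 ≤ V p.1) (z p.1) - res F inf_le_right (z p.2)) = 0 := by
    rintro ⟨i, j⟩
    have hc : IsCompact ((V i ⊓ V j : X.Opens) : Set X) :=
      hU' _ _ (hle i) (V i).2 (hV i).isCompact (hle j) (V j).2 (hV j).isCompact
    refine exists_pow_smul_eq_zero hF hc _ _ ?_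
    have hi : X.basicOpen (resO (inf_le_left.trans (hle i) : V i ⊓ V j ≤ U) f) ≤
        X.basicOpen (resO (hle i) f) := by
      simp only [basicOpen_resO]
      exact inf_le_inf_right _ inf_le_left
    have hj : X.basicOpen (resO (inf_le_left.trans (hle i) : V i ⊓ V j ≤ U) f) ≤
        X.basicOpen (resO (hle j) f) := by
      simp only [basicOpen_resO]
      exact inf_le_inf_right _ inf_le_right
    have e₁ := congrArg (res F hi) (hz i)
    have e₂ := congrArg (res F hj) (hz j)
    simp only [res_res, res_smul, resO_resO, ← map_pow] at e₁ e₂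
    simp only [map_sub, res_res, e₁, e₂, sub_self]
  choose m hm using hcomp
  obtain ⟨K, hK⟩ := Finite.exists_le m
  obtain ⟨w, hw⟩ := sections_glue V hle hUV.le (fun i => resO (hle i) f ^ K • z i) fun i j => by
    have := pow_smul_eq_zero_of_le (hK (i, j)) (hm (i, j))
    rw [smul_sub, sub_eq_zero] at this
    simpa only [res_smul, map_pow, resO_resO] using this
  refine ⟨K + N, w, sections_ext (fun i => X.basicOpen (resO (hle i) f)) hD ?_ fun i => ?_⟩
  · simp only [basicOpen_resO, ← iSup_inf_eq, ← hUV]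
    exact le_inf (X.basicOpen_le f) le_rfl
  · have := congrArg (res F (X.basicOpen_le (resO (hle i) f))) (hw i)
    rw [res_smul, hz, res_res, ← mul_smul] at this
    simp only [res_res, res_smul, resO_resO, ← map_pow, ← map_mul, ← pow_add] at this ⊢
    exact this

/-- The preimage of an affine open subset is quasi-compact and quasi-separated, so
`isLocalizingAt_of_isCompact` applies to it. -/
lemma isQcoh_pushforward {Y : Scheme.{u}} (f : X ⟶ Y) [QuasiCompact f] [QuasiSeparated f]
    (hF : isQcoh X F) : isQcoh Y ((Scheme.Modules.pushforward f).obj F) := by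
  refine isQcoh_iff_isLocalizingAt.2 fun U hU r => ?_
  have h := isLocalizingAt_of_isCompact hF (U := f ⁻¹ᵁ U)
    (f.isCompact_preimage hU.isCompact) (f.isQuasiSeparated_preimage hU.isQuasiSeparated)
    (f.app U r)
  have e : f ⁻¹ᵁ (Y.basicOpen r) = X.basicOpen (f.app U r) := f.preimage_basicOpen r
  have h' := (localizing_iff_of_eq rfl e le_rfl ((Opens.map f.base).monotone (Y.basicOpen_le r))
    (X.basicOpen_le _) ((Opens.map f.base).monotone (Y.basicOpen_le r)) (f.app U r)).2 h
  refine ⟨fun x => ?_, fun y hy => ?_⟩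
  · obtain ⟨n, y, hy⟩ := h'.1 x
    refine ⟨n, y, hy.trans ?_⟩
    have := congr($(f.naturality (homOfLE (Y.basicOpen_le r)).op) (r ^ n))
    rw [← map_pow]
    exact congr($this.symm • (show Γ(F, f ⁻¹ᵁ Y.basicOpen r) from x))
  · obtain ⟨n, hn⟩ := h'.2 y hy
    refine ⟨n, ?_⟩
    rw [resO_self, ← map_pow] at hn
    exact hn

--INSERT
end Sections

end
end Reconstruction

namespace Reconstruction

noncomputable section

/-! ### Sections over affine open subsets and extension by direct image -/

section Functors

variable {X : Scheme.{u}}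

/-- Restriction to an affine open subset preserves colimits, and the essential image of
`tilde.functor` is closed under them. -/
instance (J : Type u) [SmallCategory J] : (isQcoh X).IsClosedUnderColimitsOfShape J :=
  .mk' (by
    rintro _ ⟨G, hG⟩
    refine isQcoh_of_restrict _ fun U hU => ?_
    have : PreservesColimitsOfSize.{u, u} (Scheme.Modules.restrictFunctor hU.fromSpec) :=
      inferInstance
    refine isQcoh_iso (preservesColimitIso (Scheme.Modules.restrictFunctor hU.fromSpec) G).symm ?_
    have hE : ∀ j, (tilde.functor Γ(X, U)).essImage
        ((G ⋙ Scheme.Modules.restrictFunctor hU.fromSpec).obj j) := fun j => by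
      rw [essImage_tilde]
      exact isQcoh_restrict _ _ (hG j)
    have := (tilde.functor Γ(X, U)).essImage.prop_colimit _ hE
    rw [essImage_tilde] at this
    exact this)

/-- The functor of sections over an open subset. -/
def sec (U : X.Opens) : Qcoh X ⥤ ModuleCat.{u} Γ(X, U) where
  obj F := ModuleCat.of _ Γ(F.obj, U)
  map g := ModuleCat.ofHom
    { toFun := g.hom.app U
      map_add' := map_add _
      map_smul' := Scheme.Modules.Hom.app_smul _ }

instance (U : X.Opens) : (sec U).Additive where
  map_add := rfl

/-- Kernels of quasi-coherent sheaves are kernels of sheaves of modules, which are computed on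
sections over each open subset. -/
instance (U : X.Opens) {F G : Qcoh X} (f : F ⟶ G) : PreservesLimit (parallelPair f 0) (sec U) := by
  have h₁ := (isQcoh X).preservesKernels_ι f
  let E : TopCat.Presheaf Ab X ⥤ Ab := (evaluation X.Opensᵒᵖ Ab).obj (op U)
  have : PreservesLimits (Scheme.Modules.toPresheaf X) := inferInstance
  have : PreservesLimitsOfSize.{0, 0} (Scheme.Modules.toPresheaf X) :=
    preservesLimitsOfSize_shrink _
  have : PreservesLimitsOfShape WalkingParallelPair E :=
    inferInstanceAs (PreservesLimitsOfShape WalkingParallelPair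
      ((evaluation X.Opensᵒᵖ Ab.{u}).obj (op U)))
  have h₂ : PreservesLimit (parallelPair f 0)
      ((isQcoh X).ι ⋙ Scheme.Modules.toPresheaf X ⋙ E) := inferInstance
  have h₃ : PreservesLimit (parallelPair f 0) (sec U ⋙ forget₂ (ModuleCat Γ(X, U)) Ab) := h₂
  exact preservesLimit_of_reflects_of_preserves (sec U) (forget₂ (ModuleCat Γ(X, U)) Ab)

instance (U : X.Opens) : PreservesFiniteLimits (sec U) :=
  Functor.preservesFiniteLimits_of_preservesKernels _

/-- The direct image of quasi-coherent sheaves. -/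
def push {X Y : Scheme.{u}} (f : X ⟶ Y) [QuasiCompact f] [QuasiSeparated f] : Qcoh X ⥤ Qcoh Y :=
  (isQcoh Y).lift ((isQcoh X).ι ⋙ Scheme.Modules.pushforward f)
    fun F => isQcoh_pushforward f F.property

/-- The restriction of quasi-coherent sheaves along an open immersion. -/
def restr {X Y : Scheme.{u}} (f : X ⟶ Y) [IsOpenImmersion f] : Qcoh Y ⥤ Qcoh X :=
  (isQcoh X).lift ((isQcoh Y).ι ⋙ Scheme.Modules.restrictFunctor f)
    fun F => isQcoh_restrict f _ F.property

/-- Restriction is left adjoint to the direct image. -/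
def restrAdj {X Y : Scheme.{u}} (f : X ⟶ Y) [IsOpenImmersion f] [QuasiCompact f]
    [QuasiSeparated f] : restr f ⊣ push f :=
  (Scheme.Modules.restrictAdjunction f).restrictFullyFaithful (isQcoh Y).fullyFaithfulι
    (isQcoh X).fullyFaithfulι (Iso.refl _) (Iso.refl _)

variable {W : X.Opens} (hW : IsAffineOpen W)

/-- The sheaf associated with a module, as a quasi-coherent sheaf. -/
def tildeQ (R : CommRingCat.{u}) : ModuleCat.{u} R ≌ Qcoh (Spec R) := tildeEquiv

/-- The sections over an affine open subset are the global sections of the restriction. -/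
def secIsoApp (F : X.Modules) : ModuleCat.of Γ(X, W) Γ(F.restrict hW.fromSpec, ⊤) ≅
    ModuleCat.of Γ(X, W) Γ(F, W) :=
  LinearEquiv.toModuleIso
    { toFun := fun x => res F (show W ≤ hW.fromSpec ''ᵁ ⊤ by simp [hW.opensRange_fromSpec]) x
      invFun := fun x => res F (show hW.fromSpec ''ᵁ ⊤ ≤ W by simp [hW.opensRange_fromSpec]) x
      map_add' := map_add _
      map_smul' := fun r x => by
        rw [smul_restrict_fromSpec hW ⊤ (by simp [hW.opensRange_fromSpec])]
        exact (res_smul _ _ _).trans (by rw [resO_resO, resO_self]; rfl)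
      left_inv := fun x => (res_res _ _ _).trans (res_self _ _)
      right_inv := fun x => (res_res _ _ _).trans (res_self _ _) }

/-- The sections over an affine open subset are the module corresponding to the restriction. -/
def secIso : restr hW.fromSpec ⋙ (tildeQ Γ(X, W)).inverse ≅ sec W :=
  NatIso.ofComponents (fun F => secIsoApp hW F.obj) (fun {F G} g => by
    ext x
    exact (app_res' g.hom (show W ≤ hW.fromSpec ''ᵁ ⊤ by simp [hW.opensRange_fromSpec]) x).symm)

variable [QuasiSeparatedSpace X]

/-- The direct image on `X` of the sheaf on the affine open subset `W` associated with a module. -/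
def extend : ModuleCat.{u} Γ(X, W) ⥤ Qcoh X := (tildeQ Γ(X, W)).functor ⋙ push hW.fromSpec

/-- The functor of sections over an affine open subset is left adjoint to `extend`. -/
def secAdj : sec W ⊣ extend hW :=
  ((restrAdj hW.fromSpec).comp (tildeQ Γ(X, W)).symm.toAdjunction).ofNatIsoLeft (secIso hW)

instance {X Y : Scheme.{u}} (f : X ⟶ Y) [IsOpenImmersion f] [QuasiCompact f]
    [QuasiSeparated f] : (push f).Full where
  map_surjective g := by
    obtain ⟨h, hh⟩ := (Scheme.Modules.pushforward f).map_surjective g.hom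
    exact ⟨ObjectProperty.homMk h, ObjectProperty.hom_ext _ hh⟩

instance {X Y : Scheme.{u}} (f : X ⟶ Y) [IsOpenImmersion f] [QuasiCompact f]
    [QuasiSeparated f] : (push f).Faithful where
  map_injective h := ObjectProperty.hom_ext _ ((Scheme.Modules.pushforward f).map_injective
    congr(($h).hom))

instance : (extend hW).Full := by
  unfold extend
  infer_instance

instance : (extend hW).Faithful := by
  unfold extend
  infer_instance

end Functors

end
end Reconstruction

namespace Reconstruction

noncomputable section

/-! ### Testing on affine open subsets -/

section Affine

variable {X : Scheme.{u}}

lemma injective_of_mono {F G : Qcoh X} (g : F ⟶ G) [Mono g] (U : X.Opens) :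
    Function.Injective (g.hom.app U) :=
  (ModuleCat.mono_iff_injective ((sec U).map g)).1 inferInstance

lemma affine_cover_of_le (U : X.Opens) : U ≤ ⨆ W : {W : X.affineOpens // W.1 ≤ U}, W.1.1 := by
  intro x hx
  obtain ⟨W, hW, hxW, hWU⟩ := Opens.isBasis_iff_nbhd.1 X.isBasis_affineOpens hx
  exact Opens.mem_iSup.2 ⟨⟨⟨W, hW⟩, hWU⟩, hxW⟩

lemma hom_ext_of_affine {F G : Qcoh X} {f g : F ⟶ G}
    (h : ∀ W, IsAffineOpen W → ∀ x, f.hom.app W x = g.hom.app W x) : f = g := by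
  refine ObjectProperty.hom_ext _ (Scheme.Modules.hom_ext _ _ fun U => ?_)
  ext x
  refine sections_ext _ (fun W : {W : X.affineOpens // W.1 ≤ U} => W.2) (affine_cover_of_le U)
    fun W => ?_
  rw [← app_res', ← app_res', h _ W.1.2]

lemma mono_of_injective {F G : Qcoh X} (g : F ⟶ G)
    (h : ∀ W, IsAffineOpen W → Function.Injective (g.hom.app W)) : Mono g :=
  ⟨fun a b e => hom_ext_of_affine fun W hW x => h W hW (by
    exact congr(($e).hom.app W x))⟩

lemma epi_of_surjective {F G : Qcoh X} (g : F ⟶ G)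
    (h : ∀ W, IsAffineOpen W → Function.Surjective (g.hom.app W)) : Epi g :=
  ⟨fun a b e => hom_ext_of_affine fun W hW x => by
    obtain ⟨y, rfl⟩ := h W hW x
    exact congr(($e).hom.app W y)⟩

lemma isIso_of_bijective {F G : Qcoh X} (g : F ⟶ G)
    (h : ∀ W, IsAffineOpen W → Function.Bijective (g.hom.app W)) : IsIso g := by
  have := mono_of_injective g fun W hW => (h W hW).1
  have := epi_of_surjective g fun W hW => (h W hW).2
  exact isIso_of_mono_of_epi g

lemma isZero_of_sections {F : Qcoh X}
    (h : ∀ W, IsAffineOpen W → ∀ x : Γ(F.obj, W), x = 0) : IsZero F :=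
  (IsZero.iff_id_eq_zero _).2 (hom_ext_of_affine fun W hW x => by
    rw [h W hW x, map_zero, map_zero])

/-- The sheaf condition for a finite or infinite affine cover: vanishing is local. -/
lemma isZero_of_cover {F : Qcoh X} {ι : Type*} (W : ι → X.Opens)
    (hc : ⨆ i, W i = ⊤) (h : ∀ i, IsAffineOpen (W i) ∧ IsZero ((sec (W i)).obj F)) : IsZero F := by
  have hF := isQcoh_iff_isLocalizingAt.1 F.property
  refine isZero_of_sections fun U hU x => ?_
  -- `U` is covered by basic open subsets of the `W i`, where sections are fractions of sections
  -- over `W i`, hence zero.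
  have hc' : U ≤ ⨆ D : {D : X.Opens // D ≤ U ∧ ∃ i, ∃ f : Γ(X, W i), D = X.basicOpen f}, D.1 := by
    intro y hy
    obtain ⟨i, hi⟩ := Opens.mem_iSup.1 (hc.ge (trivial : y ∈ (⊤ : X.Opens)))
    obtain ⟨f, hf, hyf⟩ := (h i).1.exists_basicOpen_le ⟨y, hy⟩ hi
    exact Opens.mem_iSup.2 ⟨⟨_, hf, i, f, rfl⟩, hyf⟩
  refine sections_eq_zero _ (fun D : {D : X.Opens // D ≤ U ∧ ∃ i, ∃ f : Γ(X, W i), D = X.basicOpen f}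
    => D.2.1) hc' ?_
  rintro ⟨_, hD, i, f, rfl⟩
  have := ModuleCat.subsingleton_of_isZero (h i).2
  obtain ⟨n, y, hy⟩ := (hF (W i) (h i).1 f).1 (res F.obj hD x)
  have hy0 : y = 0 := Subsingleton.elim (α := (sec (W i)).obj F) _ _
  have hu : IsUnit (resO (X.basicOpen_le f) (f ^ n)) := by
    rw [map_pow]
    exact (RingedSpace.isUnit_res_basicOpen X.toRingedSpace f).pow n
  rw [hy0, map_zero] at hy
  exact (hu.smul_eq_zero).1 hy.symm

end Affine

/-! ### Directed unions -/

section Union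

variable {X : Scheme.{u}} [QuasiSeparatedSpace X]

/-- A left adjoint preserves colimits. The right adjoint `extend` exists because `W` is affine and,
`X` being quasi-separated, its inclusion is quasi-compact. -/
lemma preservesColimits_sec {W : X.Opens} (hW : IsAffineOpen W) :
    PreservesColimitsOfSize.{u, u} (sec W) :=
  (secAdj hW).leftAdjoint_preservesColimits

lemma preservesFiniteColimits_sec {W : X.Opens} (hW : IsAffineOpen W) :
    PreservesFiniteColimits (sec W) := by
  have := (secAdj hW).leftAdjoint_preservesColimits.{0, 0}
  exact inferInstance

lemma surjective_of_epi {F G : Qcoh X} (g : F ⟶ G) [Epi g] {W : X.Opens} (hW : IsAffineOpen W) :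
    Function.Surjective (g.hom.app W) := by
  have := preservesFiniteColimits_sec hW
  exact (ModuleCat.epi_iff_surjective ((sec W).map g)).1 inferInstance

/-- A cocone over a directed system of monomorphisms is a colimit as soon as its legs are
monomorphisms that are jointly surjective on sections over affine open subsets. -/
lemma nonempty_isColimit_of_mono {J : Type u} [SmallCategory J] [IsFiltered J] {F : J ⥤ Qcoh X}
    (c : Cocone F) (hm : ∀ j, Mono (c.ι.app j))
    (hc : ∀ W, IsAffineOpen W → ∀ x : Γ(c.pt.obj, W), ∃ j y, (c.ι.app j).hom.app W y = x) :
    Nonempty (IsColimit c) := by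
  have h : IsIso (colimit.desc F c) := by
    refine isIso_of_bijective _ fun W hW => ⟨?_, fun x => ?_⟩
    · refine (injective_iff_map_eq_zero _).2 fun x hx => ?_
      have := preservesColimits_sec hW
      have hl := isColimitOfPreserves (sec W) (colimit.isColimit F)
      obtain ⟨j, y, rfl⟩ := Concrete.isColimit_exists_rep _ hl x
      have e : (c.ι.app j).hom.app W y = 0 := by
        rw [← colimit.ι_desc c j]
        exact hx
      have hy : y = 0 := injective_of_mono (c.ι.app j) W (e.trans (map_zero _).symm)
      rw [hy]
      exact map_zero (((sec W).map (colimit.ι F j)).hom)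
    · obtain ⟨j, y, rfl⟩ := hc W hW x
      refine ⟨(colimit.ι F j).hom.app W y, ?_⟩
      exact congr(($(colimit.ι_desc c j)).hom.app W y)
  have : IsIso ((colimit.isColimit F).desc c) := h
  exact ⟨IsColimit.ofPointIso (colimit.isColimit F)⟩

/-- Sections over an affine open subset of a filtered colimit come from some stage. -/
lemma exists_rep_of_isColimit {J : Type u} [SmallCategory J] [IsFiltered J] {F : J ⥤ Qcoh X}
    {c : Cocone F} (hc : IsColimit c) {W : X.Opens} (hW : IsAffineOpen W) (x : Γ(c.pt.obj, W)) :
    ∃ j y, (c.ι.app j).hom.app W y = x := by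
  have := preservesColimits_sec hW
  exact Concrete.isColimit_exists_rep _ (isColimitOfPreserves (sec W) hc) x

/-- A section that dies in the colimit dies at some stage, where the transition map is injective. -/
lemma mono_ι_of_isColimit {J : Type u} [SmallCategory J] [IsFiltered J] {F : J ⥤ Qcoh X}
    {c : Cocone F} (hc : IsColimit c) (hF : ∀ {i j : J} (f : i ⟶ j), Mono (F.map f)) (j : J) :
    Mono (c.ι.app j) := by
  refine mono_of_injective _ fun W hW => (injective_iff_map_eq_zero _).2 fun x hx => ?_
  have := preservesColimits_sec hW
  have hl := isColimitOfPreserves (sec W) hc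
  obtain ⟨k, f, g, hf⟩ := Concrete.isColimit_exists_of_rep_eq (F ⋙ sec W) hl (i := j) (j := j) x
    (0 : Γ((F.obj j).obj, W)) (hx.trans (map_zero ((sec W).map (c.ι.app j)).hom).symm)
  have := hF f
  refine injective_of_mono (F.map f) W (hf.trans ?_)
  exact (map_zero ((sec W).map (F.map g)).hom).trans (map_zero ((sec W).map (F.map f)).hom).symm

/-- Sections over a quasi-compact open subset of the colimit of a directed system of monomorphisms
come from some stage. -/
lemma exists_rep_of_isCompact {J : Type u} [SmallCategory J] [IsFiltered J] {F : J ⥤ Qcoh X}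
    {c : Cocone F} (hc : IsColimit c) (hm : ∀ j, Mono (c.ι.app j))
    {U : X.Opens} (hU : IsCompact (U : Set X)) (x : Γ(c.pt.obj, U)) :
    ∃ j y, (c.ι.app j).hom.app U y = x := by
  obtain ⟨ι, _, V, hV, hUV⟩ := exists_finite_affine_cover hU
  have hle : ∀ i, V i ≤ U := fun i => hUV.symm ▸ le_iSup V i
  choose j y hy using fun i => exists_rep_of_isColimit hc (hV i) (res _ (hle i) x)
  have := Fintype.ofFinite ι
  classical
  obtain ⟨k, hk⟩ := IsFiltered.sup_objs_exists (Finset.univ.image j)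
  let t (i : ι) : j i ⟶ k := (hk (Finset.mem_image_of_mem j (Finset.mem_univ i))).some
  have hy' (i : ι) : (c.ι.app k).hom.app (V i) ((F.map (t i)).hom.app (V i) (y i)) =
      res _ (hle i) x := by
    rw [← hy i, ← c.w (t i)]
    rfl
  -- The leg at stage `k` is injective, so the local lifts agree on overlaps already at that stage.
  obtain ⟨z, hz⟩ := sections_glue (F := (F.obj k).obj) V hle hUV.le
    (fun i => (F.map (t i)).hom.app (V i) (y i)) (fun i i' => by
      refine injective_of_mono (c.ι.app k) _ ?_
      rw [app_res', app_res', hy', hy']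
      exact (res_res _ _ _).trans (res_res _ _ _).symm)
  refine ⟨k, z, sections_ext V hle hUV.le fun i => ?_⟩
  rw [← app_res', hz, hy']
  rfl

instance {W : X.Opens} (hW : IsAffineOpen W) : (extend hW).IsRightAdjoint :=
  (secAdj hW).isRightAdjoint

instance {W : X.Opens} (hW : IsAffineOpen W) : (extend hW).Additive :=
  (extend hW).additive_of_preserves_binary_products

/-- `extend` preserves directed unions. -/
lemma nonempty_isColimit_extend {W : X.Opens} (hW : IsAffineOpen W) {J : Type u} [SmallCategory J]
    [IsFiltered J] {N : J ⥤ ModuleCat.{u} Γ(X, W)} {c : Cocone N} (hc : IsColimit c)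
    (hm : ∀ j, Mono (c.ι.app j)) : Nonempty (IsColimit ((extend hW).mapCocone c)) := by
  have hc' := isColimitOfPreserves (tildeQ Γ(X, W)).functor hc
  have hm' (j : J) : Mono (((tildeQ Γ(X, W)).functor.mapCocone c).ι.app j) := by
    have := hm j
    exact inferInstanceAs (Mono ((tildeQ Γ(X, W)).functor.map (c.ι.app j)))
  refine nonempty_isColimit_of_mono _ (fun j => ?_) (fun W' hW' x => ?_)
  · have := hm j
    exact inferInstanceAs (Mono ((extend hW).map (c.ι.app j)))
  -- Sections of the direct image over `W'` are sections over the preimage of `W'`, which is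
  -- quasi-compact but need not be affine.
  · exact exists_rep_of_isCompact hc' hm' (U := hW.fromSpec ⁻¹ᵁ W')
      (hW.fromSpec.isCompact_preimage hW'.isCompact) x

end Union

end
end Reconstruction

namespace Reconstruction

noncomputable section

/-! ### Serre subcategories and exact functors with a fully faithful right adjoint -/

section Locality

universe v w v' w'

variable {C : Type w} [Category.{v} C] [Abelian C] (S : ObjectProperty C) [S.IsSerreClass]

instance : S.IsClosedUnderBinaryProducts where
  limitsOfShape_le := by
    rintro M ⟨p⟩
    let e : M ≅ p.diag.obj ⟨.left⟩ ⨯ p.diag.obj ⟨.right⟩ :=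
      p.isLimit.conePointUniqueUpToIso
        ((IsLimit.postcomposeHomEquiv (diagramIsoPair p.diag).symm _).symm (prodIsProd _ _))
    exact S.prop_of_iso (e ≪≫ (biprod.isoProd _ _).symm).symm
      (S.prop_biprod (p.prop_diag_obj _) (p.prop_diag_obj _))

instance : S.IsClosedUnderFiniteProducts := .mk'

section

variable {D : Type w'} [Category.{v'} D] {Ψ : C ⥤ D} {Φ : D ⥤ C}
  [PreservesFiniteLimits Ψ] [Φ.Full] [Φ.Faithful]

/-- Subobjects of `Ψ F` lift to subobjects of `F`: pull `Φ f` back along the unit. As `Ψ` inverts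
the unit, it also inverts the second projection. -/
lemma prop_map_of_mono_obj (adj : Ψ ⊣ Φ) {F : C} (hF : S F) {N : D} (f : N ⟶ Ψ.obj F) [Mono f] :
    S.map Ψ N := by
  have := adj.rightAdjoint_preservesLimits.{0, 0}
  have hi : IsIso (Ψ.map (pullback.snd (adj.unit.app F) (Φ.map f))) :=
    (IsPullback.map Ψ (IsPullback.of_hasPullback (adj.unit.app F) (Φ.map f))).isIso_snd_of_isIso
  exact ⟨pullback (adj.unit.app F) (Φ.map f), S.prop_of_mono (pullback.fst _ _) hF,
    ⟨asIso (Ψ.map (pullback.snd (adj.unit.app F) (Φ.map f))) ≪≫ asIso (adj.counit.app N)⟩⟩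

lemma prop_map_of_mono (adj : Ψ ⊣ Φ) {M N : D} (hN : S.map Ψ N) (f : M ⟶ N) [Mono f] :
    S.map Ψ M := by
  obtain ⟨F, hF, ⟨e⟩⟩ := hN
  exact prop_map_of_mono_obj S adj hF (f ≫ e.inv)

variable [Abelian D]

/-- The maps `g k` embed `N` into a finite direct sum of objects `Ψ (F k)`, that is, into the image
of an object of `S`. -/
lemma prop_map_of_jointly_mono (adj : Ψ ⊣ Φ) {K : Type*} [Finite K] {N : D} {M : K → D}
    (hM : ∀ k, S.map Ψ (M k)) (g : ∀ k, N ⟶ M k)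
    (hg : ∀ {Z : D} (a : Z ⟶ N), (∀ k, a ≫ g k = 0) → a = 0) : S.map Ψ N := by
  obtain ⟨n, ⟨ε⟩⟩ := Finite.exists_equiv_fin K
  choose F hF e using fun k : Fin n => hM (ε.symm k)
  have := Abelian.hasFiniteBiproducts (C := C)
  have := Abelian.hasFiniteBiproducts (C := D)
  have : Ψ.Additive := Ψ.additive_of_preserves_binary_products
  let l : N ⟶ ⨁ Ψ.obj ∘ F := biproduct.lift fun k => g (ε.symm k) ≫ (e k).some.inv
  have : Mono (l ≫ (Ψ.mapBiproduct F).inv) := by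
    refine Preadditive.mono_of_cancel_zero _ fun a ha => hg a fun k => ?_
    have h : a ≫ l = 0 := by
      rw [← cancel_mono (Ψ.mapBiproduct F).inv, Category.assoc, ha, zero_comp]
    have h' := h =≫ biproduct.π _ (ε k)
    rw [Category.assoc, biproduct.lift_π, zero_comp, ← Category.assoc] at h'
    have h'' := (cancel_mono (e (ε k)).some.inv).1 (h'.trans zero_comp.symm)
    rwa [ε.symm_apply_apply] at h''
  exact prop_map_of_mono_obj S adj
    (S.prop_of_iso (biproduct.isoProduct F).symm (S.prop_product hF)) (l ≫ (Ψ.mapBiproduct F).inv)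

variable [PreservesFiniteColimits Ψ]

/-- The lift of the quotient `N` is the image of the adjoint map `F ⟶ Φ N`, a quotient of `F`. Its
image under `Ψ` maps to `N` both monomorphically and epimorphically. -/
lemma prop_map_of_epi_obj (adj : Ψ ⊣ Φ) {F : C} (hF : S F) {N : D} (g : Ψ.obj F ⟶ N) [Epi g] :
    S.map Ψ N := by
  let h := adj.homEquiv _ _ g
  have e : Ψ.map (factorThruImage h) ≫ Ψ.map (image.ι h) ≫ adj.counit.app N = g := by
    rw [← Category.assoc, ← Ψ.map_comp, image.fac]
    exact (adj.homEquiv_counit (g := h)).symm.trans ((adj.homEquiv _ _).symm_apply_apply g)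
  have h₁ : Mono (Ψ.map (image.ι h) ≫ adj.counit.app N) := inferInstance
  have h₂ : Epi (Ψ.map (image.ι h) ≫ adj.counit.app N) :=
    @epi_of_epi_fac _ _ _ _ _ _ _ _ ‹Epi g› e
  have := isIso_of_mono_of_epi (Ψ.map (image.ι h) ≫ adj.counit.app N)
  exact ⟨image h, S.prop_of_epi (factorThruImage h) hF,
    ⟨asIso (Ψ.map (image.ι h) ≫ adj.counit.app N)⟩⟩

lemma prop_map_of_epi (adj : Ψ ⊣ Φ) {M N : D} (hM : S.map Ψ M) (f : M ⟶ N) [Epi f] : S.map Ψ N := by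
  obtain ⟨F, hF, ⟨e⟩⟩ := hM
  exact prop_map_of_epi_obj S adj hF (e.hom ≫ f)

end

/-- Membership in a Serre subcategory is local for a finite family of exact functors with fully
faithful right adjoints that jointly detect zero objects. -/
theorem prop_of_map {ι : Type*} [Finite ι] {D : ι → Type w'} [∀ i, Category.{v'} (D i)]
    [∀ i, Abelian (D i)] {Ψ : ∀ i, C ⥤ D i} {Φ : ∀ i, D i ⥤ C} (adj : ∀ i, Ψ i ⊣ Φ i)
    [∀ i, PreservesFiniteLimits (Ψ i)] [∀ i, PreservesFiniteColimits (Ψ i)] [∀ i, (Φ i).Full]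
    [∀ i, (Φ i).Faithful] (hd : ∀ G, (∀ i, IsZero ((Ψ i).obj G)) → IsZero G)
    {G : C} (hG : ∀ i, S.map (Ψ i) ((Ψ i).obj G)) : S G := by
  have := Fintype.ofFinite ι
  classical
  -- Induction on the set `s` of indices at which `G` is allowed to be non-zero.
  have key : ∀ s : Finset ι, ∀ G, (∀ i, i ∉ s → IsZero ((Ψ i).obj G)) →
      (∀ i, S.map (Ψ i) ((Ψ i).obj G)) → S G := by
    intro s
    induction s using Finset.induction_on with
    | empty => exact fun G h _ => S.prop_of_isZero (hd G fun i => h i (by simp))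
    | insert i t hi ih =>
      intro G h₀ h₁
      let η := (adj i).unit.app G
      have hη : IsIso ((Ψ i).map η) := inferInstance
      -- `Ψ i` inverts the unit, so the kernel vanishes at `i` and wherever `G` does: the induction
      -- hypothesis applies.
      have hker : S (kernel η) := by
        refine ih _ (fun j hj => ?_) fun j =>
          prop_map_of_mono S (adj j) (h₁ j) ((Ψ j).map (kernel.ι η))
        by_cases hji : j = i
        · subst hji
          refine (IsZero.iff_id_eq_zero _).2 ?_
          rw [← cancel_mono ((Ψ j).map (kernel.ι η)), ← cancel_mono ((Ψ j).map η), zero_comp,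
            zero_comp, Category.id_comp, ← Functor.map_comp, kernel.condition, Functor.map_zero]
        · exact (h₀ j (by simp [hj, hji])).of_mono ((Ψ j).map (kernel.ι η))
      -- The image and an object `F` of `S` both map to `Φ (Ψ G)` by morphisms that `Ψ i` inverts.
      -- Their pullback is a subobject of `F`, hence in `S`, and the cokernel of its map to the
      -- image vanishes at `i`.
      have him : S (Abelian.image η) := by
        obtain ⟨F, hF, ⟨e⟩⟩ := h₁ i
        let k : F ⟶ (Φ i).obj ((Ψ i).obj G) := (adj i).unit.app F ≫ (Φ i).map e.hom
        have hk : IsIso ((Ψ i).map k) := by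
          rw [Functor.map_comp]
          infer_instance
        let m := Abelian.image.ι η
        let q := pullback.fst m k
        have hq : IsIso ((Ψ i).map q) :=
          (IsPullback.map (Ψ i) (IsPullback.of_hasPullback m k)).isIso_fst_of_isIso
        have hcok : S (cokernel q) := by
          refine ih _ (fun j hj => ?_) fun j => prop_map_of_epi S (adj j) (h₁ j)
            ((Ψ j).map (Abelian.factorThruImage η ≫ cokernel.π q))
          by_cases hji : j = i
          · subst hji
            refine (IsZero.iff_id_eq_zero _).2 ?_
            rw [← cancel_epi ((Ψ j).map (cokernel.π q)), ← cancel_epi ((Ψ j).map q), comp_zero,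
              comp_zero, Category.comp_id, ← Functor.map_comp, cokernel.condition,
              Functor.map_zero]
          · exact (h₀ j (by simp [hj, hji])).of_epi
              ((Ψ j).map (Abelian.factorThruImage η ≫ cokernel.π q))
        exact S.prop_X₂_of_exact (ShortComplex.exact_cokernel q)
          (S.prop_of_mono (pullback.snd m k) hF) hcok
      exact S.prop_X₂_of_exact (S := ShortComplex.mk (kernel.ι η) (Abelian.factorThruImage η)
        (by rw [← cancel_mono (Abelian.image.ι η)]; simp))
        (ShortComplex.exact_of_f_is_kernel _ (by
          exact isKernelOfComp (Abelian.image.ι η) _ (kernelIsKernel η) _ (by simp))) hker him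
  exact key Finset.univ G (by simp) hG

/-- The kernel of a morphism from a torsion-free injective object to a torsion-free object is
closed. -/
lemma closedObjects_of_injective {M P Q : C} (i : M ⟶ P) (p : P ⟶ Q) (w : i ≫ p = 0)
    (hl : IsLimit (KernelFork.ofι i w)) [Injective P]
    (hP : ∀ A, S A → ∀ g : A ⟶ P, g = 0) (hQ : ∀ A, S A → ∀ g : A ⟶ Q, g = 0) :
    closedObjects S M := by
  have hi : Mono i := mono_of_isLimit_fork hl
  intro A B f hf
  refine ⟨fun a b hab => ?_, fun g => ?_⟩
  · have h : f ≫ (a - b) = 0 := by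
      rw [Preadditive.comp_sub]
      exact sub_eq_zero.2 hab
    have h₂ : cokernel.desc f (a - b) h ≫ i = 0 := hP _ hf.2 _
    have h₃ : a - b = 0 := by
      rw [← cokernel.π_desc f (a - b) h, zero_of_comp_mono i h₂, comp_zero]
    exact sub_eq_zero.1 h₃
  · have h : kernel.ι f ≫ g = 0 := zero_of_comp_mono i (hP _ hf.1 _)
    let g' : Abelian.coimage f ⟶ M := cokernel.desc _ g h
    -- Injectivity extends `g` to a map `b` into `P`. It lands in `M` because `b ≫ p` vanishes on
    -- the image of `f`, so factors through `cokernel f`, which is in `S`.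
    let b : B ⟶ P := Injective.factorThru (g' ≫ i) (Abelian.factorThruCoimage f)
    have hb : f ≫ b = g ≫ i := by
      rw [← Abelian.coimage.fac f, Category.assoc, Injective.comp_factorThru, ← Category.assoc]
      congr 1
      exact cokernel.π_desc _ _ _
    have hb' : b ≫ p = 0 := by
      have h₁ : f ≫ b ≫ p = 0 := by rw [← Category.assoc, hb, Category.assoc, w, comp_zero]
      rw [← cokernel.π_desc f (b ≫ p) h₁, hQ _ hf.2 (cokernel.desc f (b ≫ p) h₁), comp_zero]
    obtain ⟨c, hc⟩ := KernelFork.IsLimit.lift' hl b hb'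
    refine ⟨c, ?_⟩
    rw [← cancel_mono i]
    exact (Category.assoc _ _ _).trans ((congrArg (f ≫ ·) hc).trans hb)

end Locality

end
end Reconstruction

namespace Reconstruction

noncomputable section

open scoped TensorProduct

/-! ### The tensor product of quasi-coherent sheaves -/

section Algebra

variable {R A M N M' N' : Type*} [CommRing R] [CommRing A] [Algebra R A] (f : R)
  [IsLocalization.Away f A] [AddCommGroup M] [AddCommGroup N] [AddCommGroup M'] [AddCommGroup N']
  [Module R M] [Module R N] [Module R M'] [Module R N'] [Module A M'] [Module A N']
  [IsScalarTower R A M'] [IsScalarTower R A N'] (g : M →ₗ[R] M') (h : N →ₗ[R] N')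
  [IsLocalizedModule.Away f g] [IsLocalizedModule.Away f h]

/-- The tensor product of localizations at `f` is the localization at `f` of the tensor product. -/
lemma tensorProduct_localizing (t : M ⊗[R] N →+ M' ⊗[A] N') (ht : ∀ m n, t (m ⊗ₜ n) = g m ⊗ₜ h n) :
    (∀ x, ∃ (n : ℕ) (y : M ⊗[R] N), t y = algebraMap R A (f ^ n) • x) ∧
      ∀ y, t y = 0 → ∃ n : ℕ, f ^ n • y = 0 := by
  -- For `A`-modules, tensoring over `R` and over its localization `A` agree.
  let e := (IsLocalization.moduleTensorEquiv (.powers f) A M' N').toAddEquiv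
  have he : ∀ y, e (t y) = TensorProduct.map g h y := by
    intro y
    induction y with
    | zero => simp
    | add x y hx hy => simp [hx, hy]
    | tmul m n =>
      rw [ht]
      rfl
  have hs : ∀ (r : R) x, e (algebraMap R A r • x) = r • e x := fun r x => by
    rw [← algebraMap_smul A r (e x)]
    exact (IsLocalization.moduleTensorEquiv (.powers f) A M' N').map_smul _ x
  have hl : IsLocalizedModule.Away f (TensorProduct.map g h) := inferInstance
  refine ⟨fun x => ?_, fun y hy => ?_⟩
  · obtain ⟨n, y, hy⟩ := hl.surj _ _ (e x)
    refine ⟨n, y, e.injective ?_⟩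
    rw [he, hs, ← hy]
  · obtain ⟨⟨_, n, rfl⟩, hn⟩ := (IsLocalizedModule.eq_zero_iff (.powers f)
      (TensorProduct.map g h)).mp (by rw [← he, hy, map_zero] : TensorProduct.map g h y = 0)
    exact ⟨n, hn⟩

end Algebra

/-! ### Presheaves of modules with the localization property and their associated sheaves -/

section Presheaf

variable {X : Scheme.{u}} {W : X.Opens}

/-- A local-to-global principle: when the functions for which a statement holds form an ideal, it is
enough to find one that is non-zero at each point. -/
lemma ideal_eq_top_of_cover (hW : IsAffineOpen W) (I : Ideal Γ(X, W))
    (h : ∀ p ∈ W, ∃ f ∈ I, p ∈ X.basicOpen f) : I = ⊤ := by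
  rw [← Ideal.span_eq I, ← hW.iSup_basicOpen_eq_self_iff]
  refine le_antisymm (iSup_le fun f => X.basicOpen_le _) fun p hp => ?_
  obtain ⟨f, hf, hpf⟩ := h p hp
  exact Opens.mem_iSup.2 ⟨⟨f, hf⟩, hpf⟩

lemma basicOpen_pow_mem {f : Γ(X, W)} {p : X} (hp : p ∈ X.basicOpen f) (n : ℕ) :
    p ∈ X.basicOpen (f ^ n) := by
  rcases Nat.eq_zero_or_pos n with rfl | hn
  · simpa using X.basicOpen_le f hp
  · rwa [X.basicOpen_pow _ hn]

variable {T : X.Opens → Type u} [∀ U, AddCommGroup (T U)] [∀ U, Module Γ(X, U) (T U)]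
  (ρ : ∀ {U V : X.Opens}, V ≤ U → T U →+ T V) {A : X.Modules}
  (θ : ∀ U, T U →ₗ[Γ(X, U)] Γ(A, U))

/-- Here `T`, `ρ` and `θ` stand for a presheaf of modules, its restriction maps and a locally
bijective map to a sheaf. If `θ x = 0`, then `x` vanishes near each point, so by localization the
annihilator of `x` is the unit ideal. -/
lemma injective_of_localizing
    (hρ : ∀ {U V W} (h : V ≤ U) (h' : W ≤ V) x, ρ h' (ρ h x) = ρ (h'.trans h) x)
    (hi : ∀ U x, θ U x = 0 → ∀ p ∈ U, ∃ (V : X.Opens) (h : V ≤ U), p ∈ V ∧ ρ h x = 0)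
    (hloc : ∀ U, IsAffineOpen U → ∀ f : Γ(X, U),
      (∀ x : T (X.basicOpen f), ∃ (n : ℕ) (y : T U),
        ρ (X.basicOpen_le f) y = resO (X.basicOpen_le f) (f ^ n) • x) ∧
      (∀ y : T U, ρ (X.basicOpen_le f) y = 0 → ∃ n : ℕ, f ^ n • y = 0))
    (hW : IsAffineOpen W) : Function.Injective (θ W) := by
  refine (injective_iff_map_eq_zero _).2 fun x hx => ?_
  have h : LinearMap.ker (LinearMap.toSpanSingleton Γ(X, W) _ x) = ⊤ := by
    refine ideal_eq_top_of_cover hW _ fun p hp => ?_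
    obtain ⟨V, hV, hpV, hVx⟩ := hi W x hx p hp
    obtain ⟨f, hf, hpf⟩ := hW.exists_basicOpen_le ⟨p, hpV⟩ hp
    obtain ⟨n, hn⟩ := (hloc W hW f).2 x (by rw [← hρ hV hf, hVx, map_zero])
    exact ⟨f ^ n, hn, basicOpen_pow_mem hpf n⟩
  simpa using (h.symm ▸ Submodule.mem_top :
    (1 : Γ(X, W)) ∈ LinearMap.ker (LinearMap.toSpanSingleton Γ(X, W) _ x))

/-- On a small basic open subset `b` comes from `T`, where the annihilation statement is known;
finitely many such subsets cover `W`, and the largest exponent serves. -/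
lemma pow_smul_eq_zero_of_localizing
    (hρ : ∀ {U V W} (h : V ≤ U) (h' : W ≤ V) x, ρ h' (ρ h x) = ρ (h'.trans h) x)
    (hθ : ∀ {U V} (h : V ≤ U) x, θ V (ρ h x) = res A h (θ U x))
    (hi : ∀ U x, θ U x = 0 → ∀ p ∈ U, ∃ (V : X.Opens) (h : V ≤ U), p ∈ V ∧ ρ h x = 0)
    (hs : ∀ U a, ∀ p ∈ U, ∃ (V : X.Opens) (h : V ≤ U), p ∈ V ∧ ∃ y, θ V y = res A h a)
    (hloc : ∀ U, IsAffineOpen U → ∀ f : Γ(X, U),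
      (∀ x : T (X.basicOpen f), ∃ (n : ℕ) (y : T U),
        ρ (X.basicOpen_le f) y = resO (X.basicOpen_le f) (f ^ n) • x) ∧
      (∀ y : T U, ρ (X.basicOpen_le f) y = 0 → ∃ n : ℕ, f ^ n • y = 0))
    (hW : IsAffineOpen W) (f : Γ(X, W)) (b : Γ(A, W))
    (hb : res A (X.basicOpen_le f) b = 0) : ∃ n : ℕ, f ^ n • b = 0 := by
  have key : ∀ p ∈ W, ∃ g : Γ(X, W), p ∈ X.basicOpen g ∧
      ∃ n : ℕ, resO (X.basicOpen_le g) (f ^ n) • res A (X.basicOpen_le g) b = 0 := by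
    intro p hp
    obtain ⟨V, hV, hpV, z, hz⟩ := hs W b p hp
    obtain ⟨g, hg, hpg⟩ := hW.exists_basicOpen_le ⟨p, hpV⟩ hp
    refine ⟨g, hpg, ?_⟩
    have hz' : θ _ (ρ hg z) = res A (X.basicOpen_le g) b := by rw [hθ, hz, res_res]
    have hle : X.basicOpen (resO (X.basicOpen_le g) f) ≤ X.basicOpen f := by
      rw [basicOpen_resO]
      exact inf_le_right
    obtain ⟨n, hn⟩ := (hloc _ (hW.basicOpen g) (resO (X.basicOpen_le g) f)).2 (ρ hg z) (by
      refine injective_of_localizing ρ θ hρ hi hloc ((hW.basicOpen g).basicOpen _) ?_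
      rw [hθ, hz', res_res, ← res_res (X.basicOpen_le f) hle, hb, map_zero, map_zero])
    refine ⟨n, ?_⟩
    rw [← hz', map_pow, ← map_smul, hn, map_zero]
  choose! g hg n hn using key
  obtain ⟨s, hs⟩ := hW.isCompact.elim_finite_subcover (fun p : W => (X.basicOpen (g p) : Set X))
    (fun p => (X.basicOpen (g p)).isOpen) (fun p hp => Set.mem_iUnion.2 ⟨⟨p, hp⟩, hg p hp⟩)
  refine ⟨s.sup fun p => n p, sections_eq_zero (fun p : s => X.basicOpen (g p.1))
    (fun p => X.basicOpen_le _) (fun p hp => ?_) fun p => ?_⟩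
  · obtain ⟨q, hq, hpq⟩ := Set.mem_iUnion₂.1 (hs hp)
    exact Opens.mem_iSup.2 ⟨⟨q, hq⟩, hpq⟩
  · have h := hn p.1 p.1.2
    rw [map_pow] at h
    rw [res_smul, map_pow]
    exact pow_smul_eq_zero_of_le (Finset.le_sup (f := fun p : W => n p) p.2) h

/-- A presheaf of modules with the localization property has the same sections over affine open
subsets as the associated sheaf. -/
lemma bijective_of_localizing
    (hρ : ∀ {U V W} (h : V ≤ U) (h' : W ≤ V) x, ρ h' (ρ h x) = ρ (h'.trans h) x)
    (hθ : ∀ {U V} (h : V ≤ U) x, θ V (ρ h x) = res A h (θ U x))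
    (hi : ∀ U x, θ U x = 0 → ∀ p ∈ U, ∃ (V : X.Opens) (h : V ≤ U), p ∈ V ∧ ρ h x = 0)
    (hs : ∀ U a, ∀ p ∈ U, ∃ (V : X.Opens) (h : V ≤ U), p ∈ V ∧ ∃ y, θ V y = res A h a)
    (hloc : ∀ U, IsAffineOpen U → ∀ f : Γ(X, U),
      (∀ x : T (X.basicOpen f), ∃ (n : ℕ) (y : T U),
        ρ (X.basicOpen_le f) y = resO (X.basicOpen_le f) (f ^ n) • x) ∧
      (∀ y : T U, ρ (X.basicOpen_le f) y = 0 → ∃ n : ℕ, f ^ n • y = 0))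
    (hW : IsAffineOpen W) : Function.Bijective (θ W) := by
  refine ⟨injective_of_localizing ρ θ hρ hi hloc hW, fun a => ?_⟩
  -- The functions `r` with `r • a` in the range of `θ` form an ideal. Near each point it contains a
  -- power of `f`: one exponent clears the denominator, the other the discrepancy.
  have h : (LinearMap.range (θ W)).comap (LinearMap.toSpanSingleton Γ(X, W) _ a) = ⊤ := by
    refine ideal_eq_top_of_cover hW _ fun p hp => ?_
    obtain ⟨V, hV, hpV, z, hz⟩ := hs W a p hp
    obtain ⟨f, hf, hpf⟩ := hW.exists_basicOpen_le ⟨p, hpV⟩ hp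
    obtain ⟨n, y, hy⟩ := (hloc W hW f).1 (ρ hf z)
    obtain ⟨m, hm⟩ := pow_smul_eq_zero_of_localizing ρ θ hρ hθ hi hs hloc hW f
      (f ^ n • a - θ W y) (by
        rw [map_sub, res_smul, ← hθ, hy, map_smul, hθ, hz, res_res, sub_self])
    refine ⟨f ^ (m + n), ⟨f ^ m • y, ?_⟩, basicOpen_pow_mem hpf _⟩
    rw [smul_sub, sub_eq_zero] at hm
    rw [map_smul, ← hm, pow_add, ← mul_smul]
    rfl
  obtain ⟨y, hy⟩ := (h.symm ▸ Submodule.mem_top :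
    (1 : Γ(X, W)) ∈ (LinearMap.range (θ W)).comap (LinearMap.toSpanSingleton Γ(X, W) _ a))
  exact ⟨y, by simpa using hy⟩

lemma isQcoh_of_localizing
    (hρ : ∀ {U V W} (h : V ≤ U) (h' : W ≤ V) x, ρ h' (ρ h x) = ρ (h'.trans h) x)
    (hθ : ∀ {U V} (h : V ≤ U) x, θ V (ρ h x) = res A h (θ U x))
    (hi : ∀ U x, θ U x = 0 → ∀ p ∈ U, ∃ (V : X.Opens) (h : V ≤ U), p ∈ V ∧ ρ h x = 0)
    (hs : ∀ U a, ∀ p ∈ U, ∃ (V : X.Opens) (h : V ≤ U), p ∈ V ∧ ∃ y, θ V y = res A h a)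
    (hloc : ∀ U, IsAffineOpen U → ∀ f : Γ(X, U),
      (∀ x : T (X.basicOpen f), ∃ (n : ℕ) (y : T U),
        ρ (X.basicOpen_le f) y = resO (X.basicOpen_le f) (f ^ n) • x) ∧
      (∀ y : T U, ρ (X.basicOpen_le f) y = 0 → ∃ n : ℕ, f ^ n • y = 0)) : isQcoh X A := by
  refine isQcoh_iff_isLocalizingAt.2 fun U hU f => ⟨fun a => ?_,
    pow_smul_eq_zero_of_localizing ρ θ hρ hθ hi hs hloc hU f⟩
  obtain ⟨x, rfl⟩ := (bijective_of_localizing ρ θ hρ hθ hi hs hloc (hU.basicOpen f)).2 a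
  obtain ⟨n, y, hy⟩ := (hloc U hU f).1 x
  exact ⟨n, θ U y, by rw [← hθ, hy, map_smul]⟩

end Presheaf

section Tensor

variable {X : Scheme.{u}} (F G : X.Modules)

/-- The presheaf tensor product. -/
def tensorPresheaf : PresheafOfModules X.ringCatSheaf.obj :=
  PresheafOfModules.Monoidal.tensorObj (R := X.presheaf) F.val G.val

/-- The map from the presheaf tensor product to its associated sheaf. -/
def tensorUnit : tensorPresheaf F G ⟶ (PresheafOfModules.restrictScalars (𝟙 X.ringCatSheaf.obj)).obj
    ((SheafOfModules.forget X.ringCatSheaf).obj (tensor F G)) :=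
  (PresheafOfModules.sheafificationAdjunction (𝟙 X.ringCatSheaf.obj)).unit.app (tensorPresheaf F G)

/-- The map from the tensor product of sections to the sections of the tensor product. -/
def toTensor (U : X.Opens) : Γ(F, U) ⊗[Γ(X, U)] Γ(G, U) →ₗ[Γ(X, U)] Γ(tensor F G, U) where
  toFun x := (tensorUnit F G).app (op U) x
  map_add' := map_add ((tensorUnit F G).app (op U)).hom
  map_smul' r x := ((tensorUnit F G).app (op U)).hom.map_smul r x

/-- The restriction maps of the presheaf tensor product. -/
def resTensor {U V : X.Opens} (h : V ≤ U) :
    Γ(F, U) ⊗[Γ(X, U)] Γ(G, U) →+ Γ(F, V) ⊗[Γ(X, V)] Γ(G, V) :=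
  ((tensorPresheaf F G).presheaf.map (homOfLE h).op).hom

lemma resTensor_tmul {U V : X.Opens} (h : V ≤ U) (x : Γ(F, U)) (y : Γ(G, U)) :
    resTensor F G h (x ⊗ₜ y) = res F h x ⊗ₜ res G h y := rfl

lemma resTensor_resTensor {U V W : X.Opens} (h : V ≤ U) (h' : W ≤ V)
    (x : Γ(F, U) ⊗[Γ(X, U)] Γ(G, U)) :
    resTensor F G h' (resTensor F G h x) = resTensor F G (h'.trans h) x := by
  induction x with
  | zero => simp only [map_zero]
  | add x y hx hy => simp only [map_add, hx, hy]
  | tmul x y => simp only [resTensor_tmul, res_res]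

lemma toTensor_resTensor {U V : X.Opens} (h : V ≤ U) (x : Γ(F, U) ⊗[Γ(X, U)] Γ(G, U)) :
    toTensor F G V (resTensor F G h x) = res (tensor F G) h (toTensor F G U x) :=
  congr($(((PresheafOfModules.toPresheaf _).map (tensorUnit F G)).naturality (homOfLE h).op) x)

lemma tensorUnit_locallyInjective (U : X.Opens) (x) (hx : toTensor F G U x = 0) (p : X) (hp : p ∈ U) :
    ∃ (V : X.Opens) (h : V ≤ U), p ∈ V ∧ resTensor F G h x = 0 := by
  have h : Presheaf.IsLocallyInjective (Opens.grothendieckTopology X)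
      (CategoryTheory.toSheafify (Opens.grothendieckTopology X) (tensorPresheaf F G).presheaf) :=
    inferInstance
  obtain ⟨V, i, hi, hpV⟩ := h.equalizerSieve_mem (X := op U) x 0 (hx.trans (map_zero _).symm) p hp
  exact ⟨V, i.le, hpV, hi.trans (map_zero _)⟩

lemma tensorUnit_locallySurjective (U : X.Opens) (a : Γ(tensor F G, U)) (p : X) (hp : p ∈ U) :
    ∃ (V : X.Opens) (h : V ≤ U), p ∈ V ∧ ∃ y, toTensor F G V y = res (tensor F G) h a := by
  have h : Presheaf.IsLocallySurjective (Opens.grothendieckTopology X)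
      (CategoryTheory.toSheafify (Opens.grothendieckTopology X) (tensorPresheaf F G).presheaf) :=
    inferInstance
  obtain ⟨V, i, ⟨y, hy⟩, hpV⟩ := h.imageSieve_mem (U := U) a p hp
  exact ⟨V, i.le, hpV, y, hy⟩

variable {F G}

lemma isLocalizedModule_res (hF : isQcoh X F) {U : X.Opens} (hU : IsAffineOpen U) (f : Γ(X, U))
    [Module Γ(X, U) Γ(F, X.basicOpen f)]
    (g : Γ(F, U) →ₗ[Γ(X, U)] Γ(F, X.basicOpen f)) (hg : ∀ x, g x = res F (X.basicOpen_le f) x)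
    (hs : ∀ (r : Γ(X, U)) (x : Γ(F, X.basicOpen f)), r • x = resO (X.basicOpen_le f) r • x) :
    IsLocalizedModule.Away f g := by
  have h := isQcoh_iff_isLocalizingAt.1 hF U hU f
  refine IsLocalizedModule.Away.mk_of_addCommGroup ?_ (fun x => ?_) (fun y hy => ?_)
  · have hu : IsUnit (resO (X.basicOpen_le f) f) :=
      RingedSpace.isUnit_res_basicOpen X.toRingedSpace f
    rw [Module.End.isUnit_iff]
    refine ⟨fun x y hxy => ?_, fun y => ?_⟩
    · refine hu.smul_left_cancel.1 ?_
      rw [← hs, ← hs]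
      exact hxy
    · obtain ⟨v, hv⟩ := hu
      refine ⟨v⁻¹ • y, ?_⟩
      change f • (v⁻¹ • y) = y
      rw [hs, ← hv]
      exact smul_inv_smul v y
  · obtain ⟨n, y, hy⟩ := h.1 x
    exact ⟨n, y, by rw [hg, hy, hs]⟩
  · exact h.2 y (by rw [← hg, hy])

lemma resTensor_localizing (hF : isQcoh X F) (hG : isQcoh X G) {U : X.Opens} (hU : IsAffineOpen U)
    (f : Γ(X, U)) :
    (∀ x, ∃ (n : ℕ) (y : Γ(F, U) ⊗[Γ(X, U)] Γ(G, U)),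
      resTensor F G (X.basicOpen_le f) y = resO (X.basicOpen_le f) (f ^ n) • x) ∧
    (∀ y, resTensor F G (X.basicOpen_le f) y = 0 → ∃ n : ℕ, f ^ n • y = 0) := by
  have := hU.isLocalization_basicOpen f
  let : Module Γ(X, U) Γ(F, X.basicOpen f) := Module.compHom _ (resO (X.basicOpen_le f))
  let : Module Γ(X, U) Γ(G, X.basicOpen f) := Module.compHom _ (resO (X.basicOpen_le f))
  have : IsScalarTower Γ(X, U) Γ(X, X.basicOpen f) Γ(F, X.basicOpen f) :=
    ⟨fun r s x => mul_smul (resO (X.basicOpen_le f) r) s x⟩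
  have : IsScalarTower Γ(X, U) Γ(X, X.basicOpen f) Γ(G, X.basicOpen f) :=
    ⟨fun r s x => mul_smul (resO (X.basicOpen_le f) r) s x⟩
  let g : Γ(F, U) →ₗ[Γ(X, U)] Γ(F, X.basicOpen f) :=
    { toFun := res F (X.basicOpen_le f), map_add' := map_add _, map_smul' := res_smul _ }
  let h : Γ(G, U) →ₗ[Γ(X, U)] Γ(G, X.basicOpen f) :=
    { toFun := res G (X.basicOpen_le f), map_add' := map_add _, map_smul' := res_smul _ }
  have := isLocalizedModule_res hF hU f g (fun _ => rfl) (fun _ _ => rfl)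
  have := isLocalizedModule_res hG hU f h (fun _ => rfl) (fun _ _ => rfl)
  exact tensorProduct_localizing (A := Γ(X, X.basicOpen f)) f g h
    (resTensor F G (X.basicOpen_le f)) (resTensor_tmul F G _)

/-- The tensor product of quasi-coherent sheaves is quasi-coherent. -/
lemma isQcoh_tensor (hF : isQcoh X F) (hG : isQcoh X G) : isQcoh X (tensor F G) :=
  isQcoh_of_localizing (resTensor F G) (toTensor F G) (resTensor_resTensor F G)
    (toTensor_resTensor F G) (tensorUnit_locallyInjective F G)
    (tensorUnit_locallySurjective F G) fun _ hU => resTensor_localizing hF hG hU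

/-- The sections of the tensor product over an affine open subset. -/
lemma bijective_toTensor (hF : isQcoh X F) (hG : isQcoh X G) {W : X.Opens} (hW : IsAffineOpen W) :
    Function.Bijective (toTensor F G W) :=
  bijective_of_localizing (resTensor F G) (toTensor F G) (resTensor_resTensor F G)
    (toTensor_resTensor F G) (tensorUnit_locallyInjective F G)
    (tensorUnit_locallySurjective F G) (fun _ hU => resTensor_localizing hF hG hU) hW

end Tensor

end
end Reconstruction

namespace Reconstruction

noncomputable section

/-! ### Stalks and supports -/

section Vanishing

variable {X : Scheme.{u}}

lemma res_basicOpen_eq_zero {F : X.Modules} {W : X.Opens} {f : Γ(X, W)}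
    {x : Γ(F, W)} (h : f • x = 0) : res F (X.basicOpen_le f) x = 0 := by
  have hu : IsUnit (resO (X.basicOpen_le f) f) :=
    RingedSpace.isUnit_res_basicOpen X.toRingedSpace f
  refine hu.smul_eq_zero.1 ?_
  rw [← res_smul, h, map_zero]

/-- The stalk of a quasi-coherent sheaf vanishes if and only if every section over an affine
neighbourhood is annihilated by a function that does not vanish at the point. -/
lemma vanishingAt_iff {P : X} {W : X.Opens} (hW : IsAffineOpen W) (hP : P ∈ W) (F : Qcoh X) :
    vanishingAt P F ↔ ∀ x : Γ(F.obj, W), ∃ f : Γ(X, W), P ∈ X.basicOpen f ∧ f • x = 0 := by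
  have hF := isQcoh_iff_isLocalizingAt.1 F.property W hW
  constructor
  · intro h x
    have := AddCommGrpCat.subsingleton_of_isZero h
    obtain ⟨V, hPV, i, j, hx⟩ := TopCat.Presheaf.germ_eq F.obj.presheaf P hP hP x 0
      (Subsingleton.elim _ _)
    obtain ⟨f, hf, hPf⟩ := hW.exists_basicOpen_le ⟨P, hPV⟩ hP
    have hx' : res F.obj i.le x = 0 := hx.trans (map_zero _)
    obtain ⟨n, hn⟩ := (hF f).2 x (by rw [← res_res i.le hf, hx', map_zero])
    exact ⟨f ^ n, basicOpen_pow_mem hPf n, hn⟩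
  · intro h
    have : Subsingleton (↑(TopCat.Presheaf.stalk F.obj.presheaf P) : Type u) := by
      refine subsingleton_of_forall_eq 0 fun t => ?_
      obtain ⟨U, hPU, x, rfl⟩ := TopCat.Presheaf.exists_germ_eq F.obj.presheaf t
      obtain ⟨f, hf, hPf⟩ := hW.exists_basicOpen_le ⟨P, hPU⟩ hP
      obtain ⟨n, y, hy⟩ := (hF f).1 (res F.obj hf x)
      obtain ⟨g, hPg, hg⟩ := h y
      have hy0 := res_basicOpen_eq_zero hg
      have hu : IsUnit (resO (X.basicOpen_le f) (f ^ n)) := by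
        rw [map_pow]
        exact (RingedSpace.isUnit_res_basicOpen X.toRingedSpace f).pow n
      have hD : res F.obj (inf_le_left : X.basicOpen f ⊓ X.basicOpen g ≤ _) (res F.obj hf x) = 0 := by
        have hu' := hu.map (resO (inf_le_left : X.basicOpen f ⊓ X.basicOpen g ≤ _))
        refine hu'.smul_eq_zero.1 ?_
        rw [← res_smul, ← hy, res_res, ← res_res (X.basicOpen_le g) inf_le_right, hy0, map_zero]
      rw [res_res] at hD
      have e := TopCat.Presheaf.germ_res_apply F.obj.presheaf
        (homOfLE (inf_le_left.trans hf : X.basicOpen f ⊓ X.basicOpen g ≤ U)) P ⟨hPf, hPg⟩ x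
      rw [← e]
      exact (congrArg _ hD).trans (map_zero _)
    exact AddCommGrpCat.isZero_of_subsingleton _

end Vanishing

section

variable {X : Scheme.{u}}

lemma restrAdj_unit_app {Y : Scheme.{u}} (j : Y ⟶ X) [IsOpenImmersion j] [QuasiCompact j]
    [QuasiSeparated j] (F : Qcoh X) (U : X.Opens) (x : Γ(F.obj, U)) :
    ((restrAdj j).unit.app F).hom.app U x = res F.obj (j.image_preimage_le U) x := by
  rfl

end

/-! ### Tensor-closed Serre subcategories are closed under direct images of restrictions -/

section TensorSerre

variable {X : Scheme.{u}} [QuasiSeparatedSpace X]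

/-- `extend` applied to the sections of `F` is the direct image of the restriction of `F`. -/
def extendSecIso {W : X.Opens} (hW : IsAffineOpen W) (F : Qcoh X) :
    (extend hW).obj ((sec W).obj F) ≅ (push hW.fromSpec).obj ((restr hW.fromSpec).obj F) :=
  (extend hW).mapIso ((secIso hW).app F).symm ≪≫
    (push hW.fromSpec).mapIso ((tildeQ Γ(X, W)).counitIso.app ((restr hW.fromSpec).obj F))

variable (S : ObjectProperty (Qcoh X)) [S.IsSerreClass]

/-- The functors `sec (W i)` are exact, have fully faithful right adjoints and jointly detect zero,
so this is a case of `prop_of_map`. -/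
lemma prop_of_sections {ι : Type*} [Finite ι] (W : ι → X.Opens) (hW : ∀ i, IsAffineOpen (W i))
    (hc : ⨆ i, W i = ⊤) {G : Qcoh X} (hG : ∀ i, S.map (sec (W i)) ((sec (W i)).obj G)) : S G := by
  have (i : ι) := preservesFiniteColimits_sec (hW i)
  exact prop_of_map S (fun i => secAdj (hW i))
    (fun G h => isZero_of_cover W hc fun i => ⟨hW i, h i⟩) hG

open scoped TensorProduct

variable {S} in
-- Let `G` be the direct image of `Γ(X, D(f))`, viewed as a module over `Γ(X, V)`. Then `N` is a
-- quotient of the sections of `F ⊗ G` over `V`, since a section over `D(f)` is some `η x` divided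
-- by a power of `f`. The map `ρ` leaves open how `H(D(f))` is made a module over `Γ(X, V)`.
lemma prop_map_sections_basicOpen (hT : ∀ F G : Qcoh X, S F →
    ∃ h : isQcoh X (tensor F.obj G.obj), S ⟨tensor F.obj G.obj, h⟩) {F : Qcoh X} (hF : S F)
    {V : X.Opens} (hV : IsAffineOpen V) (f : Γ(X, V)) {H : Qcoh X} (η : F ⟶ H)
    (hη : Function.Surjective (η.hom.app (X.basicOpen f))) (N : ModuleCat.{u} Γ(X, V))
    (ρ : Γ(H.obj, X.basicOpen f) ≃+ N)
    (hρ : ∀ (r : Γ(X, V)) x, ρ (resO (X.basicOpen_le f) r • x) = r • ρ x) :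
    S.map (sec V) N := by
  let A : ModuleCat.{u} Γ(X, V) := ModuleCat.of Γ(X, V) Γ(X, X.basicOpen f)
  let G := (extend hV).obj A
  let c : Γ(G.obj, V) →ₗ[Γ(X, V)] Γ(X, X.basicOpen f) := ((secAdj hV).counit.app A).hom
  have hc : Function.Surjective c :=
    (ModuleCat.epi_iff_surjective ((secAdj hV).counit.app A)).1 inferInstance
  have hcs (r : Γ(X, V)) (y) : c (r • y) = resO (X.basicOpen_le f) r * c y := map_smul c r y
  let b : Γ(F.obj, V) →ₗ[Γ(X, V)] Γ(G.obj, V) →ₗ[Γ(X, V)] N :=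
    LinearMap.mk₂ Γ(X, V) (fun x y => ρ (c y • res H.obj (X.basicOpen_le f) (η.hom.app V x)))
      (fun x x' y => by rw [map_add, map_add, smul_add, map_add])
      (fun r x y => by rw [Scheme.Modules.Hom.app_smul, res_smul, smul_comm, hρ])
      (fun x y y' => by rw [map_add, add_smul, map_add])
      (fun r x y => by rw [hcs, mul_smul, hρ])
  obtain ⟨h, hS⟩ := hT F G hF
  have := preservesFiniteColimits_sec hV
  let e := LinearEquiv.ofBijective (toTensor F.obj G.obj V)
    (bijective_toTensor F.property G.property hV)
  let g : (sec V).obj ⟨tensor F.obj G.obj, h⟩ ⟶ N :=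
    ModuleCat.ofHom ((TensorProduct.lift b).comp e.symm.toLinearMap)
  have hg : Epi g := by
    rw [ModuleCat.epi_iff_surjective]
    intro z
    obtain ⟨z, rfl⟩ := ρ.surjective z
    obtain ⟨z, rfl⟩ := hη z
    obtain ⟨n, x, hx⟩ := (isQcoh_iff_isLocalizingAt.1 F.property V hV f).1 z
    have hu : IsUnit (resO (X.basicOpen_le f) (f ^ n)) := by
      rw [map_pow]
      exact (RingedSpace.isUnit_res_basicOpen X.toRingedSpace f).pow n
    obtain ⟨v, hv⟩ := hu
    obtain ⟨y, hy⟩ := hc (↑v⁻¹ : Γ(X, X.basicOpen f))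
    refine ⟨toTensor F.obj G.obj V (x ⊗ₜ y), ?_⟩
    have h₁ : e.symm (toTensor F.obj G.obj V (x ⊗ₜ y)) = x ⊗ₜ y := e.symm_apply_apply _
    change TensorProduct.lift b (e.symm (toTensor F.obj G.obj V (x ⊗ₜ y))) = _
    rw [h₁, TensorProduct.lift.tmul]
    change ρ (c y • res H.obj (X.basicOpen_le f) (η.hom.app V x)) = _
    rw [hy, ← app_res', hx, ← hv, Scheme.Modules.Hom.app_smul, ← mul_smul, v.inv_mul, one_smul]
  exact prop_map_of_epi_obj S (secAdj hV) hS g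

variable {S} in
/-- A Serre subcategory closed under tensor products is closed under the direct images of
restrictions to affine open subsets. -/
lemma prop_extend_sec [CompactSpace X] (hT : ∀ F G : Qcoh X, S F →
    ∃ h : isQcoh X (tensor F.obj G.obj), S ⟨tensor F.obj G.obj, h⟩) {F : Qcoh X} (hF : S F)
    {W : X.Opens} (hW : IsAffineOpen W) : S ((extend hW).obj ((sec W).obj F)) := by
  let j := hW.fromSpec
  let H := (push j).obj ((restr j).obj F)
  let η : F ⟶ H := (restrAdj j).unit.app F
  refine S.prop_of_iso (extendSecIso hW F).symm (?_ : S H)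
  obtain ⟨ι, _, V, hV, hc⟩ := exists_finite_affine_cover (X := X) (U := ⊤) isCompact_univ
  refine prop_of_sections S V hV hc.symm fun i => ?_
  have hq : IsCompact ((W ⊓ V i : X.Opens) : Set X) :=
    QuasiSeparatedSpace.inter_isCompact _ _ W.isOpen hW.isCompact (V i).isOpen (hV i).isCompact
  -- `W ⊓ V i` is covered by finitely many basic open subsets of `V i`, so the sections of `H` over
  -- `V i` embed into the product of those over these subsets. On each of them `η` is surjective,
  -- being contained in `W`.
  have key : ∀ p ∈ W ⊓ V i, ∃ f : Γ(X, V i), X.basicOpen f ≤ W ∧ p ∈ X.basicOpen f := fun p hp =>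
    (hV i).exists_basicOpen_le ⟨p, hp.1⟩ hp.2
  choose! f hfW hpf using key
  obtain ⟨s, hs⟩ := hq.elim_finite_subcover
    (fun p : (W ⊓ V i : X.Opens) => (X.basicOpen (f p) : Set X))
    (fun p => (X.basicOpen (f p)).isOpen) (fun p hp => Set.mem_iUnion.2 ⟨⟨p, hp⟩, hpf p hp⟩)
  have := preservesFiniteColimits_sec (hV i)
  let g (k : s) : (sec (V i)).obj H ⟶
      (ModuleCat.restrictScalars (resO (X.basicOpen_le (f k.1)))).obj
      ((sec (X.basicOpen (f k.1))).obj H) :=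
    ModuleCat.ofHom (Y := (ModuleCat.restrictScalars (resO (X.basicOpen_le (f k.1)))).obj
      ((sec (X.basicOpen (f k.1))).obj H))
      { toFun := fun x => res H.obj (X.basicOpen_le (f k.1)) x
        map_add' := map_add _
        map_smul' := res_smul _ }
  refine prop_map_of_jointly_mono S (secAdj (hV i)) (K := s) (fun k =>
    prop_map_sections_basicOpen hT hF (hV i) (f k.1) η (fun z => ?_) _ (AddEquiv.refl _)
      fun _ _ => rfl) g fun {Z} a ha => ?_
  · have hle : X.basicOpen (f k.1) ≤ j ''ᵁ j ⁻¹ᵁ X.basicOpen (f k.1) := by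
      rw [j.image_preimage_eq_opensRange_inf, hW.opensRange_fromSpec]
      exact le_inf (hfW _ k.1.2) le_rfl
    refine ⟨res F.obj hle z, (restrAdj_unit_app j F _ _).trans ?_⟩
    exact (res_res _ _ _).trans (res_self _ _)
  · ext z
    refine sections_eq_zero (F := F.obj) (U := j ''ᵁ j ⁻¹ᵁ V i)
      (fun k : s => j ''ᵁ j ⁻¹ᵁ X.basicOpen (f k.1))
      (fun k => j.image_mono (j.preimage_mono (X.basicOpen_le _))) (fun p hp => ?_)
      (x := (show Γ(H.obj, V i) from a z)) (fun k => ?_)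
    · rw [j.image_preimage_eq_opensRange_inf, hW.opensRange_fromSpec] at hp
      obtain ⟨k, hk, hpk⟩ := Set.mem_iUnion₂.1 (hs hp)
      refine Opens.mem_iSup.2 ⟨⟨k, hk⟩, ?_⟩
      rw [j.image_preimage_eq_opensRange_inf, hW.opensRange_fromSpec]
      exact ⟨hp.1, hpk⟩
    · exact congr($(ha k) z)

end TensorSerre

end
end Reconstruction

namespace Reconstruction

noncomputable section

/-! ### Torsion classes of modules -/

section Modules

variable {R : Type u} [CommRing R]

/-- A torsion class of modules: a Serre class that contains a module as soon as it contains its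
finitely generated submodules. -/
class IsTorsionClass (T : ObjectProperty (ModuleCat.{u} R)) : Prop extends T.IsSerreClass where
  of_fg (M : Type u) [AddCommGroup M] [Module R M] :
    (∀ N : Submodule R M, N.FG → T (ModuleCat.of R N)) → T (ModuleCat.of R M)

variable (T : ObjectProperty (ModuleCat.{u} R)) [IsTorsionClass T]
  {M N : Type u} [AddCommGroup M] [Module R M] [AddCommGroup N] [Module R N]

variable {T}

lemma prop_of_injective (f : M →ₗ[R] N) (hf : Function.Injective f) (h : T (ModuleCat.of R N)) :
    T (ModuleCat.of R M) := by
  have : Mono (ModuleCat.ofHom f) := (ModuleCat.mono_iff_injective _).2 hf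
  exact T.prop_of_mono (ModuleCat.ofHom f) h

lemma prop_of_surjective (f : M →ₗ[R] N) (hf : Function.Surjective f) (h : T (ModuleCat.of R M)) :
    T (ModuleCat.of R N) := by
  have : Epi (ModuleCat.ofHom f) := (ModuleCat.epi_iff_surjective _).2 hf
  exact T.prop_of_epi (ModuleCat.ofHom f) h

lemma prop_of_submodule (K : Submodule R M) (h : T (ModuleCat.of R K))
    (h' : T (ModuleCat.of R (M ⧸ K))) : T (ModuleCat.of R M) := by
  refine T.prop_X₂_of_exact (S := ShortComplex.mk (ModuleCat.ofHom K.subtype)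
    (ModuleCat.ofHom K.mkQ) (by ext x; simp)) ?_ h h'
  rw [ShortComplex.moduleCat_exact_iff]
  intro x hx
  exact ⟨⟨x, (Submodule.Quotient.mk_eq_zero K).1 hx⟩, rfl⟩

variable (T) in
/-- An element is torsion if the cyclic submodule that it generates is. -/
def IsTorsionElt (x : M) : Prop := T (ModuleCat.of R (R ⧸ Ideal.torsionOf R M x))

lemma prop_span_singleton {x : M} (hx : IsTorsionElt T x) :
    T (ModuleCat.of R (Submodule.span R {x})) :=
  T.prop_of_iso (Ideal.quotTorsionOfEquivSpanSingleton R M x).toModuleIso hx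

lemma IsTorsionElt.of_prop (h : T (ModuleCat.of R M)) (x : M) : IsTorsionElt T x := by
  refine prop_of_injective
    ((Submodule.subtype _).comp (Ideal.quotTorsionOfEquivSpanSingleton R M x).toLinearMap) ?_ h
  exact (Submodule.subtype_injective _).comp (Ideal.quotTorsionOfEquivSpanSingleton R M x).injective

lemma prop_quotient_of_le {I J : Ideal R} (h : I ≤ J) (hI : T (ModuleCat.of R (R ⧸ I))) :
    T (ModuleCat.of R (R ⧸ J)) :=
  prop_of_surjective (Submodule.factor h) (Submodule.factor_surjective h) hI

lemma IsTorsionElt.of_le {x : M} {y : N} (h : ∀ r : R, r • x = 0 → r • y = 0)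
    (hx : IsTorsionElt T x) : IsTorsionElt T y :=
  prop_quotient_of_le (fun r hr => (Ideal.mem_torsionOf_iff y r).2
    (h r ((Ideal.mem_torsionOf_iff x r).1 hr))) hx

lemma isTorsionElt_of_ideal {x : M} {I : Ideal R} (hI : T (ModuleCat.of R (R ⧸ I)))
    (h : ∀ r ∈ I, r • x = 0) : IsTorsionElt T x :=
  prop_quotient_of_le (fun r hr => (Ideal.mem_torsionOf_iff x r).2 (h r hr)) hI

/-- Only finitely generated submodules matter, and those are built from torsion cyclic modules by
quotients and extensions. -/
lemma prop_of_isTorsionElt (h : ∀ x : M, IsTorsionElt T x) : T (ModuleCat.of R M) := by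
  refine IsTorsionClass.of_fg M fun N hN => ?_
  induction N, hN using Submodule.fg_induction with
  | singleton x => exact prop_span_singleton (h x)
  | sup N₁ N₂ _ _ h₁ h₂ =>
    refine prop_of_submodule (N₁.submoduleOf (N₁ ⊔ N₂)) ?_ ?_
    · exact T.prop_of_iso (Submodule.submoduleOfEquivOfLe le_sup_left).symm.toModuleIso h₁
    · refine prop_of_surjective ((Submodule.mkQ _).comp (Submodule.inclusion le_sup_right)) ?_ h₂
      intro y
      obtain ⟨⟨y, hy⟩, rfl⟩ := Submodule.mkQ_surjective _ y
      obtain ⟨a, ha, b, hb, rfl⟩ := Submodule.mem_sup.1 hy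
      refine ⟨⟨b, hb⟩, ?_⟩
      refine (Submodule.Quotient.eq _).2 ?_
      change b - (a + b) ∈ N₁
      simpa using ha

variable (T M) in
/-- The submodule of torsion elements. -/
def torsionSubmodule : Submodule R M where
  carrier := {x | IsTorsionElt T x}
  zero_mem' := by
    refine isTorsionElt_of_ideal (I := ⊤) (T.prop_of_isZero ?_) (by simp)
    have : Subsingleton (R ⧸ (⊤ : Ideal R)) := Submodule.Quotient.subsingleton_iff.2 rfl
    exact ModuleCat.isZero_of_subsingleton _
  add_mem' {x y} hx hy := by
    -- Scalars that kill the pair `(x, y)` kill `x + y`, and the product of two torsion cyclic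
    -- modules is torsion.
    have h : T (ModuleCat.of R (Submodule.span R {x} × Submodule.span R {y})) := by
      refine T.prop_of_iso ?_
        (T.prop_biprod (prop_span_singleton hx) (prop_span_singleton hy))
      exact ModuleCat.biprodIsoProd _ _
    refine IsTorsionElt.of_le (fun r hr => ?_) (IsTorsionElt.of_prop h
      (⟨x, Submodule.mem_span_singleton_self x⟩, ⟨y, Submodule.mem_span_singleton_self y⟩))
    have h₁ : r • x = 0 := congrArg (fun z => (z.1 : M)) hr
    have h₂ : r • y = 0 := congrArg (fun z => (z.2 : M)) hr
    rw [smul_add, h₁, h₂, add_zero]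
  smul_mem' r x hx := hx.of_le fun s hs => by rw [smul_comm, hs, smul_zero]

lemma prop_torsionSubmodule : T (ModuleCat.of R (torsionSubmodule T M)) :=
  prop_of_isTorsionElt fun x => IsTorsionElt.of_le (x := x.1)
    (fun _ hr => Subtype.ext hr) x.2

variable (T M) in
/-- A module is torsion-free if it has no torsion elements other than zero. -/
def IsTorsionFree : Prop := ∀ x : M, IsTorsionElt T x → x = 0

/-- If a multiple of `x` by each element of an ideal with torsion quotient is torsion, so is `x`. -/
lemma IsTorsionElt.of_smul {x : M} {I : Ideal R} (hI : T (ModuleCat.of R (R ⧸ I)))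
    (h : ∀ r ∈ I, IsTorsionElt T (r • x)) : IsTorsionElt T x := by
  -- The span of `x` is an extension of a module killed by `I` by its own torsion part `K`.
  let K : Submodule R (Submodule.span R {x}) := (torsionSubmodule T M).comap (Submodule.subtype _)
  have hs : T (ModuleCat.of R (Submodule.span R {x})) := by
    refine prop_of_submodule K ?_ ?_
    · exact prop_of_isTorsionElt fun y => IsTorsionElt.of_le (x := y.1.1)
        (fun _ hr => Subtype.ext (Subtype.ext hr)) y.2
    · refine prop_of_isTorsionElt fun y => ?_
      obtain ⟨⟨y, hy⟩, rfl⟩ := Submodule.mkQ_surjective _ y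
      obtain ⟨a, rfl⟩ := Submodule.mem_span_singleton.1 hy
      refine isTorsionElt_of_ideal hI fun r hr => (Submodule.Quotient.mk_eq_zero _).2 ?_
      change IsTorsionElt T (r • a • x)
      rw [smul_comm]
      exact (torsionSubmodule T M).smul_mem a (h r hr)
  exact IsTorsionElt.of_le (fun _ hr => congrArg Subtype.val hr)
    (IsTorsionElt.of_prop hs ⟨x, Submodule.mem_span_singleton_self x⟩)

lemma isTorsionFree_quotient : IsTorsionFree T (M ⧸ torsionSubmodule T M) := by
  intro x hx
  obtain ⟨x, rfl⟩ := Submodule.mkQ_surjective _ x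
  refine (Submodule.Quotient.mk_eq_zero _).2 (IsTorsionElt.of_smul hx fun r hr => ?_)
  exact (Submodule.Quotient.mk_eq_zero _).1 hr

lemma IsTorsionFree.eq_zero (hN : IsTorsionFree T N) {A : ModuleCat.{u} R} (hA : T A)
    (g : A ⟶ ModuleCat.of R N) : g = 0 := by
  ext x
  refine hN _ ((IsTorsionElt.of_prop (T := T) (M := A) hA x).of_le fun r hr => ?_)
  exact (map_smul g.hom r x).symm.trans ((congrArg g hr).trans (map_zero g.hom))

lemma exists_maximal_disjoint (N t : Submodule R M) (h : Disjoint N t) :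
    ∃ E, N ≤ E ∧ Disjoint E t ∧ ∀ E', E ≤ E' → Disjoint E' t → E' = E := by
  obtain ⟨E, hE, hm⟩ := zorn_le_nonempty₀ {E : Submodule R M | Disjoint E t}
    (fun c hc hc' y hy => ⟨sSup c, (hc'.directedOn.disjoint_sSup_left).2 fun a ha => hc ha,
      fun z hz => le_sSup hz⟩) N h
  exact ⟨E, hE, hm.1, fun E' hle hd => le_antisymm (hm.2 hd hle) hle⟩

/-- The quotient of `M` by its torsion is non-zero and embeds into an injective `E₀`. A submodule
`E` of `E₀` that contains it and is maximal among those disjoint from the torsion `t` is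
torsion-free, and is shown to be a direct summand of `E₀`. -/
lemma exists_torsionFree_injective (hM : ¬ T (ModuleCat.of R M)) :
    ∃ (E : Type u) (_ : AddCommGroup E) (_ : Module R E), Injective (ModuleCat.of R E) ∧
      IsTorsionFree T E ∧ ∃ g : M →ₗ[R] E, g ≠ 0 := by
  let Q := M ⧸ torsionSubmodule T M
  obtain ⟨E₀, _, i, hi⟩ : ∃ (E₀ : ModuleCat.{u} R) (_ : Injective E₀) (i : Q →ₗ[R] E₀),
      Function.Injective i :=
    ⟨Injective.under (ModuleCat.of R Q), inferInstance, (Injective.ι (ModuleCat.of R Q)).hom,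
      (ModuleCat.mono_iff_injective (Injective.ι _)).1 inferInstance⟩
  let t := torsionSubmodule T E₀
  have hd : Disjoint (LinearMap.range i) t := by
    rw [Submodule.disjoint_def]
    rintro _ ⟨x, rfl⟩ hx
    rw [isTorsionFree_quotient x (IsTorsionElt.of_le (fun r hr => hi ?_) hx), map_zero]
    rw [map_smul, hr, map_zero]
  obtain ⟨E, hE, hEt, hEm⟩ := exists_maximal_disjoint _ _ hd
  obtain ⟨D, hD, hDE, hDm⟩ := exists_maximal_disjoint _ _ hEt.symm
  let a : E →ₗ[R] E₀ ⧸ D := D.mkQ.comp E.subtype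
  have ha : Function.Injective a := by
    refine (injective_iff_map_eq_zero _).2 fun x hx => Subtype.ext ?_
    exact Submodule.disjoint_def.1 hDE _ ((Submodule.Quotient.mk_eq_zero D).1 hx) x.2
  have : Mono (ModuleCat.ofHom a) := (ModuleCat.mono_iff_injective _).2 ha
  -- `D` is a complement of `E` containing `t`, chosen maximal. The inclusion of `E` extends to `q`,
  -- whose range contains `E`; once the range is shown disjoint from `t`, maximality of `E` makes it
  -- equal to `E`, and `q` composed with the projection is a retraction.
  let q : E₀ ⧸ D →ₗ[R] E₀ :=
    (Injective.factorThru (J := E₀) (ModuleCat.ofHom E.subtype) (ModuleCat.ofHom a)).hom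
  have hq (x : E₀) (hx : x ∈ E) : q (D.mkQ x) = x :=
    congr($(Injective.comp_factorThru (J := E₀) (ModuleCat.ofHom E.subtype) (ModuleCat.ofHom a))
      (⟨x, hx⟩ : E))
  have hrange : LinearMap.range q = E := by
    refine hEm _ (fun x hx => ⟨_, hq x hx⟩) (Submodule.disjoint_def.2 ?_)
    rintro _ ⟨y, rfl⟩ hy
    obtain ⟨y, rfl⟩ := D.mkQ_surjective y
    have hyD : y ∈ D := by
      rw [← hDm (D ⊔ Submodule.span R {y}) le_sup_left ?_]
      · exact Submodule.mem_sup_right (Submodule.mem_span_singleton_self y)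
      · refine Submodule.disjoint_def.2 fun z hz hzE => ?_
        obtain ⟨d, hd, b, hb, rfl⟩ := Submodule.mem_sup.1 hz
        obtain ⟨r, rfl⟩ := Submodule.mem_span_singleton.1 hb
        refine Submodule.disjoint_def.1 hEt _ hzE ?_
        rw [← hq _ hzE, map_add, show D.mkQ d = 0 from (Submodule.Quotient.mk_eq_zero D).2 hd,
          zero_add, map_smul, map_smul]
        exact t.smul_mem r hy
    rw [show D.mkQ y = 0 from (Submodule.Quotient.mk_eq_zero D).2 hyD, map_zero]
  let p : E₀ →ₗ[R] E := (q.comp D.mkQ).codRestrict E fun x => hrange ▸ ⟨_, rfl⟩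
  refine ⟨E, inferInstance, inferInstance, ⟨fun {A B} g f _ => ?_⟩, fun x hx => ?_,
    (i.codRestrict E fun x => hE ⟨x, rfl⟩).comp (Submodule.mkQ _), fun h => hM ?_⟩
  · refine ⟨Injective.factorThru (J := E₀) (g ≫ ModuleCat.ofHom E.subtype) f ≫ ModuleCat.ofHom p, ?_⟩
    ext x
    have h := congr($(Injective.comp_factorThru (J := E₀) (g ≫ ModuleCat.ofHom E.subtype) f) x)
    exact (congrArg (fun z => q (D.mkQ z)) h).trans (hq _ (g x).2)
  · refine Subtype.ext (Submodule.disjoint_def.1 hEt _ x.2 (IsTorsionElt.of_le (fun r hr => ?_) hx))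
    exact congrArg Subtype.val hr
  · refine prop_of_isTorsionElt fun x => (Submodule.Quotient.mk_eq_zero _).1 (hi ?_)
    rw [map_zero]
    exact congrArg Subtype.val (LinearMap.congr_fun h x)

lemma injective_pi {K : Type u} {E : K → Type u} [∀ k, AddCommGroup (E k)] [∀ k, Module R (E k)]
    (hE : ∀ k, Injective (ModuleCat.of R (E k))) : Injective (ModuleCat.of R (∀ k, E k)) where
  factors {A B} g f _ := by
    refine ⟨ModuleCat.ofHom (LinearMap.pi fun k => (Injective.factorThru (J := ModuleCat.of R (E k))
      (g ≫ ModuleCat.ofHom (LinearMap.proj k)) f).hom), ?_⟩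
    ext x k
    exact congr($(Injective.comp_factorThru (J := ModuleCat.of R (E k))
      (g ≫ ModuleCat.ofHom (LinearMap.proj k)) f) x)

/-- If an ideal with torsion quotient contains no finitely generated ideal with torsion quotient,
then the union of some directed system of submodules with torsion-free quotients of a torsion-free
injective module has a quotient that is not torsion-free. -/
lemma exists_directed_of_not_fg {I : Ideal R} (hI : T (ModuleCat.of R (R ⧸ I)))
    (hfg : ∀ l ≤ I, l.FG → ¬ T (ModuleCat.of R (R ⧸ l))) :
    ∃ (K : Type u) (_ : PartialOrder K) (_ : IsDirectedOrder K) (_ : Nonempty K) (P : Type u)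
      (_ : AddCommGroup P) (_ : Module R P) (M : K →o Submodule R P),
      Injective (ModuleCat.of R P) ∧ IsTorsionFree T P ∧ (∀ k, IsTorsionFree T (P ⧸ M k)) ∧
      ¬ IsTorsionFree T (P ⧸ ⨆ k, M k) := by
  -- The system is indexed by the finitely generated ideals `l ≤ I`; each gives a non-zero map from
  -- `R ⧸ l` to a torsion-free injective module, and `e l` is the image of 1.
  let K := {l : Ideal R // l ≤ I ∧ l.FG}
  choose E i₁ i₂ hE hEt g hg using fun l : K => exists_torsionFree_injective (hfg l.1 l.2.1 l.2.2)
  let e (l : K) : E l := g l (Submodule.mkQ _ 1)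
  have he (l : K) : e l ≠ 0 := fun h => hg l (by
    refine Submodule.linearMap_qext _ (LinearMap.ext_ring ?_)
    exact h.trans (LinearMap.zero_apply _).symm)
  have hle (l : K) (r : R) (hr : r ∈ l.1) : r • e l = 0 := by
    rw [← map_smul, ← map_smul, show Submodule.mkQ l.1 (r • 1) = 0 from
      (Submodule.Quotient.mk_eq_zero _).2 (by simpa using hr), map_zero]
  -- `M k` consists of the families that vanish at all `l ≥ k`; the quotient by it embeds into the
  -- product over these `l`, so is torsion-free.
  let M : K →o Submodule R (∀ l, E l) :=
    { toFun := fun k => ⨅ l : K, ⨅ _ : k ≤ l, LinearMap.ker (LinearMap.proj l)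
      monotone' := fun k k' h => le_iInf₂ fun l hl => iInf₂_le l (h.trans hl) }
  have hM (k : K) (x) : x ∈ M k ↔ ∀ l, k ≤ l → x l = 0 := by
    change x ∈ ⨅ l : K, ⨅ _ : k ≤ l, LinearMap.ker (LinearMap.proj l) ↔ _
    simp
  have hdir : IsDirectedOrder K := ⟨fun a b =>
    ⟨⟨a.1 ⊔ b.1, sup_le a.2.1 b.2.1, Submodule.FG.sup a.2.2 b.2.2⟩,
    le_sup_left (a := a.1), le_sup_right (a := a.1)⟩⟩
  have hne : Nonempty K := ⟨⟨⊥, bot_le, Submodule.fg_bot⟩⟩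
  refine ⟨K, inferInstance, hdir, hne, ∀ l, E l, inferInstance, inferInstance, M,
    injective_pi hE, fun x hx => funext fun l => ?_, fun k x hx => ?_, fun h => ?_⟩
  · exact hEt l _ (hx.of_le fun r hr => congrFun hr l)
  · obtain ⟨x, rfl⟩ := Submodule.mkQ_surjective _ x
    refine (Submodule.Quotient.mk_eq_zero _).2 ((hM _ _).2 fun l hl => ?_)
    exact hEt l _ (hx.of_le fun r hr => (hM _ _).1 ((Submodule.Quotient.mk_eq_zero _).1 hr) l hl)
  -- Each `r ∈ I` kills `e l` for all `l` containing `r`, so `r • e` lies in the member of the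
  -- system indexed by `Ideal.span {r}`. The class of `e` is thus torsion, but `e` is in no `M k`.
  · have h₁ : Submodule.mkQ (⨆ k, M k) e = 0 := by
      refine h _ (isTorsionElt_of_ideal hI fun r hr => ?_)
      refine (Submodule.Quotient.mk_eq_zero _).2 ?_
      refine Submodule.mem_iSup_of_mem ⟨Ideal.span {r}, by simpa using hr, ⟨{r}, by simp⟩⟩
        ((hM _ _).2 fun l hl => hle l r (hl (Ideal.mem_span_singleton_self r)))
    have h₂ := (Submodule.Quotient.mk_eq_zero _).1 h₁
    rw [Submodule.mem_iSup_of_directed _ M.monotone.directed_le] at h₂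
    obtain ⟨k, hk⟩ := h₂
    exact he k ((hM _ _).1 hk k le_rfl)

/-- The union of a directed system of submodules is a colimit. -/
lemma nonempty_isColimit_union {K : Type u} [Preorder K] [IsDirectedOrder K] [Nonempty K]
    (F : K ⥤ ModuleCat.{u} R) (c : Cocone F) (hi : ∀ k, Function.Injective (c.ι.app k))
    (hs : ∀ x : c.pt, ∃ k y, c.ι.app k y = x) : Nonempty (IsColimit c) := by
  refine ⟨isColimitOfReflects (forget (ModuleCat R)) (Types.FilteredColimit.isColimitOf _ _ ?_ ?_)⟩
  · intro x
    obtain ⟨k, y, hy⟩ := hs x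
    exact ⟨k, y, hy.symm⟩
  · intro k l x y h
    obtain ⟨m, hkm, hlm⟩ := exists_ge_ge k l
    refine ⟨m, homOfLE hkm, homOfLE hlm, hi m ?_⟩
    have h₁ := congr($(c.w (homOfLE hkm)) x)
    have h₂ := congr($(c.w (homOfLE hlm)) y)
    exact h₁.trans (h.trans h₂.symm)

end Modules

end
end Reconstruction

namespace Reconstruction

noncomputable section

/-! ### The torsion classes associated with a tensor localizing subcategory -/

section

variable {X : Scheme.{u}} [QuasiSeparatedSpace X] {W : X.Opens} (hW : IsAffineOpen W)

lemma exact_extend {M₁ M₂ M₃ : ModuleCat.{u} Γ(X, W)} (f : M₁ ⟶ M₂) (g : M₂ ⟶ M₃) (w : f ≫ g = 0)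
    (h : (ShortComplex.mk f g w).Exact) [Mono f] :
    (ShortComplex.mk ((extend hW).map f) ((extend hW).map g)
      (by rw [← Functor.map_comp, w, Functor.map_zero])).Exact := by
  have := (secAdj hW).rightAdjoint_preservesLimits.{0, 0}
  exact h.map_of_mono_of_preservesKernel (extend hW) ‹_› inferInstance

end

section Torsion

variable {X : Scheme.{u}} [QuasiSeparatedSpace X] [CompactSpace X] (A : TensorLocalizing X)
  {W : X.Opens} (hW : IsAffineOpen W)

/-- The modules whose associated sheaf on `W` has its direct image in `A`. -/
def torsionClass : ObjectProperty (ModuleCat.{u} Γ(X, W)) := A.carrier.inverseImage (extend hW)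

/-- The inverse image under `extend` suits subobjects, extensions and directed unions; the image
under `sec` suits quotients. That they agree is `prop_extend_sec`. -/
lemma torsionClass_iff (M : ModuleCat.{u} Γ(X, W)) :
    torsionClass A hW M ↔ A.carrier.map (sec W) M := by
  constructor
  · exact fun h => ⟨_, h, ⟨asIso ((secAdj hW).counit.app M)⟩⟩
  · rintro ⟨F, hF, ⟨e⟩⟩
    exact A.carrier.prop_of_iso ((extend hW).mapIso e) (prop_extend_sec A.isTensor hF hW)

lemma torsionClass_sec {F : Qcoh X} (hF : A.carrier F) : torsionClass A hW ((sec W).obj F) :=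
  prop_extend_sec A.isTensor hF hW

open scoped ZeroObject in
instance : (torsionClass A hW).IsSerreClass where
  exists_zero := ⟨0, isZero_zero _, A.carrier.prop_of_isZero
    ((extend hW).map_isZero (isZero_zero _))⟩
  prop_of_mono f _ h := by
    have := (secAdj hW).rightAdjoint_preservesLimits.{0, 0}
    exact A.carrier.prop_of_mono ((extend hW).map f) h
  prop_of_epi f _ h := by
    have := preservesFiniteColimits_sec hW
    rw [torsionClass_iff] at h ⊢
    exact prop_map_of_epi A.carrier (secAdj hW) h f
  prop_X₂_of_shortExact {S} hS h₁ h₃ := by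
    have := hS.mono_f
    exact A.carrier.prop_X₂_of_exact (exact_extend hW S.f S.g S.zero hS.exact) h₁ h₃

/-- A module is the directed union of its finitely generated submodules, and `extend` preserves
directed unions. -/
instance : IsTorsionClass (torsionClass A hW) where
  of_fg M _ _ h := by
    let J := {N : Submodule Γ(X, W) M // N.FG}
    have : IsDirectedOrder J := ⟨fun a b => ⟨⟨a.1 ⊔ b.1, Submodule.FG.sup a.2 b.2⟩,
      le_sup_left (a := a.1), le_sup_right (a := a.1)⟩⟩
    have : Nonempty J := ⟨⟨⊥, Submodule.fg_bot⟩⟩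
    let F : J ⥤ ModuleCat.{u} Γ(X, W) :=
      { obj := fun N => ModuleCat.of _ N.1
        map := fun f => ModuleCat.ofHom (Submodule.inclusion f.le) }
    let c : Cocone F :=
      { pt := ModuleCat.of _ M
        ι := { app := fun N => ModuleCat.ofHom N.1.subtype } }
    have hi (N : J) : Function.Injective (c.ι.app N) := Subtype.val_injective
    obtain ⟨hc⟩ := nonempty_isColimit_union F c hi fun x =>
      ⟨⟨Submodule.span _ {x}, Submodule.fg_span_singleton x⟩,
        ⟨x, Submodule.mem_span_singleton_self x⟩, rfl⟩
    obtain ⟨hc'⟩ := nonempty_isColimit_extend hW hc fun N => (ModuleCat.mono_iff_injective _).2 (hi N)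
    have := IsLocalizingSubcategory.closedUnderFilteredColimits (S := A.carrier) J
    exact A.carrier.prop_of_isColimit hc' fun N => h N.1 N.2

lemma eq_zero_of_isTorsionFree {P : Type u} [AddCommGroup P] [Module Γ(X, W) P]
    (hP : IsTorsionFree (torsionClass A hW) P) (F : Qcoh X) (hF : A.carrier F)
    (g : F ⟶ (extend hW).obj (ModuleCat.of _ P)) : g = 0 := by
  refine ((secAdj hW).homEquiv _ _).symm.injective ?_
  exact (hP.eq_zero (torsionClass_sec A hW hF) _).trans
    (hP.eq_zero (torsionClass_sec A hW hF) _).symm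

/-- `extend` is left exact and, being right adjoint to an exact functor, preserves injectives, so
`closedObjects_of_injective` applies to the kernel of `P ⟶ P ⧸ N`. -/
lemma closedObjects_extend {P : Type u} [AddCommGroup P] [Module Γ(X, W) P]
    (hi : Injective (ModuleCat.of Γ(X, W) P)) (hP : IsTorsionFree (torsionClass A hW) P)
    (N : Submodule Γ(X, W) P) (hN : IsTorsionFree (torsionClass A hW) (P ⧸ N)) :
    closedObjects A.carrier ((extend hW).obj (ModuleCat.of _ N)) := by
  have hm : Mono (ModuleCat.ofHom N.subtype) :=
    (ModuleCat.mono_iff_injective _).2 Subtype.val_injective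
  have w : ModuleCat.ofHom N.subtype ≫ ModuleCat.ofHom N.mkQ = 0 := by
    ext x
    simp
  have hex : (ShortComplex.mk (ModuleCat.ofHom N.subtype) (ModuleCat.ofHom N.mkQ) w).Exact := by
    rw [ShortComplex.moduleCat_exact_iff]
    intro x hx
    exact ⟨⟨x, (Submodule.Quotient.mk_eq_zero N).1 hx⟩, rfl⟩
  have := (secAdj hW).rightAdjoint_preservesLimits.{0, 0}
  have := Injective.injective_of_adjoint (secAdj hW) (ModuleCat.of Γ(X, W) P)
  have hex' := exact_extend hW _ _ w hex
  have hm' : Mono ((extend hW).map (ModuleCat.ofHom N.subtype)) := inferInstance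
  exact closedObjects_of_injective A.carrier _ _ _ hex'.fIsKernel
    (eq_zero_of_isTorsionFree A hW hP) (eq_zero_of_isTorsionFree A hW hN)

/-- For a subcategory of finite type, torsion-freeness of quotients passes to directed unions. -/
lemma isTorsionFree_iSup {K : Type u} [PartialOrder K] [IsDirectedOrder K] [Nonempty K] {P : Type u}
    [AddCommGroup P] [Module Γ(X, W) P] (M : K →o Submodule Γ(X, W) P)
    (hi : Injective (ModuleCat.of Γ(X, W) P)) (hP : IsTorsionFree (torsionClass A hW) P)
    (hM : ∀ k, IsTorsionFree (torsionClass A hW) (P ⧸ M k)) :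
    IsTorsionFree (torsionClass A hW) (P ⧸ ⨆ k, M k) := by
  let M₁ := ⨆ k, M k
  have hM₁ (k : K) : M k ≤ M₁ := le_iSup M k
  let t := torsionSubmodule (torsionClass A hW) (P ⧸ M₁)
  -- `M₂` is the saturation of the union `M₁`; the goal is `M₂ = M₁`.
  let M₂ : Submodule Γ(X, W) P := t.comap M₁.mkQ
  have h₁₂ : M₁ ≤ M₂ := fun x hx => by
    change M₁.mkQ x ∈ t
    rw [show M₁.mkQ x = 0 from (Submodule.Quotient.mk_eq_zero M₁).2 hx]
    exact t.zero_mem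
  have hM₂ : IsTorsionFree (torsionClass A hW) (P ⧸ M₂) := by
    intro x hx
    obtain ⟨x, rfl⟩ := Submodule.mkQ_surjective _ x
    refine (Submodule.Quotient.mk_eq_zero M₂).2 (IsTorsionElt.of_smul hx fun r hr => ?_)
    rw [← map_smul]
    exact (Submodule.Quotient.mk_eq_zero M₂).1 hr
  let N : K ⥤ ModuleCat.{u} Γ(X, W) :=
    { obj := fun k => ModuleCat.of _ (M k)
      map := fun f => ModuleCat.ofHom (Submodule.inclusion (M.monotone f.le)) }
  let c : Cocone N :=
    { pt := ModuleCat.of _ M₁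
      ι := { app := fun k => ModuleCat.ofHom (Submodule.inclusion (hM₁ k)) } }
  have hinj (k : K) : Function.Injective (c.ι.app k) := Submodule.inclusion_injective (hM₁ k)
  obtain ⟨hc⟩ := nonempty_isColimit_union N c hinj fun x => by
    obtain ⟨k, hk⟩ := (Submodule.mem_iSup_of_directed _ M.monotone.directed_le).1 x.2
    exact ⟨k, ⟨x.1, hk⟩, rfl⟩
  obtain ⟨hc'⟩ := nonempty_isColimit_extend hW hc
    fun k => (ModuleCat.mono_iff_injective _).2 (hinj k)
  let i₁₂ : ModuleCat.of Γ(X, W) M₁ ⟶ ModuleCat.of Γ(X, W) M₂ :=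
    ModuleCat.ofHom (Submodule.inclusion h₁₂)
  have hm₁₂ : Mono i₁₂ := (ModuleCat.mono_iff_injective _).2 (Submodule.inclusion_injective h₁₂)
  let p : ModuleCat.of Γ(X, W) M₂ ⟶ ModuleCat.of Γ(X, W) t :=
    ModuleCat.ofHom ((M₁.mkQ.comp M₂.subtype).codRestrict t fun x => x.2)
  have w : i₁₂ ≫ p = 0 := by
    ext x
    exact (Submodule.Quotient.mk_eq_zero M₁).2 x.2
  have hex : (ShortComplex.mk i₁₂ p w).Exact := by
    rw [ShortComplex.moduleCat_exact_iff]
    intro x hx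
    exact ⟨⟨x.1, (Submodule.Quotient.mk_eq_zero M₁).1 (congrArg Subtype.val hx)⟩, rfl⟩
  have := (secAdj hW).rightAdjoint_preservesLimits.{0, 0}
  let θ := (extend hW).map i₁₂
  have hθ : A.carrier.isoModSerre θ := by
    refine ⟨A.carrier.prop_of_isZero (isZero_kernel_of_mono θ), ?_⟩
    have := (exact_extend hW i₁₂ p w hex).mono_cokernelDesc
    exact A.carrier.prop_of_mono (cokernel.desc θ ((extend hW).map p) _)
      (prop_torsionSubmodule (T := torsionClass A hW))
  let F : K ⥤ (closedObjects A.carrier).FullSubcategory :=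
    (closedObjects A.carrier).lift (N ⋙ extend hW) fun k =>
      closedObjects_extend A hW hi hP (M k) (hM k)
  have hF {i j : K} (f : i ⟶ j) : Mono (F.map f) := by
    have : Mono (N.map f) :=
      (ModuleCat.mono_iff_injective _).2 (Submodule.inclusion_injective (M.monotone f.le))
    exact (closedObjects A.carrier).ι.mono_of_mono_map
      (inferInstanceAs (Mono ((extend hW).map (N.map f))))
  let Z₂ : (closedObjects A.carrier).FullSubcategory :=
    ⟨(extend hW).obj (ModuleCat.of _ M₂), closedObjects_extend A hW hi hP M₂ hM₂⟩
  let c₂ : Cocone F :=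
    { pt := Z₂
      ι := { app := fun k => ObjectProperty.homMk ((extend hW).map (c.ι.app k) ≫ θ)
             naturality := fun k l f => by
               ext1
               change (extend hW).map (N.map f) ≫ (extend hW).map (c.ι.app l) ≫ θ = _ ≫ 𝟙 _
               rw [← Category.assoc, ← Functor.map_comp, c.w, Category.comp_id]
               rfl } }
  -- The cokernel of `θ` is torsion, so maps from `extend M₁` to closed objects extend uniquely
  -- along `θ`. This makes the saturation the colimit among closed objects.
  have hc₂ : IsColimit c₂ := by
    let d (s : Cocone F) : (extend hW).obj (ModuleCat.of _ M₁) ⟶ s.pt.obj :=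
      hc'.desc ((closedObjects A.carrier).ι.mapCocone s)
    refine
      { desc := fun s => ObjectProperty.homMk ((s.pt.property θ hθ).2 (d s)).choose
        fac := fun s k => ?_
        uniq := fun s m h => ?_ }
    · have h := ((s.pt.property θ hθ).2 (d s)).choose_spec
      ext1
      change ((extend hW).map (c.ι.app k) ≫ θ) ≫ _ = _
      rw [Category.assoc]
      exact (congrArg _ h).trans (hc'.fac ((closedObjects A.carrier).ι.mapCocone s) k)
    · have h' := ((s.pt.property θ hθ).2 (d s)).choose_spec
      ext1
      refine (s.pt.property θ hθ).1 (Eq.trans ?_ h'.symm)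
      refine hc'.hom_ext fun k => ?_
      refine Eq.trans ?_ (hc'.fac ((closedObjects A.carrier).ι.mapCocone s) k).symm
      exact (Category.assoc _ _ _).symm.trans congr(($(h k)).hom)
  -- By finite type this is also a colimit in `Qcoh X`, so every element of `M₂` comes from some `M
  -- k`.
  have := A.isOfFiniteType K F hF
  have hc₃ := isColimitOfPreserves (closedObjects A.carrier).ι hc₂
  intro x hx
  obtain ⟨x, rfl⟩ := Submodule.mkQ_surjective _ x
  let ε := (secAdj hW).counit
  obtain ⟨y, hy⟩ := (ModuleCat.epi_iff_surjective (ε.app (ModuleCat.of _ M₂))).1 inferInstance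
    (⟨x, hx⟩ : M₂)
  obtain ⟨k, z, hz⟩ := exists_rep_of_isColimit hc₃ hW y
  have e := congr($(ε.naturality (c.ι.app k ≫ i₁₂)) z)
  have e' : ((sec W).map ((extend hW).map (c.ι.app k ≫ i₁₂))) z = y := by
    rw [Functor.map_comp]
    exact hz
  have e₂ : ε.app (ModuleCat.of _ M₂) y = (c.ι.app k ≫ i₁₂) (ε.app _ z) :=
    (congrArg (ε.app (ModuleCat.of _ M₂)) e'.symm).trans e
  refine (Submodule.Quotient.mk_eq_zero M₁).2 ?_
  have e₃ : x = (c.ι.app k (ε.app _ z)).1 := congrArg Subtype.val (hy.symm.trans e₂)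
  rw [e₃]
  exact (c.ι.app k (ε.app _ z)).2

/-- The ideals whose quotient is torsion contain finitely generated ones. -/
lemma exists_fg_torsionClass {I : Ideal Γ(X, W)} (hI : torsionClass A hW (ModuleCat.of _ (_ ⧸ I))) :
    ∃ l ≤ I, l.FG ∧ torsionClass A hW (ModuleCat.of _ (_ ⧸ l)) := by
  by_contra! h
  obtain ⟨K, _, _, _, P, _, _, M, hi, hP, hM, hM'⟩ := exists_directed_of_not_fg hI h
  exact hM' (isTorsionFree_iSup A hW M hi hP hM)

end Torsion

end
end Reconstruction

namespace Reconstruction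

noncomputable section

/-! ### Tensor localizing subcategories of finite type are determined by their support -/

section Points

variable {X : Scheme.{u}} {W : X.Opens} (hW : IsAffineOpen W)

lemma fromSpec_mem_basicOpen (p : PrimeSpectrum Γ(X, W)) (f : Γ(X, W)) :
    hW.fromSpec p ∈ X.basicOpen f ↔ f ∉ p.asIdeal := by
  have h : p ∈ hW.fromSpec ⁻¹ᵁ X.basicOpen f ↔ p ∈ PrimeSpectrum.basicOpen f := by
    rw [hW.fromSpec_preimage_basicOpen]
    rfl
  exact h

lemma fromSpec_mem (p : PrimeSpectrum Γ(X, W)) : hW.fromSpec p ∈ W := by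
  have h : hW.fromSpec p ∈ hW.fromSpec.opensRange := ⟨p, rfl⟩
  rwa [hW.opensRange_fromSpec] at h

lemma exists_fromSpec_eq {P : X} (hP : P ∈ W) : ∃ p : PrimeSpectrum Γ(X, W), hW.fromSpec p = P :=
  ⟨hW.primeIdealOf ⟨P, hP⟩, hW.fromSpec_primeIdealOf ⟨P, hP⟩⟩

lemma vanishingAt_fromSpec_iff (p : PrimeSpectrum Γ(X, W)) (F : Qcoh X) :
    vanishingAt (hW.fromSpec p) F ↔
      ∀ x : Γ(F.obj, W), ¬ Ideal.torsionOf Γ(X, W) Γ(F.obj, W) x ≤ p.asIdeal := by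
  rw [vanishingAt_iff hW (fromSpec_mem hW p)]
  refine forall_congr' fun x => ?_
  rw [SetLike.not_le_iff_exists]
  refine exists_congr fun f => ?_
  rw [fromSpec_mem_basicOpen, and_comm]
  rfl

lemma vanishingAt_of_specializes {P Q : X} (h : P ⤳ Q) {F : Qcoh X} (hF : vanishingAt Q F) :
    vanishingAt P F := by
  obtain ⟨W, hW, hQ, -⟩ := Opens.isBasis_iff_nbhd.1 X.isBasis_affineOpens (Opens.mem_top Q)
  rw [vanishingAt_iff hW hQ] at hF
  rw [vanishingAt_iff hW (h.mem_open W.isOpen hQ)]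
  intro x
  obtain ⟨f, hf, hx⟩ := hF x
  exact ⟨f, h.mem_open (X.basicOpen f).isOpen hf, hx⟩

/-- The quasi-coherent sheaves whose stalks vanish outside of `V`. -/
def supportedOn (V : Set X) : ObjectProperty (Qcoh X) := fun F => ∀ P, P ∉ V → vanishingAt P F

end Points

section Support

variable {X : Scheme.{u}} [QuasiSeparatedSpace X] [CompactSpace X] (A : TensorLocalizing X)

/-- The union of the supports of the sheaves in `A`. -/
def supportOf : Set X := {P | ∃ F, A.carrier F ∧ ¬ vanishingAt P F}

/-- An ideal maximal among those with non-torsion quotient is prime. Zorn's lemma applies because an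
ideal with torsion quotient contains a finitely generated one, which cannot first appear in the
union of a chain. -/
lemma exists_prime_of_not_torsionClass {W : X.Opens} (hW : IsAffineOpen W) {I : Ideal Γ(X, W)}
    (hI : ¬ torsionClass A hW (ModuleCat.of _ (_ ⧸ I))) :
    ∃ p : PrimeSpectrum Γ(X, W), I ≤ p.asIdeal ∧
      ¬ torsionClass A hW (ModuleCat.of _ (_ ⧸ p.asIdeal)) := by
  obtain ⟨p, hIp, hm⟩ := zorn_le_nonempty₀
    {J : Ideal Γ(X, W) | ¬ torsionClass A hW (ModuleCat.of _ (_ ⧸ J))}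
    (fun c hc hc' y hy => ⟨sSup c, fun hT => by
      obtain ⟨l, hl, hfg, hTl⟩ := exists_fg_torsionClass A hW hT
      obtain ⟨J, hJ, hlJ⟩ := (CompleteLattice.isCompactElement_iff_le_of_directed_sSup_le _ _).1
        ((Submodule.fg_iff_compact l).1 hfg) c ⟨y, hy⟩ hc'.directedOn hl
      exact hc hJ (prop_quotient_of_le hlJ hTl), fun z hz => le_sSup hz⟩) I hI
  have hp : ¬ torsionClass A hW (ModuleCat.of _ (_ ⧸ p)) := hm.1
  have hlt : ∀ J, p ≤ J → ∀ a ∈ J, a ∉ p → torsionClass A hW (ModuleCat.of _ (_ ⧸ J)) :=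
    fun J hJ a ha hap => by_contra fun h => hap (hm.2 h hJ ha)
  have hprime : p.IsPrime := by
    refine ⟨fun h => hp ?_, fun {a b} hab => ?_⟩
    · rw [h]
      have : Subsingleton (Γ(X, W) ⧸ (⊤ : Ideal Γ(X, W))) := Submodule.Quotient.subsingleton_iff.2 rfl
      exact ObjectProperty.prop_of_isZero _ (ModuleCat.isZero_of_subsingleton _)
    · by_contra! hn
      -- Both `p + (a)` and the colon ideal `(p : a)`, which contains `b`, are strictly larger than
      -- `p`. Their quotients are torsion, which forces that of `p` to be torsion.
      have h₁ := hlt (p ⊔ Ideal.span {a}) le_sup_left a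
        (Ideal.mem_sup_right (Ideal.mem_span_singleton_self a)) hn.1
      have h₂ := hlt (Ideal.torsionOf Γ(X, W) (Γ(X, W) ⧸ p) (Submodule.Quotient.mk a))
        (fun s hs => by
          rw [Ideal.mem_torsionOf_iff, ← Submodule.Quotient.mk_smul, Submodule.Quotient.mk_eq_zero]
          exact p.mul_mem_right _ hs) b (by
          rw [Ideal.mem_torsionOf_iff, ← Submodule.Quotient.mk_smul, Submodule.Quotient.mk_eq_zero]
          rwa [smul_eq_mul, mul_comm]) hn.2
      have h₃ : IsTorsionElt (torsionClass A hW) (Submodule.Quotient.mk 1 : Γ(X, W) ⧸ p) := by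
        refine IsTorsionElt.of_smul h₁ fun r hr => ?_
        obtain ⟨q, hq, d, hd, rfl⟩ := Submodule.mem_sup.1 hr
        obtain ⟨c, rfl⟩ := Ideal.mem_span_singleton'.1 hd
        refine isTorsionElt_of_ideal h₂ fun s hs => ?_
        rw [Ideal.mem_torsionOf_iff, ← Submodule.Quotient.mk_smul,
          Submodule.Quotient.mk_eq_zero] at hs
        rw [← Submodule.Quotient.mk_smul, ← Submodule.Quotient.mk_smul,
          Submodule.Quotient.mk_eq_zero]
        have e : s • (q + c * a) • (1 : Γ(X, W)) = s * q + c * (s • a) := by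
          simp only [smul_eq_mul]
          ring
        rw [e]
        exact p.add_mem (p.mul_mem_left _ hq) (p.mul_mem_left _ hs)
      refine hp (prop_quotient_of_le (fun s hs => ?_) h₃)
      rw [Ideal.mem_torsionOf_iff, ← Submodule.Quotient.mk_smul, Submodule.Quotient.mk_eq_zero] at hs
      simpa using hs
  exact ⟨⟨p, hprime⟩, hIp, hp⟩

/-- A tensor localizing subcategory of finite type consists of the sheaves supported on its
support. -/
theorem carrier_eq_supportedOn : A.carrier = supportedOn (supportOf A) := by
  refine le_antisymm (fun F hF P hP => by_contra fun h => hP ⟨F, hF, h⟩) fun G hG => ?_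
  obtain ⟨ι, _, V, hV, hc⟩ := exists_finite_affine_cover (X := X) (U := ⊤) isCompact_univ
  refine prop_of_sections A.carrier V hV hc.symm fun i => (torsionClass_iff A (hV i) _).1 ?_
  refine prop_of_isTorsionElt (T := torsionClass A (hV i)) (M := Γ(G.obj, V i))
    fun x => by_contra fun hx => ?_
  -- A non-torsion section `x` of `G` gives a prime `p` in the support of `G` with non-torsion
  -- quotient. Some `F` in `A` has a section whose annihilator lies in `p`, so that quotient is
  -- torsion after all.
  obtain ⟨p, hxp, hp⟩ := exists_prime_of_not_torsionClass A (hV i) hx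
  have hGp : ¬ vanishingAt ((hV i).fromSpec p) G := fun h =>
    (vanishingAt_fromSpec_iff (hV i) p G).1 h x hxp
  obtain ⟨F, hF, hFp⟩ := by_contra fun h => hGp (hG _ h)
  rw [vanishingAt_fromSpec_iff] at hFp
  push Not at hFp
  obtain ⟨y, hy⟩ := hFp
  exact hp (prop_quotient_of_le hy
    (IsTorsionElt.of_prop (M := Γ(F.obj, V i)) (torsionClass_sec A (hV i) hF) y))

/-- The support is stable under specialization. It contains a constructible neighbourhood of each of
its points: the zero locus in `W` of a finitely generated ideal with torsion quotient. -/
lemma isThomason_supportOf : IsThomason (supportOf A) := by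
  refine isThomason_of_isOpen_constructible ?_ fun P Q h ⟨F, hF, hP⟩ =>
    ⟨F, hF, fun hQ => hP (vanishingAt_of_specializes h hQ)⟩
  refine (@isOpen_iff_forall_mem_open X (constructibleTopology X) _).2 ?_
  rintro P ⟨F, hF, hP⟩
  obtain ⟨W, (hW : IsAffineOpen W), hPW, -⟩ :=
    Opens.isBasis_iff_nbhd.1 X.isBasis_affineOpens (Opens.mem_top P)
  obtain ⟨p, rfl⟩ := exists_fromSpec_eq hW hPW
  rw [vanishingAt_fromSpec_iff] at hP
  push Not at hP
  obtain ⟨y, hy⟩ := hP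
  obtain ⟨l, hl, ⟨s, rfl⟩, hT⟩ := exists_fg_torsionClass A hW
    (IsTorsionElt.of_prop (M := Γ(F.obj, W)) (torsionClass_sec A hW hF) y)
  let U : Set X := ⋃ f ∈ s, (X.basicOpen f : Set X)
  have hU : IsOpen U := isOpen_biUnion fun f _ => (X.basicOpen f).isOpen
  have hU' : IsCompact U := s.isCompact_biUnion fun f _ => (hW.basicOpen f).isCompact
  refine ⟨(W : Set X) ∩ Uᶜ, ?_, ?_, ⟨fromSpec_mem hW p, fun hmem => ?_⟩⟩
  · rintro Q ⟨hQ, hQU⟩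
    obtain ⟨q, rfl⟩ := exists_fromSpec_eq hW hQ
    refine ⟨(extend hW).obj (ModuleCat.of _ (Γ(X, W) ⧸ Ideal.span (s : Set Γ(X, W)))), hT, ?_⟩
    rw [vanishingAt_fromSpec_iff]
    push Not
    let c := (secAdj hW).counit.app (ModuleCat.of _ (Γ(X, W) ⧸ Ideal.span (s : Set Γ(X, W))))
    obtain ⟨x, hx⟩ := (ModuleCat.epi_iff_surjective c).1 inferInstance
      (Submodule.Quotient.mk 1 : Γ(X, W) ⧸ Ideal.span (s : Set Γ(X, W)))
    refine ⟨x, fun r hr => ?_⟩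
    have h₁ : r • (Submodule.Quotient.mk 1 : Γ(X, W) ⧸ Ideal.span (s : Set Γ(X, W))) = 0 := by
      rw [← hx]
      exact (map_smul c.hom r x).symm.trans ((congrArg c hr).trans (map_zero c.hom))
    rw [← Submodule.Quotient.mk_smul, Submodule.Quotient.mk_eq_zero, smul_eq_mul, mul_one] at h₁
    refine Ideal.span_le.2 (fun f hf => ?_) h₁
    by_contra hfq
    exact hQU (Set.mem_biUnion hf ((fromSpec_mem_basicOpen hW q f).2 hfq))
  · refine @IsOpen.inter X (constructibleTopology X) _ _
      (IsCompact.isOpen_constructibleTopology_of_isOpen hW.isCompact W.isOpen)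
      (IsCompact.isOpen_constructibleTopology_of_isClosed ?_ ?_)
    · rwa [compl_compl]
    · exact hU.isClosed_compl
  · obtain ⟨f, hf, hf'⟩ := Set.mem_iUnion₂.1 hmem
    exact (fromSpec_mem_basicOpen hW p f).1 hf' (hy (hl (Submodule.subset_span hf)))

end Support

end
end Reconstruction

namespace Reconstruction

noncomputable section

/-! ### The sheaves supported on a Thomason subset -/

section Serre

open scoped TensorProduct

variable {X : Scheme.{u}}

lemma exists_affine_mem (P : X) : ∃ W : X.Opens, IsAffineOpen W ∧ P ∈ W := by
  obtain ⟨W, hW, hP, -⟩ := Opens.isBasis_iff_nbhd.1 X.isBasis_affineOpens (Opens.mem_top P)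
  exact ⟨W, hW, hP⟩

lemma vanishingAt_of_sections {P : X} {W : X.Opens} (hW : IsAffineOpen W) (hP : P ∈ W) {F : Qcoh X}
    (h : ∀ x : Γ(F.obj, W), x = 0) : vanishingAt P F :=
  (vanishingAt_iff hW hP F).2 fun x => ⟨1, by simpa using hP, by rw [h x, smul_zero]⟩

lemma ι_image_preimage_eq (U W : X.Opens) : U.ι ''ᵁ U.ι ⁻¹ᵁ W = W ⊓ U := by
  rw [U.ι.image_preimage_eq_opensRange_inf, Scheme.Opens.opensRange_ι, inf_comm]

lemma vanishingAt_tensor {P : X} {F : Qcoh X} (hF : vanishingAt P F) (G : Qcoh X) :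
    vanishingAt P ⟨tensor F.obj G.obj, isQcoh_tensor F.property G.property⟩ := by
  obtain ⟨W, hW, hP⟩ := exists_affine_mem P
  rw [vanishingAt_iff hW hP] at hF ⊢
  intro x
  obtain ⟨t, rfl⟩ := (bijective_toTensor F.property G.property hW).2 x
  suffices h : ∃ f : Γ(X, W), P ∈ X.basicOpen f ∧ f • t = 0 by
    obtain ⟨f, hf, ht⟩ := h
    exact ⟨f, hf, by rw [← map_smul, ht, map_zero]⟩
  induction t with
  | zero => exact ⟨1, by simpa using hP, smul_zero _⟩
  | add x y hx hy =>
    obtain ⟨f, hf, hfx⟩ := hx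
    obtain ⟨g, hg, hgy⟩ := hy
    refine ⟨f * g, ?_, ?_⟩
    · rw [X.basicOpen_mul]
      exact ⟨hf, hg⟩
    · rw [smul_add, mul_comm, mul_smul, hfx, mul_comm, mul_smul, hgy, smul_zero, smul_zero, add_zero]
  | tmul x y =>
    obtain ⟨f, hf, hfx⟩ := hF x
    exact ⟨f, hf, by rw [TensorProduct.smul_tmul', hfx, TensorProduct.zero_tmul]⟩

variable [QuasiSeparatedSpace X]

open scoped ZeroObject in
instance (P : X) : (vanishingAt P).IsSerreClass where
  exists_zero := by
    obtain ⟨W, hW, hP⟩ := exists_affine_mem P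
    refine ⟨0, isZero_zero _, vanishingAt_of_sections hW hP fun x => ?_⟩
    have := ModuleCat.subsingleton_of_isZero ((sec W).map_isZero (isZero_zero (Qcoh X)))
    exact Subsingleton.elim (α := (sec W).obj (0 : Qcoh X)) _ _
  prop_of_mono {F G} f _ h := by
    obtain ⟨W, hW, hP⟩ := exists_affine_mem P
    rw [vanishingAt_iff hW hP] at h ⊢
    intro x
    obtain ⟨r, hr, hx⟩ := h (f.hom.app W x)
    refine ⟨r, hr, injective_of_mono f W ?_⟩
    rw [Scheme.Modules.Hom.app_smul, hx, map_zero]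
  prop_of_epi {F G} f _ h := by
    obtain ⟨W, hW, hP⟩ := exists_affine_mem P
    rw [vanishingAt_iff hW hP] at h ⊢
    intro x
    obtain ⟨x, rfl⟩ := surjective_of_epi f hW x
    obtain ⟨r, hr, hx⟩ := h x
    exact ⟨r, hr, by rw [← Scheme.Modules.Hom.app_smul, hx, map_zero]⟩
  prop_X₂_of_shortExact {S} hS h₁ h₃ := by
    obtain ⟨W, hW, hP⟩ := exists_affine_mem P
    have := preservesFiniteColimits_sec hW
    have hex := (ShortComplex.moduleCat_exact_iff _).1 (hS.exact.map (sec W))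
    rw [vanishingAt_iff hW hP] at h₁ h₃ ⊢
    intro x
    obtain ⟨r, hr, hx⟩ := h₃ (S.g.hom.app W x)
    obtain ⟨(y : Γ(S.X₁.obj, W)), hy⟩ := hex (r • x) ((Scheme.Modules.Hom.app_smul _ _ _).trans hx)
    obtain ⟨s, hs, hy'⟩ := h₁ y
    refine ⟨s * r, ?_, ?_⟩
    · rw [X.basicOpen_mul]
      exact ⟨hs, hr⟩
    · have hy₂ : S.f.hom.app W y = r • x := hy
      rw [mul_smul, ← hy₂, ← Scheme.Modules.Hom.app_smul, hy', map_zero]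

instance (P : X) : IsLocalizingSubcategory (vanishingAt P) where
  closedUnderFilteredColimits J _ _ :=
    { colimitsOfShape_le := by
        rintro F ⟨p⟩
        obtain ⟨W, hW, hP⟩ := exists_affine_mem P
        rw [vanishingAt_iff hW hP]
        intro x
        obtain ⟨j, y, rfl⟩ := exists_rep_of_isColimit p.isColimit hW x
        obtain ⟨r, hr, hy⟩ := (vanishingAt_iff hW hP _).1 (p.prop_diag_obj j) y
        exact ⟨r, hr, by rw [← Scheme.Modules.Hom.app_smul, hy, map_zero]⟩ }

open scoped ZeroObject in
instance (V : Set X) : (supportedOn V).IsSerreClass where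
  exists_zero := ⟨0, isZero_zero _, fun P _ => (vanishingAt P).prop_zero⟩
  prop_of_mono f _ h P hP := (vanishingAt P).prop_of_mono f (h P hP)
  prop_of_epi f _ h P hP := (vanishingAt P).prop_of_epi f (h P hP)
  prop_X₂_of_shortExact hS h₁ h₃ P hP :=
    (vanishingAt P).prop_X₂_of_shortExact hS (h₁ P hP) (h₃ P hP)

instance (V : Set X) : IsLocalizingSubcategory (supportedOn V) where
  closedUnderFilteredColimits J _ _ :=
    { colimitsOfShape_le := by
        rintro F ⟨p⟩ P hP
        have := IsLocalizingSubcategory.closedUnderFilteredColimits (S := vanishingAt P) J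
        exact (vanishingAt P).prop_of_isColimit p.isColimit fun j => p.prop_diag_obj j P hP }

end Serre

section Closed

variable {X : Scheme.{u}} [QuasiSeparatedSpace X]

/-! ### Direct images of restrictions to a quasi-compact open subset -/

section Opens

variable (U : X.Opens) [CompactSpace U]

/-- The direct image of the restriction to a quasi-compact open subset. -/
def restrPush : Qcoh X ⥤ Qcoh X := restr U.ι ⋙ push U.ι

/-- The map from a sheaf to the direct image of its restriction. -/
def toRestrPush (F : Qcoh X) : F ⟶ (restrPush U).obj F := (restrAdj U.ι).unit.app F

variable {U}

lemma toRestrPush_eq_zero_iff (F : Qcoh X) (W : X.Opens) (x : Γ(F.obj, W)) :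
    (toRestrPush U F).hom.app W x = 0 ↔ res F.obj (inf_le_left : W ⊓ U ≤ W) x = 0 := by
  have h₁ : W ⊓ U ≤ U.ι ''ᵁ U.ι ⁻¹ᵁ W := (ι_image_preimage_eq U W).ge
  have h₂ : U.ι ''ᵁ U.ι ⁻¹ᵁ W ≤ W ⊓ U := (ι_image_preimage_eq U W).le
  refine (map_eq_zero_iff (res F.obj h₁) (res_injective_of_eq h₁ h₂)).symm.trans
    (iff_of_eq (congrArg (· = 0) ?_))
  exact res_res (U.ι.image_preimage_le W) h₁ x

lemma bijective_toRestrPush_iff (F : Qcoh X) (W : X.Opens) :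
    Function.Bijective ((toRestrPush U F).hom.app W) ↔
      Function.Bijective (res F.obj (inf_le_left : W ⊓ U ≤ W)) := by
  have h₁ : W ⊓ U ≤ U.ι ''ᵁ U.ι ⁻¹ᵁ W := (ι_image_preimage_eq U W).ge
  have h₂ : U.ι ''ᵁ U.ι ⁻¹ᵁ W ≤ W ⊓ U := (ι_image_preimage_eq U W).le
  have hb : Function.Bijective (res F.obj h₁) :=
    ⟨res_injective_of_eq h₁ h₂, fun x => ⟨res F.obj h₂ x, by rw [res_res, res_self]⟩⟩
  refine (hb.of_comp_iff' fun x : Γ(F.obj, W) => res F.obj (U.ι.image_preimage_le W) x).symm.trans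
    (iff_of_eq (congrArg _ (funext fun x => ?_)))
  exact res_res (U.ι.image_preimage_le W) h₁ x

lemma bijective_toRestrPush (F : Qcoh X) {W : X.Opens} (h : W ≤ U) :
    Function.Bijective ((toRestrPush U F).hom.app W) := by
  rw [bijective_toRestrPush_iff]
  have h' : W ≤ W ⊓ U := le_inf le_rfl h
  exact ⟨res_injective_of_eq _ h', fun x => ⟨res F.obj h' x, by rw [res_res, res_self]⟩⟩

lemma bijective_res_restrPush (F : Qcoh X) {W O : X.Opens} (hO : O ≤ W) (hW : W ⊓ U ≤ O) :
    Function.Bijective (res ((restrPush U).obj F).obj hO) := by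
  have h₁ : U.ι ''ᵁ U.ι ⁻¹ᵁ O ≤ U.ι ''ᵁ U.ι ⁻¹ᵁ W := U.ι.image_mono (U.ι.preimage_mono hO)
  have h₂ : U.ι ''ᵁ U.ι ⁻¹ᵁ W ≤ U.ι ''ᵁ U.ι ⁻¹ᵁ O := by
    rw [ι_image_preimage_eq, ι_image_preimage_eq]
    exact le_inf hW inf_le_right
  refine ⟨res_injective_of_eq (F := F.obj) h₁ h₂, fun x => ⟨res F.obj h₂ x, ?_⟩⟩
  exact (res_res (F := F.obj) h₂ h₁ x).trans (res_self _ _)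

/-- The map is an isomorphism over `U`, so its kernel and cokernel are supported on `Uᶜ`. -/
lemma isoModSerre_toRestrPush {V : Set X} (hUV : (U : Set X)ᶜ ⊆ V) (F : Qcoh X) :
    (supportedOn V).isoModSerre (toRestrPush U F) := by
  have key (P : X) (hP : P ∉ V) : ∃ W : X.Opens, IsAffineOpen W ∧ P ∈ W ∧
      Function.Bijective ((toRestrPush U F).hom.app W) := by
    have hPU : P ∈ U := by_contra fun h => hP (hUV h)
    obtain ⟨W, hW, hPW, hWU⟩ := Opens.isBasis_iff_nbhd.1 X.isBasis_affineOpens hPU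
    exact ⟨W, hW, hPW, bijective_toRestrPush F hWU⟩
  refine ⟨fun P hP => ?_, fun P hP => ?_⟩
  · obtain ⟨W, hW, hPW, hb⟩ := key P hP
    refine vanishingAt_of_sections hW hPW fun x => injective_of_mono (kernel.ι _) W ?_
    rw [map_zero]
    refine hb.1 ?_
    rw [map_zero]
    exact congr(($(kernel.condition (toRestrPush U F))).hom.app W x)
  · obtain ⟨W, hW, hPW, hb⟩ := key P hP
    refine vanishingAt_of_sections hW hPW fun x => ?_
    obtain ⟨x, rfl⟩ := surjective_of_epi (cokernel.π (toRestrPush U F)) hW x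
    obtain ⟨x, rfl⟩ := hb.2 x
    exact congr(($(cokernel.condition (toRestrPush U F))).hom.app W x)

/-- Closedness of `Z` gives a retraction. It is also a section: a section of the direct image over
`W` is determined on `W ⊓ U`, where the map is already bijective. -/
lemma isIso_toRestrPush {V : Set X} (hUV : (U : Set X)ᶜ ⊆ V) {Z : Qcoh X}
    (hZ : closedObjects (supportedOn V) Z) : IsIso (toRestrPush U Z) := by
  obtain ⟨r, hr⟩ : ∃ r, toRestrPush U Z ≫ r = 𝟙 Z :=
    (hZ (toRestrPush U Z) (isoModSerre_toRestrPush hUV Z)).2 (𝟙 Z)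
  refine ⟨r, hr, hom_ext_of_affine fun W _ x => (bijective_res_restrPush Z inf_le_left le_rfl).1 ?_⟩
  obtain ⟨y, hy⟩ := (bijective_toRestrPush Z (inf_le_right : W ⊓ U ≤ U)).2
    (res ((restrPush U).obj Z).obj (inf_le_left : W ⊓ U ≤ W) x)
  have h : r.hom.app (W ⊓ U) ((toRestrPush U Z).hom.app (W ⊓ U) y) = y :=
    congr(($hr).hom.app (W ⊓ U) y)
  have h₂ := app_res' (r ≫ toRestrPush U Z).hom (inf_le_left : W ⊓ U ≤ W) x
  rw [← hy] at h₂
  exact h₂.symm.trans ((congrArg ((toRestrPush U Z).hom.app (W ⊓ U)) h).trans hy)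

end Opens

end Closed

end
end Reconstruction

namespace Reconstruction

open scoped Topology

noncomputable section

/-! ### Closed objects for the sheaves supported on a Thomason subset -/

section ClosedOn

variable {X : Scheme.{u}}

lemma exists_app_eq {S : ShortComplex (Qcoh X)} (hS : S.Exact) [hm : Mono S.f] (U : X.Opens)
    (x : Γ(S.X₂.obj, U)) (hx : S.g.hom.app U x = 0) : ∃ y, S.f.hom.app U y = x := by
  have h := hS.map_of_mono_of_preservesKernel (sec U) hm inferInstance
  exact (ShortComplex.moduleCat_exact_iff _).1 h x hx

lemma exists_kernel_app_eq {F G : Qcoh X} (g : F ⟶ G) (U : X.Opens) (x : Γ(F.obj, U))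
    (hx : g.hom.app U x = 0) : ∃ y, (kernel.ι g).hom.app U y = x :=
  exists_app_eq (ShortComplex.exact_kernel g) (hm := inferInstanceAs (Mono (kernel.ι g))) U x hx

lemma exists_app_eq_of_mono {F G : Qcoh X} (g : F ⟶ G) [Mono g] (U : X.Opens) (x : Γ(G.obj, U))
    (hx : (cokernel.π g).hom.app U x = 0) : ∃ y, g.hom.app U y = x :=
  exists_app_eq (ShortComplex.exact_cokernel g) (hm := inferInstanceAs (Mono g)) U x hx

section Biprod

variable {J C : Type*} [Category* J] [Category* C] [Preadditive C] [HasBinaryBiproducts C]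

/-- The direct sum of a constant functor and a functor. -/
def constBiprod (Z : C) (T : J ⥤ C) : J ⥤ C where
  obj j := Z ⊞ T.obj j
  map f := biprod.map (𝟙 Z) (T.map f)

/-- The cocone on `constBiprod Z T` given by a cocone on `T` and a morphism from `Z`. -/
def constBiprodCocone {Z : C} {T : J ⥤ C} (c : Cocone T) (i : Z ⟶ c.pt) :
    Cocone (constBiprod Z T) where
  pt := c.pt
  ι := { app j := biprod.desc i (c.ι.app j)
         naturality j k f := by
          change biprod.map (𝟙 Z) (T.map f) ≫ biprod.desc i (c.ι.app k) =
            biprod.desc i (c.ι.app j) ≫ 𝟙 c.pt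
          apply biprod.hom_ext' <;> simp }

/-- The projections to `Z` form a cocone on `constBiprod Z T`; the map it induces is the retraction.
-/
lemma exists_retraction_of_isColimit [Nonempty J] {Z : C} {T : J ⥤ C} {c : Cocone T}
    {i : Z ⟶ c.pt} (hc : IsColimit (constBiprodCocone c i)) : ∃ r, i ≫ r = 𝟙 Z := by
  let c' : Cocone (constBiprod Z T) :=
    { pt := Z
      ι := { app j := biprod.fst
             naturality j k f := by
              change biprod.map (𝟙 Z) (T.map f) ≫ biprod.fst = biprod.fst ≫ 𝟙 Z
              simp } }
  let r : c.pt ⟶ Z := hc.desc c'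
  refine ⟨r, ?_⟩
  have h : biprod.desc i (c.ι.app (Classical.arbitrary J)) ≫ r = biprod.fst := hc.fac c' _
  rw [← biprod.inl_desc_assoc i (c.ι.app (Classical.arbitrary J)), h, biprod.inl_fst]

end Biprod

lemma injective_biprod_desc {Z T E : Qcoh X} (i : Z ⟶ E) (k : T ⟶ E) (W : X.Opens)
    (h : ∀ z t, i.hom.app W z + k.hom.app W t = 0 → z = 0 ∧ t = 0) :
    Function.Injective ((biprod.desc i k).hom.app W) := by
  refine (injective_iff_map_eq_zero _).2 fun w hw => ?_
  have hw' : (biprod.inl : _ ⟶ Z ⊞ T).hom.app W ((biprod.fst : Z ⊞ T ⟶ _).hom.app W w) +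
      (biprod.inr : _ ⟶ Z ⊞ T).hom.app W ((biprod.snd : Z ⊞ T ⟶ _).hom.app W w) = w :=
    congr(($(biprod.total (X := Z) (Y := T))).hom.app W w)
  have hd : biprod.desc i k = biprod.fst ≫ i + biprod.snd ≫ k := biprod.desc_eq
  rw [hd] at hw
  obtain ⟨h₁, h₂⟩ := h ((biprod.fst : Z ⊞ T ⟶ _).hom.app W w)
    ((biprod.snd : Z ⊞ T ⟶ _).hom.app W w) hw
  rw [← hw', h₁, h₂, map_zero, map_zero, add_zero]

lemma exists_biprod_desc_eq {Z T E : Qcoh X} (i : Z ⟶ E) (k : T ⟶ E) (W : X.Opens)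
    (z : Γ(Z.obj, W)) (t : Γ(T.obj, W)) :
    ∃ w, (biprod.desc i k).hom.app W w = i.hom.app W z + k.hom.app W t := by
  refine ⟨(biprod.inl : _ ⟶ Z ⊞ T).hom.app W z + (biprod.inr : _ ⟶ Z ⊞ T).hom.app W t, ?_⟩
  rw [map_add]
  exact congr($(congr(($(biprod.inl_desc i k)).hom.app W z)) +
    $(congr(($(biprod.inr_desc i k)).hom.app W t)))

/-- The sections of `Z` do not change when they are restricted to a quasi-compact open subset that
contains the complement of `V`. -/
def IsClosedOn (V : Set X) (Z : Qcoh X) : Prop :=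
  ∀ U : X.Opens, IsCompact (U : Set X) → (U : Set X)ᶜ ⊆ V → ∀ W, IsAffineOpen W →
    Function.Bijective (res Z.obj (inf_le_left : W ⊓ U ≤ W))

variable [QuasiSeparatedSpace X]

lemma isClosedOn_of_closedObjects {V : Set X} {Z : Qcoh X}
    (hZ : closedObjects (supportedOn V) Z) : IsClosedOn V Z := by
  intro U hU hUV W _
  have : CompactSpace U := isCompact_iff_compactSpace.1 hU
  have := isIso_toRestrPush hUV hZ
  rw [← bijective_toRestrPush_iff]
  exact ConcreteCategory.bijective_of_isIso ((sec W).map (toRestrPush U Z))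

variable [CompactSpace X]

/-- A section of a sheaf supported on a Thomason subset is supported on a closed subset with
quasi-compact complement. -/
lemma exists_res_eq_zero {V : Set X} (hV : IsThomason V) {K : Qcoh X} (hK : supportedOn V K)
    {W : X.Opens} (hW : IsAffineOpen W) (x : Γ(K.obj, W)) :
    ∃ U : X.Opens, IsCompact (U : Set X) ∧ (U : Set X)ᶜ ⊆ V ∧
      res K.obj (inf_le_left : W ⊓ U ≤ W) x = 0 := by
  -- `W₀` is the part of `W` where `x` vanishes locally. Its complement in `W` is closed in the
  -- constructible topology and contained in `V`, so a quasi-compact `U` can be found disjoint from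
  -- it.
  let ι := {f : Γ(X, W) // f • x = 0}
  let W₀ : X.Opens := ⨆ i : ι, X.basicOpen i.1
  have hC : IsClosed[constructibleTopology X] ((W : Set X) \ W₀) := by
    rw [← @isOpen_compl_iff _ _ (constructibleTopology X), Set.compl_sdiff]
    have h₁ := isOpen_constructible_of_isOpen W₀.isOpen
    have h₂ := (IsThomason.of_compl W.isOpen hW.isCompact).isOpen_constructible
    let := constructibleTopology X
    exact h₁.union h₂
  obtain ⟨U, h₁, h₂, h₃, h₄⟩ := hV.exists_isCompact_disjoint hC fun P hP => by
    by_contra hPV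
    obtain ⟨f, hf, hx⟩ := (vanishingAt_iff hW hP.1 K).1 (hK P hPV) x
    exact hP.2 (Opens.mem_iSup.2 ⟨⟨f, hx⟩, hf⟩)
  refine ⟨⟨U, h₁⟩, h₂, h₄, ?_⟩
  refine sections_eq_zero (fun i : ι => X.basicOpen i.1 ⊓ ⟨U, h₁⟩)
    (fun i => inf_le_inf_right _ (X.basicOpen_le i.1)) (fun P hP => ?_) fun i => ?_
  · have hP₀ : P ∈ W₀ := by_contra fun h => Set.disjoint_left.1 h₃ hP.2 ⟨hP.1, h⟩
    obtain ⟨i, hi⟩ := Opens.mem_iSup.1 hP₀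
    exact Opens.mem_iSup.2 ⟨i, hi, hP.2⟩
  · rw [res_res, ← res_res (X.basicOpen_le i.1) inf_le_left, res_basicOpen_eq_zero i.2, map_zero]

/-- A section of `K` dies on some `W ⊓ U`, hence so does its image in `Z`, where restriction to `W ⊓
U` is injective. -/
lemma IsClosedOn.eq_zero {V : Set X} (hV : IsThomason V) {Z : Qcoh X} (hZ : IsClosedOn V Z)
    {K : Qcoh X} (hK : supportedOn V K) (g : K ⟶ Z) : g = 0 := by
  refine hom_ext_of_affine fun W hW x => ?_
  obtain ⟨U, h₁, h₂, hx⟩ := exists_res_eq_zero hV hK hW x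
  refine (hZ U h₁ h₂ W hW).1 ?_
  rw [← app_res', hx, map_zero]
  exact (map_zero (res Z.obj (inf_le_left : W ⊓ U ≤ W))).symm

/-- The quasi-compact open subsets that contain the complement of `V`, ordered by reverse
inclusion. -/
abbrev CompactNhds (V : Set X) : Type u :=
  {U : X.Opens // IsCompact (U : Set X) ∧ (U : Set X)ᶜ ⊆ V}ᵒᵈ

/-- The open subset underlying an element of `CompactNhds V`. -/
abbrev CompactNhds.opens {V : Set X} (U : CompactNhds V) : X.Opens := (OrderDual.ofDual U).1

instance {V : Set X} (U : CompactNhds V) : CompactSpace U.opens :=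
  isCompact_iff_compactSpace.1 (OrderDual.ofDual U).2.1

instance (V : Set X) : Nonempty (CompactNhds V) :=
  ⟨OrderDual.toDual ⟨⊤, by simpa using isCompact_univ, by simp⟩⟩

instance (V : Set X) : IsDirectedOrder (CompactNhds V) where
  directed U U' := by
    obtain ⟨U, h₁, h₂⟩ := U
    obtain ⟨U', h₁', h₂'⟩ := U'
    refine ⟨OrderDual.toDual ⟨U ⊓ U', ?_, ?_⟩, ?_, ?_⟩
    · exact QuasiSeparatedSpace.inter_isCompact _ _ U.isOpen h₁ U'.isOpen h₁'
    · rw [Opens.coe_inf, Set.compl_inter]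
      exact Set.union_subset h₂ h₂'
    · exact (inf_le_left : U ⊓ U' ≤ U)
    · exact (inf_le_right : U ⊓ U' ≤ U')

/-- The subsheaves of the sections of `E` that vanish on some element of `CompactNhds V`. -/
def supportFunctor (V : Set X) (E : Qcoh X) : CompactNhds V ⥤ Qcoh X where
  obj U := kernel (toRestrPush U.opens E)
  map {U U'} h := kernel.lift _ (kernel.ι _) (hom_ext_of_affine fun W _ x => by
    have hx : (toRestrPush U.opens E).hom.app W
        ((kernel.ι (toRestrPush U.opens E)).hom.app W x) = 0 :=
      congr(($(kernel.condition (toRestrPush U.opens E))).hom.app W x)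
    have hU : U'.opens ≤ U.opens := h.le
    refine (toRestrPush_eq_zero_iff (U := U'.opens) E W
      ((kernel.ι (toRestrPush U.opens E)).hom.app W x)).2 ?_
    rw [toRestrPush_eq_zero_iff] at hx
    rw [← res_res (inf_le_left : W ⊓ U.opens ≤ W) (inf_le_inf_left W hU), hx, map_zero])
  map_id U := by rw [← cancel_mono (kernel.ι _)]; simp
  map_comp f g := by rw [← cancel_mono (kernel.ι _)]; simp

/-- The inclusions of the values of `supportFunctor V E` into `E`. -/
def supportCocone (V : Set X) (E : Qcoh X) : Cocone (supportFunctor V E) where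
  pt := E
  ι := { app U := kernel.ι (toRestrPush U.opens E)
         naturality _ _ _ := (kernel.lift_ι _ _ _).trans (Category.comp_id _).symm }

/-- `E` is the directed union of the direct sums of `Z` and the subsheaf of sections vanishing on
`U`. The sums are direct since sections of `Z` restrict injectively. They exhaust `E`: a section `x`
of `E` comes from `Z` over some `W ⊓ U`, and subtracting its extension to `W` leaves a section
vanishing on `U`. -/
lemma IsClosedOn.exists_retraction {V : Set X} (hV : IsThomason V) {Z : Qcoh X}
    (hZ : IsClosedOn V Z) {E : Qcoh X} (i : Z ⟶ E) [Mono i]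
    (hC : supportedOn V (cokernel i)) : ∃ r : E ⟶ Z, i ≫ r = 𝟙 Z := by
  suffices h : Nonempty (IsColimit (constBiprodCocone (supportCocone V E) i)) from
    exists_retraction_of_isColimit h.some
  refine nonempty_isColimit_of_mono _ (fun U => ?_) (fun W hW (x : Γ(E.obj, W)) => ?_)
  · refine mono_of_injective _ fun W hW =>
      injective_biprod_desc i (kernel.ι (toRestrPush U.opens E)) W fun z t hzt => ?_
    have hT : res E.obj (inf_le_left : W ⊓ U.opens ≤ W)
        ((kernel.ι (toRestrPush U.opens E)).hom.app W t) = 0 := by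
      rw [← toRestrPush_eq_zero_iff]
      exact congr(($(kernel.condition (toRestrPush U.opens E))).hom.app W t)
    have hz : z = 0 := by
      refine (injective_iff_map_eq_zero _).1
        (hZ U.opens (OrderDual.ofDual U).2.1 (OrderDual.ofDual U).2.2 W hW).1 z ?_
      refine injective_of_mono i _ ?_
      have := congrArg (res E.obj (inf_le_left : W ⊓ U.opens ≤ W)) hzt
      rw [map_add, hT, add_zero, map_zero] at this
      rw [app_res', this, map_zero]
    refine ⟨hz, injective_of_mono (kernel.ι (toRestrPush U.opens E)) W ?_⟩
    rwa [hz, map_zero, zero_add, ← map_zero ((kernel.ι (toRestrPush U.opens E)).hom.app W).hom]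
      at hzt
  · obtain ⟨U, h₁, h₂, hx⟩ := exists_res_eq_zero hV hC hW ((cokernel.π i).hom.app W x)
    let U' : CompactNhds V := OrderDual.toDual ⟨U, h₁, h₂⟩
    rw [← app_res'] at hx
    obtain ⟨z₀, hz₀⟩ := exists_app_eq_of_mono i _ _ hx
    obtain ⟨z, rfl⟩ := (hZ U h₁ h₂ W hW).2 z₀
    have ht : (toRestrPush U'.opens E).hom.app W (x - i.hom.app W z) = 0 := by
      rw [toRestrPush_eq_zero_iff, map_sub, sub_eq_zero, ← app_res']
      exact hz₀.symm
    obtain ⟨t, ht⟩ := exists_kernel_app_eq _ W _ ht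
    obtain ⟨w, hw⟩ := exists_biprod_desc_eq i (kernel.ι (toRestrPush U'.opens E)) W z t
    refine ⟨U', w, hw.trans ?_⟩
    rw [ht, add_sub_cancel]

/-- An object whose extensions by objects of `S` are split is `S`-closed. -/
lemma closedObjects_of_retraction {C : Type*} [Category* C] [Abelian C] (S : ObjectProperty C)
    [S.IsSerreClass] {Z : C} (h₀ : ∀ {K : C} (_ : S K) (g : K ⟶ Z), g = 0)
    (h : ∀ {E : C} (i : Z ⟶ E) [Mono i], S (cokernel i) → ∃ r : E ⟶ Z, i ≫ r = 𝟙 Z) :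
    closedObjects S Z := by
  rintro A B f ⟨hk, hc⟩
  refine ⟨fun a b hab => ?_, fun g => ?_⟩
  · have hd : f ≫ (a - b) = 0 := by rw [Preadditive.comp_sub, sub_eq_zero]; exact hab
    rw [← sub_eq_zero, ← cokernel.π_desc f (a - b) hd, h₀ hc (cokernel.desc f (a - b) hd), comp_zero]
  · have hg : kernel.ι f ≫ g = 0 := h₀ hk _
    -- To extend `g` along `f`, push the inclusion of the coimage into `B` out along `g'` and
    -- retract the resulting extension of `Z`.
    let m := Abelian.factorThruCoimage f
    let g' : Abelian.coimage f ⟶ Z := cokernel.desc _ g hg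
    have hf : Abelian.coimage.π f ≫ m = f := Abelian.coimage.fac f
    have hw : f ≫ pushout.inl m g' ≫ cokernel.π (pushout.inr m g') = 0 := by
      refine (congrArg (· ≫ _) hf).symm.trans ?_
      rw [Category.assoc, pushout.condition_assoc, cokernel.condition, comp_zero, comp_zero]
    -- The cokernel of the pushed-out map is a quotient of `cokernel f`, so it is in `S`.
    have he : Epi (cokernel.desc f _ hw) := by
      refine Preadditive.epi_of_cancel_zero _ fun a ha => ?_
      rw [← cancel_epi (cokernel.π (pushout.inr m g')), comp_zero]
      apply pushout.hom_ext
      · rw [comp_zero, ← Category.assoc, ← cokernel.π_desc f _ hw, Category.assoc, ha, comp_zero]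
      · rw [cokernel.condition_assoc, zero_comp, comp_zero]
    obtain ⟨r, hr⟩ := h (pushout.inr m g') (S.prop_of_epi (cokernel.desc f _ hw) hc)
    refine ⟨pushout.inl m g' ≫ r, ?_⟩
    refine (congrArg (· ≫ _) hf).symm.trans ?_
    rw [Category.assoc, pushout.condition_assoc, hr, Category.comp_id]
    exact cokernel.π_desc _ _ _

/-- This replaces an orthogonality condition by one on sections over quasi-compact open subsets,
which is visibly compatible with directed unions. -/
lemma closedObjects_iff {V : Set X} (hV : IsThomason V) {Z : Qcoh X} :
    closedObjects (supportedOn V) Z ↔ IsClosedOn V Z :=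
  ⟨isClosedOn_of_closedObjects, fun hZ => closedObjects_of_retraction _
    (fun hK g => hZ.eq_zero hV hK g) fun i _ hC => hZ.exists_retraction hV i hC⟩

/-- Closed objects are closed under kernels. Finite type speaks of monomorphisms among closed
objects, whereas the arguments on sections need monomorphisms in `C`. -/
lemma mono_hom_of_mono {C : Type*} [Category* C] [Abelian C] (S : ObjectProperty C)
    [S.IsSerreClass] {Y Z : (closedObjects S).FullSubcategory} (f : Y ⟶ Z) [Mono f] :
    Mono f.hom := by
  have hk : closedObjects S (kernel f.hom) := by
    have : (closedObjects S).IsClosedUnderLimitsOfShape WalkingParallelPair :=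
      inferInstanceAs (S.isoModSerre.isLocal.IsClosedUnderLimitsOfShape _)
    refine (closedObjects S).prop_of_isLimit (limit.isLimit (parallelPair f.hom 0)) ?_
    rintro (_ | _)
    · exact Y.property
    · exact Z.property
  let K : (closedObjects S).FullSubcategory := ⟨kernel f.hom, hk⟩
  let k : K ⟶ Y := ObjectProperty.homMk (kernel.ι f.hom)
  have h : k ≫ f = (ObjectProperty.homMk 0 : K ⟶ Y) ≫ f :=
    ObjectProperty.hom_ext _ ((kernel.condition f.hom).trans zero_comp.symm)
  exact Preadditive.mono_of_kernel_zero congr(($((cancel_mono f).1 h)).hom)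

/-- By `closedObjects_iff` the colimit taken in `Qcoh X` is again closed, so it is also the colimit
among closed objects. -/
lemma isOfFiniteType_supportedOn {V : Set X} (hV : IsThomason V) :
    IsOfFiniteType (supportedOn V) := by
  intro J _ _ _ F hF
  have hF' {i j : J} (f : i ⟶ j) : Mono ((F ⋙ (closedObjects (supportedOn V)).ι).map f) := by
    have := hF f
    exact mono_hom_of_mono _ (F.map f)
  let c := colimit.cocone (F ⋙ (closedObjects (supportedOn V)).ι)
  let hc : IsColimit c := colimit.isColimit _
  have hm := mono_ι_of_isColimit hc hF'
  have hZ (j : J) : IsClosedOn V (F.obj j).obj := isClosedOn_of_closedObjects (F.obj j).property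
  have hpt : closedObjects (supportedOn V) c.pt := by
    rw [closedObjects_iff hV]
    intro U h₁ h₂ W hW
    refine ⟨(injective_iff_map_eq_zero _).2 fun x hx => ?_, fun x => ?_⟩
    · obtain ⟨j, y, rfl⟩ := exists_rep_of_isColimit hc hW x
      rw [← app_res'] at hx
      have hy := injective_of_mono (c.ι.app j) _ (hx.trans (map_zero _).symm)
      rw [(injective_iff_map_eq_zero _).1 (hZ j U h₁ h₂ W hW).1 y hy, map_zero]
    · obtain ⟨j, y, rfl⟩ := exists_rep_of_isCompact hc hm (U := W ⊓ U)
        (QuasiSeparatedSpace.inter_isCompact _ _ W.isOpen hW.isCompact U.isOpen h₁) x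
      obtain ⟨y, rfl⟩ := (hZ j U h₁ h₂ W hW).2 y
      exact ⟨(c.ι.app j).hom.app W y, (app_res' _ _ _).symm⟩
  let c' : Cocone F :=
    { pt := ⟨c.pt, hpt⟩
      ι := { app j := ObjectProperty.homMk (c.ι.app j)
             naturality i j f := ObjectProperty.hom_ext _ (c.ι.naturality f) } }
  have hc' : IsColimit ((closedObjects (supportedOn V)).ι.mapCocone c') := hc
  exact preservesColimit_of_preserves_colimit_cocone
    (isColimitOfReflects (closedObjects (supportedOn V)).ι hc') hc'

/-- The tensor localizing subcategory of finite type of the sheaves supported on a Thomason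
subset. -/
def tensorLocalizingOf (V : Set X) (hV : IsThomason V) : TensorLocalizing X where
  carrier := supportedOn V
  isOfFiniteType := isOfFiniteType_supportedOn hV
  isTensor F G hF := ⟨isQcoh_tensor F.property G.property,
    fun P hP => vanishingAt_tensor (hF P hP) G⟩

lemma tensorLocalizingOf_carrier {V : Set X} (hV : IsThomason V) :
    (tensorLocalizingOf V hV).carrier = supportedOn V := rfl

end ClosedOn

end
end Reconstruction

namespace Reconstruction

open scoped Topology

noncomputable section

/-! ### The points of the spectrum -/

section Spectrum

variable {X : Scheme.{u}}

lemma supportedOn_mono {V V' : Set X} (h : V ⊆ V') : supportedOn V ≤ supportedOn V' :=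
  fun _ hF P hP => hF P fun hP' => hP (h hP')

lemma supportedOn_inter (V V' : Set X) : supportedOn (V ∩ V') = supportedOn V ⊓ supportedOn V' := by
  ext F
  refine ⟨fun h => ⟨fun P hP => h P fun hP' => hP hP'.1, fun P hP => h P fun hP' => hP hP'.2⟩,
    fun h P hP => ?_⟩
  by_cases hP' : P ∈ V
  · exact h.2 P fun h => hP ⟨hP', h⟩
  · exact h.1 P hP'

lemma vanishingAt_eq_supportedOn (P : X) : vanishingAt P = supportedOn (nonGeneralizations P) := by
  ext F
  exact ⟨fun h Q hQ => vanishingAt_of_specializes (not_not.1 hQ) h,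
    fun h => h P fun h' => h' specializes_rfl⟩

lemma IsThomason.subset_nonGeneralizations_iff {V : Set X} (hV : IsThomason V) {P : X} :
    V ⊆ nonGeneralizations P ↔ P ∉ V :=
  ⟨fun h hP => h hP specializes_rfl, fun h _ hQ hQP => h (hV.stableUnderSpecialization hQP hQ)⟩

lemma TensorLocalizing.ext_carrier {A B : TensorLocalizing X} (h : A.carrier = B.carrier) :
    A = B := by
  cases A
  cases B
  subst h
  rfl

lemma LatticeSpec.ext_carrier {p q : LatticeSpec X} (h : p.subcategory = q.subcategory) :
    p = q := by
  have := TensorLocalizing.ext_carrier h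
  cases p
  cases q
  subst this
  rfl

/-- The direct image of the structure sheaf of the spectrum of the residue field at a point is
supported on the closure of this point. -/
lemma exists_supported_on_closure (Q : X) :
    ∃ F : Qcoh X, (∀ P, ¬ Q ⤳ P → vanishingAt P F) ∧ ¬ vanishingAt Q F := by
  let g := X.fromSpecResidueField Q
  refine ⟨(push g).obj (structureModule _), fun P hP => ?_, fun h => ?_⟩
  · rw [specializes_iff_forall_open] at hP
    push Not at hP
    obtain ⟨s, hs, hPs, hQs⟩ := hP
    obtain ⟨W, hW, hPW, hWs⟩ := Opens.isBasis_iff_nbhd.1 X.isBasis_affineOpens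
      (show P ∈ (⟨s, hs⟩ : X.Opens) from hPs)
    refine vanishingAt_of_sections hW hPW fun (x : Γ(Spec (X.residueField Q), g ⁻¹ᵁ W)) => ?_
    have he : g ⁻¹ᵁ W = ⊥ := by
      ext y
      simp only [Opens.coe_bot, Set.mem_empty_iff_false, iff_false]
      intro hy
      have hy' : g y ∈ W := hy
      rw [X.fromSpecResidueField_apply] at hy'
      exact hQs (hWs hy')
    have : Subsingleton Γ(Spec (X.residueField Q), g ⁻¹ᵁ W) := by
      rw [he]
      infer_instance
    exact this.elim x 0
  · obtain ⟨W, hW, hQ⟩ := exists_affine_mem Q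
    obtain ⟨f, hf, hf'⟩ := (vanishingAt_iff hW hQ _).1 h (1 : Γ(Spec (X.residueField Q), g ⁻¹ᵁ W))
    have h₀ : g.app W f = 0 := (mul_one _).symm.trans hf'
    have h₁ : g ⁻¹ᵁ X.basicOpen f = ⊥ := by
      rw [Scheme.preimage_basicOpen, h₀, Scheme.basicOpen_zero]
    have h₂ : (default : Spec (X.residueField Q)) ∈ g ⁻¹ᵁ X.basicOpen f := by
      have : g default ∈ X.basicOpen f := by rwa [X.fromSpecResidueField_apply]
      exact this
    rw [h₁] at h₂
    exact h₂

/-- A Thomason subset is recovered from its sheaves: for `Q ∈ V` it contains the closure of `Q`, on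
which a sheaf with non-zero stalk at `Q` is supported. -/
lemma supportedOn_le_iff {V V' : Set X} (hV : IsThomason V) :
    supportedOn V ≤ supportedOn V' ↔ V ⊆ V' := by
  refine ⟨fun h Q hQ => ?_, supportedOn_mono⟩
  obtain ⟨F, h₁, h₂⟩ := exists_supported_on_closure Q
  by_contra hQ'
  exact h₂ (h F (fun P hP => h₁ P fun hQP => hP (hV.stableUnderSpecialization hQP hQ)) Q hQ')

variable [QuasiSeparatedSpace X] [CompactSpace X]

/-- The prime element of the sheaves whose stalk at `P` vanishes. -/
def pointPrime (P : X) : LatticeSpec X where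
  toTensorLocalizing := tensorLocalizingOf _ (isThomason_nonGeneralizations P)
  ne_top h := by
    obtain ⟨F, -, hF⟩ := exists_supported_on_closure P
    rw [tensorLocalizingOf_carrier, ← vanishingAt_eq_supportedOn] at h
    exact hF (h ▸ trivial)
  prime A B h := by
    have hA := isThomason_supportOf A
    have hB := isThomason_supportOf B
    -- In terms of supports, primality says that a point outside an intersection is outside one of
    -- the two sets.
    rw [carrier_eq_supportedOn A, carrier_eq_supportedOn B, ← supportedOn_inter,
      tensorLocalizingOf_carrier, supportedOn_le_iff (hA.inter hB),
      (hA.inter hB).subset_nonGeneralizations_iff] at h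
    rw [carrier_eq_supportedOn A, carrier_eq_supportedOn B, tensorLocalizingOf_carrier,
      supportedOn_le_iff hA, supportedOn_le_iff hB, hA.subset_nonGeneralizations_iff,
      hB.subset_nonGeneralizations_iff]
    exact not_and_or.1 h

lemma subcategory_pointPrime (P : X) : (pointPrime P).subcategory = vanishingAt P :=
  (vanishingAt_eq_supportedOn P).symm

lemma pointPrime_mem_basicOpen (A : TensorLocalizing X) (P : X) :
    pointPrime P ∈ LatticeSpec.basicOpen A ↔ P ∈ supportOf A := by
  have hA := isThomason_supportOf A
  change ¬ A.carrier ≤ (pointPrime P).subcategory ↔ _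
  rw [subcategory_pointPrime, vanishingAt_eq_supportedOn, carrier_eq_supportedOn A,
    supportedOn_le_iff hA, hA.subset_nonGeneralizations_iff, not_not]

lemma supportOf_tensorLocalizingOf {V : Set X} (hV : IsThomason V) :
    supportOf (tensorLocalizingOf V hV) = V := by
  have h := carrier_eq_supportedOn (tensorLocalizingOf V hV)
  rw [tensorLocalizingOf_carrier] at h
  exact Set.Subset.antisymm ((supportedOn_le_iff (isThomason_supportOf _)).1 h.ge)
    ((supportedOn_le_iff hV).1 h.le)

/-- Injectivity holds because `X` is a T₀ space; surjectivity is the description of the prime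
Thomason subsets. -/
lemma bijective_pointPrime : Function.Bijective (pointPrime : X → LatticeSpec X) := by
  refine ⟨fun P Q h => ?_, fun p => ?_⟩
  · have h' := congrArg LatticeSpec.subcategory h
    rw [subcategory_pointPrime, subcategory_pointPrime, vanishingAt_eq_supportedOn,
      vanishingAt_eq_supportedOn] at h'
    have h₁ := (supportedOn_le_iff (isThomason_nonGeneralizations P)).1 h'.le
    have h₂ := (supportedOn_le_iff (isThomason_nonGeneralizations Q)).1 h'.ge
    exact (Specializes.antisymm (not_not.1 fun hn => h₂ hn specializes_rfl)
      (not_not.1 fun hn => h₁ hn specializes_rfl)).eq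
  · have hp := carrier_eq_supportedOn p.toTensorLocalizing
    obtain ⟨P, hP⟩ := (isThomason_supportOf p.toTensorLocalizing).exists_eq_nonGeneralizations
      (fun hu => p.ne_top (by
        rw [hp, hu]
        ext F
        exact ⟨fun _ => trivial, fun _ P hP => (hP trivial).elim⟩))
      (fun A B hA hB h => by
        have h' := p.prime (tensorLocalizingOf A hA) (tensorLocalizingOf B hB)
        rw [hp, tensorLocalizingOf_carrier, tensorLocalizingOf_carrier, ← supportedOn_inter,
          supportedOn_le_iff hA, supportedOn_le_iff hB, supportedOn_le_iff (hA.inter hB)] at h'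
        exact h' h)
    refine ⟨P, LatticeSpec.ext_carrier ?_⟩
    rw [subcategory_pointPrime, vanishingAt_eq_supportedOn, ← hP]
    exact hp.symm

/-- The points of `X` are the prime elements of the lattice. -/
def pointEquiv : X ≃ LatticeSpec X := Equiv.ofBijective _ bijective_pointPrime

lemma preimage_basicOpen (A : TensorLocalizing X) :
    pointEquiv ⁻¹' LatticeSpec.basicOpen A = supportOf A :=
  Set.ext fun P => pointPrime_mem_basicOpen A P

lemma basicOpen_tensorLocalizingOf {D : Set (LatticeSpec X)} (h : IsThomason (pointEquiv ⁻¹' D)) :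
    LatticeSpec.basicOpen (tensorLocalizingOf _ h) = D := by
  refine pointEquiv.surjective.preimage_injective ?_
  rw [preimage_basicOpen, supportOf_tensorLocalizingOf]

/-- The sets `D(A)` correspond to the Thomason subsets, which already form a topology, so generating
a topology from them adds nothing. -/
lemma isOpen_iff_isThomason (D : Set (LatticeSpec X)) :
    IsOpen D ↔ IsThomason (pointEquiv ⁻¹' D) := by
  refine ⟨fun h => ?_, fun h => ?_⟩
  · induction h with
    | basic D hD =>
      obtain ⟨A, rfl⟩ := hD
      rw [preimage_basicOpen]
      exact isThomason_supportOf A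
    | univ => exact .univ
    | inter D D' _ _ h h' => exact h.inter h'
    | sUnion 𝒟 _ h =>
      rw [Set.preimage_sUnion, ← Set.sUnion_image]
      refine .sUnion ?_
      rintro _ ⟨D, hD, rfl⟩
      exact h D hD
  · rw [← basicOpen_tensorLocalizingOf h]
    exact .basic _ ⟨_, rfl⟩

lemma isOpen_iff_eq_basicOpen (D : Set (LatticeSpec X)) :
    IsOpen D ↔ ∃ A : TensorLocalizing X, D = LatticeSpec.basicOpen A := by
  refine ⟨fun h => ⟨_, (basicOpen_tensorLocalizingOf ((isOpen_iff_isThomason D).1 h)).symm⟩, ?_⟩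
  rintro ⟨A, rfl⟩
  exact .basic _ ⟨A, rfl⟩

/-- One direction is `IsThomason.isCompact_compl`; the other is compactness of the constructible
topology, through `exists_finite_subcover_of_isThomason`. -/
lemma isOpen_isCompact_iff (K : Set (LatticeSpec X)) :
    IsOpen K ∧ IsCompact K ↔ IsOpen (pointEquiv ⁻¹' K)ᶜ ∧ IsCompact (pointEquiv ⁻¹' K)ᶜ := by
  refine ⟨fun ⟨h₁, h₂⟩ => ?_, fun ⟨h₁, h₂⟩ => ?_⟩
  · rw [isOpen_iff_isThomason] at h₁
    rw [isOpen_compl_iff]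
    refine h₁.isCompact_compl fun 𝒵 h𝒵 hK => ?_
    obtain ⟨t, ht, htf, hKt⟩ := h₂.elim_finite_subcover_image (b := 𝒵)
      (c := fun Z => pointEquiv '' Z) (fun Z hZ => by
        rw [isOpen_iff_isThomason, Equiv.preimage_image]
        exact h𝒵 Z hZ) (fun p hp => by
        obtain ⟨P, rfl⟩ := pointEquiv.surjective p
        obtain ⟨Z, hZ, hPZ⟩ := hK hp
        exact Set.mem_biUnion hZ ⟨P, hPZ, rfl⟩)
    refine ⟨t, ht, htf, fun P hP => ?_⟩
    obtain ⟨Z, hZ, Q, hQ, hQP⟩ := Set.mem_iUnion₂.1 (hKt hP)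
    exact ⟨Z, hZ, pointEquiv.injective hQP ▸ hQ⟩
  · have hT := IsThomason.of_compl h₁ h₂
    rw [compl_compl] at hT
    refine ⟨(isOpen_iff_isThomason K).2 hT, isCompact_of_finite_subcover fun {ι} D hD hK => ?_⟩
    obtain ⟨t, ht⟩ := exists_finite_subcover_of_isThomason h₁ h₂ (fun i => pointEquiv ⁻¹' D i)
      (fun i => (isOpen_iff_isThomason _).1 (hD i)) (by
        rw [compl_compl, ← Set.preimage_iUnion]
        exact Set.preimage_mono hK)
    refine ⟨t, fun p hp => ?_⟩
    obtain ⟨P, rfl⟩ := pointEquiv.surjective p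
    rw [compl_compl] at ht
    simpa using ht hp

/-- The basic open subsets of the dual correspond to the quasi-compact open subsets of `X`, which
form a basis. -/
lemma isOpen_hochsterDual_iff (U : Set (LatticeSpec X)) :
    IsOpen[hochsterDual (LatticeSpec X)] U ↔ IsOpen (pointEquiv ⁻¹' U) := by
  refine ⟨?_, fun h => ?_⟩
  · rintro ⟨𝒦, h𝒦, rfl⟩
    rw [Set.preimage_iUnion₂]
    exact isOpen_biUnion fun K hK => ((isOpen_isCompact_iff K).1 (h𝒦 K hK)).1
  · refine ⟨{K | (IsOpen K ∧ IsCompact K) ∧ Kᶜ ⊆ U}, fun K hK => hK.1, Set.Subset.antisymm ?_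
      (Set.iUnion₂_subset fun K hK => hK.2)⟩
    intro p hp
    obtain ⟨P, rfl⟩ := pointEquiv.surjective p
    obtain ⟨V, ⟨h₁, h₂⟩, hPV, hVU⟩ :=
      (PrespectralSpace.isTopologicalBasis (X := X)).exists_subset_of_mem_open
        (show P ∈ pointEquiv ⁻¹' U from hp) h
    have hV : (pointEquiv ⁻¹' (pointEquiv '' V)ᶜ)ᶜ = V := by
      rw [Set.preimage_compl, compl_compl, Equiv.preimage_image]
    refine Set.mem_biUnion (x := (pointEquiv '' V)ᶜ) ⟨(isOpen_isCompact_iff _).2 ?_, ?_⟩ ?_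
    · rw [hV]
      exact ⟨h₁, h₂⟩
    · rw [compl_compl, Set.image_subset_iff]
      exact hVU
    · rw [compl_compl]
      exact ⟨P, hPV, rfl⟩

/-- The homeomorphism between `X` and `Spec(Qcoh X)`. -/
def pointHomeomorph (X : Scheme.{u}) [QuasiSeparatedSpace X] [CompactSpace X] :
    X ≃ₜ SpecQcoh X where
  toEquiv := (pointEquiv : X ≃ LatticeSpec X)
  continuous_toFun := continuous_def.2 fun U hU => (isOpen_hochsterDual_iff U).1 hU
  continuous_invFun := continuous_def.2 fun U hU => by
    refine (isOpen_hochsterDual_iff (pointEquiv.symm ⁻¹' U)).2 ?_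
    rwa [← Set.preimage_comp, pointEquiv.symm_comp_self, Set.preimage_id]

end Spectrum

end
end Reconstruction

namespace Reconstruction

noncomputable section

/-! ### Endomorphisms of the structure sheaf in the quotient categories -/

section Endomorphisms

variable {X : Scheme.{u}}

lemma sections_eq_zero_of_vanishingAt {F : Qcoh X} {W : X.Opens}
    (hW : IsAffineOpen W) (h : ∀ P ∈ W, vanishingAt P F) (x : Γ(F.obj, W)) : x = 0 := by
  refine sections_eq_zero (fun i : {f : Γ(X, W) // f • x = 0} => X.basicOpen i.1)
    (fun i => X.basicOpen_le i.1) (fun P hP => ?_) fun i => res_basicOpen_eq_zero i.2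
  obtain ⟨f, hf, hx⟩ := (vanishingAt_iff hW hP F).1 (h P hP) x
  exact Opens.mem_iSup.2 ⟨⟨f, hx⟩, hf⟩

/-- Morphisms of the quotient category are left fractions; the denominator is kept on the left-hand
side to avoid inverses. -/
lemma exists_fraction {U : Opens (SpecQcoh X)}
    (φ : End ((toQuotient (supportedAway U)).obj (structureModule X))) :
    ∃ (F : Qcoh X) (s a : structureModule X ⟶ F), (supportedAway U).isoModSerre s ∧
      φ ≫ (toQuotient (supportedAway U)).map s = (toQuotient (supportedAway U)).map a := by
  obtain ⟨ψ, hψ⟩ := Localization.exists_leftFraction (toQuotient (supportedAway U))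
    (supportedAway U).isoModSerre φ
  refine ⟨ψ.Y', ψ.s, ψ.f, ψ.hs, ?_⟩
  rw [hψ]
  exact ψ.map_comp_map_s _ _

lemma onSections_res {F : Qcoh X} (a : structureModule X ⟶ F) {O O' : X.Opens} (h : O' ≤ O)
    (r : Γ(X, O)) : onSections a O' (resO h r) = res F.obj h (onSections a O r) :=
  app_res' a.hom h r

/-- The morphism from the structure sheaf defined by a global section. -/
lemma exists_hom_of_section {F : Qcoh X} (y : Γ(F.obj, ⊤)) :
    ∃ a : structureModule X ⟶ F, ∀ O : X.Opens, onSections a O 1 = res F.obj le_top y := by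
  let σ : SheafOfModules.sections (R := X.ringCatSheaf) F.obj :=
    PresheafOfModules.sectionsMk (fun O => res F.obj (le_top : O.unop ≤ ⊤) y)
      fun O O' f => res_res (F := F.obj) le_top f.unop.le y
  refine ⟨ObjectProperty.homMk ((SheafOfModules.unitHomEquiv F.obj).symm σ), fun O => ?_⟩
  have h := congrArg (fun t => t.val (op O)) ((SheafOfModules.unitHomEquiv F.obj).apply_symm_apply σ)
  exact h

/-- The unit section of the structure sheaf. -/
def oneSec (O : X.Opens) : Γ((structureModule X).obj, O) := (1 : Γ(X, O))

variable [QuasiSeparatedSpace X] [CompactSpace X]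

/-- The open subset of `X` that corresponds to an open subset of `Spec(Qcoh X)`. -/
abbrev opensOf (U : Opens (SpecQcoh X)) : X.Opens := Opens.comap (pointHomeomorph X) U

lemma supportedAway_iff_vanishingAt (U : Opens (SpecQcoh X)) (F : Qcoh X) :
    supportedAway U F ↔ ∀ P ∈ opensOf U, vanishingAt P F := by
  rw [supportedAway_iff]
  refine ⟨fun h P hP => ?_, fun h p hp => ?_⟩
  · rw [← subcategory_pointPrime]
    exact h (pointPrime P) hP
  · obtain ⟨P, rfl⟩ := bijective_pointPrime.surjective p
    rw [subcategory_pointPrime]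
    exact h P hp

/-- The kernel and cokernel have no non-zero sections over affine open subsets of `O`; exactness
there and gluing give the general case. Hence taking sections over `U` factors through the quotient
category. -/
lemma bijective_of_isoModSerre {U : Opens (SpecQcoh X)} {F G : Qcoh X} {s : F ⟶ G}
    (hs : (supportedAway U).isoModSerre s) {O : X.Opens} (hO : O ≤ opensOf U) :
    Function.Bijective (s.hom.app O) := by
  have hk := (supportedAway_iff_vanishingAt U _).1 hs.1
  have hc := (supportedAway_iff_vanishingAt U _).1 hs.2
  have hinj {O : X.Opens} (hO : O ≤ opensOf U) : Function.Injective (s.hom.app O) := by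
    refine (injective_iff_map_eq_zero _).2 fun x hx => ?_
    obtain ⟨y, rfl⟩ := exists_kernel_app_eq s O x hx
    have hy : y = 0 := sections_eq_zero (fun W : {W : X.affineOpens // W.1 ≤ O} => W.1.1)
      (fun W => W.2) (affine_cover_of_le O) fun W =>
        sections_eq_zero_of_vanishingAt W.1.2 (fun P hP => hk P (hO (W.2 hP))) _
    rw [hy, map_zero]
  have hsurj {W : X.Opens} (hW : IsAffineOpen W) (hWO : W ≤ opensOf U) :
      Function.Surjective (s.hom.app W) := by
    intro x
    have := preservesFiniteColimits_sec hW
    have hex := (ShortComplex.moduleCat_exact_iff _).1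
      ((ShortComplex.exact_cokernel s).map (sec W))
    exact hex x (sections_eq_zero_of_vanishingAt hW (fun P hP => hc P (hWO hP))
      ((cokernel.π s).hom.app W x))
  refine ⟨hinj hO, fun x => ?_⟩
  choose y hy using fun W : {W : X.affineOpens // W.1 ≤ O} =>
    hsurj W.1.2 (W.2.trans hO) (res G.obj W.2 x)
  obtain ⟨z, hz⟩ := sections_glue (F := F.obj)
    (fun W : {W : X.affineOpens // W.1 ≤ O} => W.1.1) (fun W => W.2) (affine_cover_of_le O) y
    fun W W' => hinj (inf_le_left.trans (W.2.trans hO)) (by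
      rw [app_res', app_res', hy, hy, res_res, res_res])
  refine ⟨z, sections_ext (fun W : {W : X.affineOpens // W.1 ≤ O} => W.1.1) (fun W => W.2)
    (affine_cover_of_le O) fun W => ?_⟩
  rw [← app_res', hz, hy]

lemma isInvertedBy_sec (U : Opens (SpecQcoh X)) :
    (supportedAway U).isoModSerre.IsInvertedBy (sec (opensOf U)) := by
  intro F G s hs
  rw [ConcreteCategory.isIso_iff_bijective]
  exact bijective_of_isoModSerre hs le_rfl

/-- The functor of sections over `U`, as a functor on the quotient category. -/
def quotientSec (U : Opens (SpecQcoh X)) :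
    QuotientCategory (supportedAway U) ⥤ ModuleCat.{u} Γ(X, opensOf U) :=
  Localization.Construction.lift (sec (opensOf U)) (isInvertedBy_sec U)

lemma toQuotient_comp_quotientSec (U : Opens (SpecQcoh X)) :
    toQuotient (supportedAway U) ⋙ quotientSec U = sec (opensOf U) :=
  Localization.Construction.fac _ _

instance (U : Opens (SpecQcoh X)) : (quotientSec U).Additive := by
  rw [Localization.functor_additive_iff (toQuotient (supportedAway U))
    (supportedAway U).isoModSerre, toQuotient_comp_quotientSec]
  infer_instance

/-- The action of a morphism of the quotient category on sections over `U`. -/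
def quotientApp {U : Opens (SpecQcoh X)} {F G : Qcoh X}
    (φ : (toQuotient (supportedAway U)).obj F ⟶ (toQuotient (supportedAway U)).obj G) :
    Γ(F.obj, opensOf U) →ₗ[Γ(X, opensOf U)] Γ(G.obj, opensOf U) :=
  ((quotientSec U).map φ).hom

lemma quotientApp_map {U : Opens (SpecQcoh X)} {F G : Qcoh X} (s : F ⟶ G)
    (x : Γ(F.obj, opensOf U)) :
    quotientApp ((toQuotient (supportedAway U)).map s) x = s.hom.app _ x := by
  have h := Functor.congr_hom (toQuotient_comp_quotientSec U) s
  exact congr(($(h.trans ((Category.id_comp _).trans (Category.comp_id _)))).hom x)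

lemma quotientApp_comp {U : Opens (SpecQcoh X)} {F G H : Qcoh X}
    (φ : (toQuotient (supportedAway U)).obj F ⟶ (toQuotient (supportedAway U)).obj G)
    (ψ : (toQuotient (supportedAway U)).obj G ⟶ (toQuotient (supportedAway U)).obj H)
    (x : Γ(F.obj, opensOf U)) : quotientApp (φ ≫ ψ) x = quotientApp ψ (quotientApp φ x) :=
  congr(($((quotientSec U).map_comp φ ψ)).hom x)

/-- The function on `U` defined by an endomorphism of the structure sheaf. -/
def endToSections (U : Opens (SpecQcoh X)) :
    End ((toQuotient (supportedAway U)).obj (structureModule X)) →+* Γ(X, opensOf U) where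
  toFun φ := quotientApp φ (oneSec _)
  map_one' := congr(($((quotientSec U).map_id
    ((toQuotient (supportedAway U)).obj (structureModule X)))).hom (oneSec (opensOf U)))
  map_zero' := congr(($((quotientSec U).map_zero
    ((toQuotient (supportedAway U)).obj (structureModule X))
    ((toQuotient (supportedAway U)).obj (structureModule X)))).hom (oneSec (opensOf U)))
  map_add' φ ψ := congr(($((quotientSec U).map_add (f := φ) (g := ψ))).hom (oneSec (opensOf U)))
  map_mul' φ ψ := by
    let b : Γ(X, opensOf U) := quotientApp ψ (oneSec _)
    let c : Γ(X, opensOf U) := quotientApp φ (oneSec _)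
    -- The product `φ * ψ` is `ψ ≫ φ`, and linearity gives `φ (ψ 1) = ψ 1 * φ 1`.
    have h := (quotientApp φ).map_smul b (oneSec _)
    refine (quotientApp_comp ψ φ _).trans ?_
    have hb : b • oneSec _ = b := mul_one b
    exact ((congrArg (quotientApp φ) hb).symm.trans h).trans (mul_comm b c)

/-- When `s` is inverted in the quotient, it is injective on sections, so this formula determines
`endToSections` from any fraction. -/
lemma app_endToSections {U : Opens (SpecQcoh X)}
    {φ : End ((toQuotient (supportedAway U)).obj (structureModule X))} {F : Qcoh X}
    {s a : structureModule X ⟶ F}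
    (h : φ ≫ (toQuotient (supportedAway U)).map s = (toQuotient (supportedAway U)).map a) :
    onSections s _ (endToSections U φ) = onSections a _ 1 := by
  have h' := (quotientApp_comp φ _ _).symm.trans (congr(quotientApp $h (oneSec (opensOf U))))
  exact (quotientApp_map s _).symm.trans (h'.trans (quotientApp_map a _))

lemma endToSections_quotientEndMap {U V : Opens (SpecQcoh X)} (h : V ≤ U)
    (φ : End ((toQuotient (supportedAway U)).obj (structureModule X))) :
    endToSections V (quotientEndMap (structureModule X) (supportedAway_anti h) φ) =
      resO (show opensOf V ≤ opensOf U from fun _ hx => h hx) (endToSections U φ) := by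
  obtain ⟨F, s, a, hs, hφ⟩ := exists_fraction φ
  have hVU : opensOf V ≤ opensOf U := fun _ hx => h hx
  refine (bijective_of_isoModSerre hs hVU).1 ?_
  have e₁ : quotientEndMap (structureModule X) (supportedAway_anti h) φ ≫
      (toQuotient (supportedAway V)).map s = (toQuotient (supportedAway V)).map a := by
    have hm {F G : Qcoh X} (t : F ⟶ G) : (quotientFunctor (supportedAway_anti h)).map
        ((toQuotient (supportedAway U)).map t) = (toQuotient (supportedAway V)).map t :=
      (Functor.congr_hom (toQuotient_comp (supportedAway_anti h)) t).trans
        ((Category.id_comp _).trans (Category.comp_id _))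
    have := congrArg (quotientFunctor (supportedAway_anti h)).map hφ
    rw [Functor.map_comp] at this
    exact (congrArg (_ ≫ ·) (hm s)).symm.trans (this.trans (hm a))
  refine (app_endToSections e₁).trans (Eq.trans ?_ (onSections_res s hVU _).symm)
  rw [app_endToSections hφ, ← onSections_res, map_one]

/-- A morphism from the structure sheaf is determined by the image of 1, so here the image of `a`
has no stalks on `U`. -/
lemma toQuotient_map_eq_zero {U : Opens (SpecQcoh X)} {F : Qcoh X} {a : structureModule X ⟶ F}
    (h : onSections a (opensOf U) 1 = 0) : (toQuotient (supportedAway U)).map a = 0 := by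
  rw [ObjectProperty.SerreClassLocalization.map_eq_zero_iff (L := toQuotient (supportedAway U))
      (P := supportedAway U),
    supportedAway_iff_vanishingAt]
  intro P hP
  obtain ⟨W, hW, hPW, hWU⟩ := Opens.isBasis_iff_nbhd.1 X.isBasis_affineOpens hP
  refine vanishingAt_of_sections hW hPW fun x => ?_
  obtain ⟨x, rfl⟩ := surjective_of_epi (Abelian.factorThruImage a) hW x
  refine injective_of_mono (Abelian.image.ι a) W ?_
  have h₁ : onSections a W 1 = 0 := by
    rw [← map_one (resO hWU), onSections_res, h, map_zero]
  let r : Γ(X, W) := x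
  have h₂ : a.hom.app W x = 0 := by
    have h₃ := Scheme.Modules.Hom.app_smul a.hom r (1 : Γ(X, W))
    have h₄ : r • (1 : Γ(X, W)) = r := mul_one r
    exact ((congrArg (a.hom.app W) h₄).symm.trans h₃).trans
      ((congrArg (r • ·) h₁).trans (smul_zero r))
  rw [map_zero]
  exact (congr(($(Abelian.image.fac a)).hom.app W x)).trans h₂

lemma injective_endToSections (U : Opens (SpecQcoh X)) :
    Function.Injective (endToSections U) := by
  refine (injective_iff_map_eq_zero _).2 fun φ hφ => ?_
  obtain ⟨F, s, a, hs, h⟩ := exists_fraction φ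
  have ha : onSections a (opensOf U) 1 = 0 := by
    rw [← app_endToSections h, hφ]
    exact map_zero (s.hom.app (opensOf U)).hom
  have := Localization.inverts (toQuotient (supportedAway U)) (supportedAway U).isoModSerre s hs
  rw [toQuotient_map_eq_zero ha] at h
  exact (cancel_mono ((toQuotient (supportedAway U)).map s)).1 (h.trans zero_comp.symm)

/-- Quasi-compactness makes the direct image of the restricted structure sheaf quasi-coherent. A
function `r` on `U` is a global section of it, hence a morphism `a`, and the endomorphism is `a`
followed by the inverse of the canonical map `s`. -/
lemma surjective_endToSections {U : Opens (SpecQcoh X)} (hU : IsCompact (opensOf U : Set X)) :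
    Function.Surjective (endToSections U) := by
  intro r
  have : CompactSpace (opensOf U) := isCompact_iff_compactSpace.1 hU
  let s := toRestrPush (opensOf U) (structureModule X)
  have hs : (supportedAway U).isoModSerre s := by
    have h := isoModSerre_toRestrPush (V := (opensOf U : Set X)ᶜ) subset_rfl (structureModule X)
    exact ⟨(supportedAway_iff_vanishingAt U _).2 fun P hP => h.1 P (not_not.2 hP),
      (supportedAway_iff_vanishingAt U _).2 fun P hP => h.2 P (not_not.2 hP)⟩
  obtain ⟨y, hy⟩ := (bijective_res_restrPush (structureModule X) (le_top : opensOf U ≤ ⊤)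
    inf_le_right).2 (onSections s _ r)
  obtain ⟨a, ha⟩ := exists_hom_of_section y
  have := Localization.inverts (toQuotient (supportedAway U)) (supportedAway U).isoModSerre s hs
  refine ⟨(toQuotient (supportedAway U)).map a ≫ inv ((toQuotient (supportedAway U)).map s),
    (bijective_of_isoModSerre hs le_rfl).1 ?_⟩
  refine (app_endToSections (s := s) (a := a) ?_).trans ((ha _).trans hy)
  rw [Category.assoc, IsIso.inv_hom_id, Category.comp_id]

end Endomorphisms

end
end Reconstruction

namespace Reconstruction

noncomputable section

/-! ### The structure sheaf of the spectrum -/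

section StructureSheaf

variable (X : Scheme.{u}) [QuasiSeparatedSpace X] [CompactSpace X]

/-- The structure sheaf of `X`, as a presheaf on `Spec(Qcoh X)`. -/
def functionPresheaf : TopCat.Presheaf RingCat.{u + 1} (SpecQcoh X) where
  -- The lift matches the universe of the endomorphism rings of the quotient categories.
  obj U := RingCat.of (ULift.{u + 1} Γ(X, opensOf U.unop))
  map {U V} i := RingCat.ofHom ((ULift.ringEquiv.symm.toRingHom.comp
    (resO (show opensOf V.unop ≤ opensOf U.unop from fun _ hx => i.unop.le hx))).comp
      ULift.ringEquiv.toRingHom)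
  map_id U := by
    ext x
    exact resO_self _ _
  map_comp i j := by
    ext x
    exact (resO_resO _ _ _).symm

lemma isSheaf_functionPresheaf : (functionPresheaf X).IsSheaf := by
  rw [TopCat.Presheaf.isSheaf_iff_isSheafUniqueGluing]
  intro ι U sf hsf
  have hle (i : ι) : opensOf (U i) ≤ opensOf (iSup U) := fun _ hx => (le_iSup U i) hx
  have hcov : opensOf (iSup U) ≤ ⨆ i, opensOf (U i) := fun P hP => by
    obtain ⟨i, hi⟩ := Opens.mem_iSup.1 (show pointHomeomorph X P ∈ iSup U from hP)
    exact Opens.mem_iSup.2 ⟨i, hi⟩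
  obtain ⟨s, hs, hu⟩ := TopCat.Sheaf.existsUnique_gluing' X.sheaf (fun i => opensOf (U i))
    (opensOf (iSup U)) (fun i => homOfLE (hle i)) hcov (fun i => (sf i).down)
    fun i j => congrArg ULift.down (hsf i j)
  refine ⟨ULift.up s, fun i => congrArg ULift.up (hs i), fun t ht => ?_⟩
  exact congrArg ULift.up (hu t.down fun i => congrArg ULift.down (ht i))

/-- The sections over `U` defined by the endomorphisms of the structure sheaf. -/
def endToFunction : endPresheaf X ⟶ functionPresheaf X where
  app U := RingCat.ofHom (ULift.ringEquiv.symm.toRingHom.comp (endToSections U.unop))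
  naturality U V i := by
    ext φ
    exact congrArg ULift.up (endToSections_quotientEndMap i.unop.le φ)

instance : Presheaf.IsLocallyInjective (Opens.grothendieckTopology (SpecQcoh X))
    (endToFunction X) :=
  Presheaf.isLocallyInjective_of_injective _ _ fun U _ _ h =>
    injective_endToSections U.unop (congrArg ULift.down h)

/-- Affine open subsets are quasi-compact and form a basis, so `surjective_endToSections` applies
locally. -/
instance : Presheaf.IsLocallySurjective (Opens.grothendieckTopology (SpecQcoh X))
    (endToFunction X) where
  imageSieve_mem {U} t := by
    intro p hp
    obtain ⟨P, rfl⟩ := (pointHomeomorph X).surjective p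
    obtain ⟨W, hW, hPW, hWU⟩ := Opens.isBasis_iff_nbhd.1 X.isBasis_affineOpens
      (show P ∈ opensOf U from hp)
    let V : Opens (SpecQcoh X) := Opens.comap (pointHomeomorph X).symm W
    have hV : opensOf V = W := by
      ext Q
      exact iff_of_eq (congrArg (· ∈ W) ((pointHomeomorph X).symm_apply_apply Q))
    have hVU : V ≤ U := by
      intro q hq
      obtain ⟨Q, rfl⟩ := (pointHomeomorph X).surjective q
      have hQ : Q ∈ opensOf V := hq
      rw [hV] at hQ
      exact hWU hQ
    have hc : IsCompact (opensOf V : Set X) := by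
      rw [hV]
      exact hW.isCompact
    have hPV : P ∈ opensOf V := by rwa [hV]
    refine ⟨V, homOfLE hVU, ?_, hPV⟩
    obtain ⟨φ, hφ⟩ := surjective_endToSections hc
      (((functionPresheaf X).map (homOfLE hVU).op t).down)
    exact ⟨φ, congrArg ULift.up hφ⟩

/-- Sheafification turns a locally bijective map into an isomorphism, and the target is already a
sheaf. -/
lemma isIso_sheafifyLift : IsIso (sheafifyLift (Opens.grothendieckTopology (SpecQcoh X))
    (endToFunction X) (isSheaf_functionPresheaf X)) := by
  let J := Opens.grothendieckTopology (SpecQcoh X)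
  have h₁ : J.W (endToFunction X) := J.W_of_isLocallyBijective _
  have h₂ : J.W (sheafifyLift J (endToFunction X) (isSheaf_functionPresheaf X)) := by
    rw [← toSheafify_sheafifyLift J (endToFunction X) (isSheaf_functionPresheaf X)] at h₁
    exact J.W.of_precomp _ _ (J.W_toSheafify _) h₁
  let F : Sheaf J RingCat.{u + 1} := ⟨_, isSheaf_functionPresheaf X⟩
  let E : Sheaf J RingCat.{u + 1} := specQcohSheaf X
  let g : E ⟶ F :=
    ⟨sheafifyLift J (endToFunction X) (isSheaf_functionPresheaf X)⟩
  have h₃ : IsIso g := (J.W_sheafToPresheaf_map_iff_isIso g).1 h₂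
  exact (sheafToPresheaf J RingCat.{u + 1}).map_isIso g

/-- The sections of the structure sheaf of `Spec(Qcoh X)` are the functions on `X`. -/
def sheafEquiv (U : Opens (SpecQcoh X)) :
    (specQcohSheaf X).obj.obj (op U) ≃+* Γ(X, opensOf U) :=
  have := isIso_sheafifyLift X
  (asIso ((sheafifyLift (Opens.grothendieckTopology (SpecQcoh X)) (endToFunction X)
    (isSheaf_functionPresheaf X)).app (op U))).ringCatIsoToRingEquiv.trans ULift.ringEquiv

lemma sheafEquiv_map {U V : Opens (SpecQcoh X)} (h : V ≤ U)
    (s : (specQcohSheaf X).obj.obj (op U)) :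
    sheafEquiv X V ((specQcohSheaf X).obj.map (homOfLE h).op s) =
      resO (show opensOf V ≤ opensOf U from fun _ hx => h hx) (sheafEquiv X U s) :=
  congrArg ULift.down (congr($((sheafifyLift (Opens.grothendieckTopology (SpecQcoh X))
    (endToFunction X) (isSheaf_functionPresheaf X)).naturality (homOfLE h).op) s))

lemma sheafEquiv_toSpecQcohSheaf {U : Opens (SpecQcoh X)}
    (φ : End ((toQuotient (supportedAway U)).obj (structureModule X))) :
    sheafEquiv X U (toSpecQcohSheaf X U φ) = endToSections U φ :=
  congrArg ULift.down (congr(($(toSheafify_sheafifyLift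
    (Opens.grothendieckTopology (SpecQcoh X)) (endToFunction X)
    (isSheaf_functionPresheaf X))).app (op U) φ))

end StructureSheaf

end
end Reconstruction

open Reconstruction
theorem mainTheorem2 (X : Scheme.{u}) [CompactSpace X] [QuasiSeparatedSpace X] :
    (∀ D : Set (LatticeSpec X), IsOpen D ↔ ∃ A : TensorLocalizing X, D = LatticeSpec.basicOpen A) ∧
    ∃ f : X ≃ₜ SpecQcoh X, (∀ P : X, (f P).subcategory = vanishingAt P) ∧
      ∃ fSharp : ∀ U : Opens (SpecQcoh X),
          (specQcohSheaf X).obj.obj (op U) ≃+* Γ(X, Opens.comap f U),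
        (∀ (U V : Opens (SpecQcoh X)) (h : V ≤ U) (s : (specQcohSheaf X).obj.obj (op U)),
          fSharp V ((specQcohSheaf X).obj.map (homOfLE h).op s) =
            X.presheaf.map (homOfLE (show Opens.comap f V ≤ Opens.comap f U from
              fun _ hx => h hx)).op (fSharp U s)) ∧
        (∀ (U : Opens (SpecQcoh X))
          (φ : End ((toQuotient (supportedAway U)).obj (structureModule X)))
          (F : Qcoh X) (s a : structureModule X ⟶ F), (supportedAway U).isoModSerre s →
          φ ≫ (toQuotient (supportedAway U)).map s = (toQuotient (supportedAway U)).map a →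
          onSections s _ (fSharp U (toSpecQcohSheaf X U φ)) = onSections a _ 1) := by
  refine ⟨isOpen_iff_eq_basicOpen, pointHomeomorph X, subcategory_pointPrime, sheafEquiv X,
    fun U V h s => sheafEquiv_map X h s, fun U φ F s a _ h => ?_⟩
  rw [sheafEquiv_toSpecQcohSheaf]
  exact app_endToSections h
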